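/- **Theorem 2 (Metastability of the disordered Curie–Weiss–Potts model).** Let $q\ge 2$ and let $(J_{ij})_{1\le i<j<\infty}$ be i.i.d. real random variables on a probability space $(\Omega,\mathcal F,\mathbb P)$ with $\mathbb E[J_{12}]=1$ and such that $0$ lies in the interior of $\{\lambda\in\mathbb R:\mathbb E[e^{\lambda J_{12}}]<\infty\}$. On $\mathcal S_N=\{1,\dots,q\}^N$ put $$H_N(\sigma)=-\frac1N\sum_{1\le i<j\le N}J_{ij}\mathbf 1_{\{\sigma_i=\sigma_j\}},\qquad \widetilde H_N(\sigma)=-\frac1N\sum_{1\le i<j\le N}\mathbf 1_{\{\sigma_i=\sigma_j\}} .$$ For $\beta\ge0$ and a Hamiltonian $H$ on $\mathcal S_N$, let $\mu\propto e^{-\beta H}$ be its Gibbs measure and consider the discrete-time Markov chain on $\mathcal S_N$ with transition probabilities $\pi(\sigma,\eta)=(Nq)^{-1}e^{-\beta\max\{0,H(\eta)-H(\sigma)\}}$ if $\sigma,\eta$ differ in exactly one vertex, $\pi(\sigma,\eta)=0$ if they differ in more than one vertex, and $\pi(\sigma,\sigma)=1-\sum_{\eta\ne\sigma}\pi(\sigma,\eta)$.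 For $H=H_N$ this is the disordered (DCWP) chain, for $H=\widetilde H_N$ the mean-field (CWP) chain. Let $\tau_A=\inf\{t>0: \Sigma_t\in A\}$ and, for non-empty $A$, let $\mathrm P_{\mu|A}$ be the law of the chain started from $\mu$ conditioned on $A$. The chain is *$\rho$-metastable* with respect to non-empty, pairwise disjoint sets $M_i\subset\mathcal S_N$, $i\in I$, with union $M$, if $$|I|\;\frac{\max_{j\in I}\mathrm P_{\mu|M_j}[\tau_{M\setminus M_j}<\tau_{M_j}]}{\min_{\emptyset\ne X\subset\mathcal S_N\setminus M}\mathrm P_{\mu|X}[\tau_M<\tau_X]}\le\rho .$$ Let $\mathcal P=\{x\in[0,1]^q:\sum_kx_k=1\}$, $\mathcal P_N=\mathcal P\cap\frac1N\mathbb N_0^q$, and $\widetilde F_{\beta,q}(x)=-\frac12\|x\|_2^2+\frac1\beta\sum_k x_k\log x_k$ for $x\in\mathcal P$. Let $m_0=(1/q,\dots,1/q)$, and let $\beta_1(q)$ be the critical value above which local minima other than $m_0$ appear, that is, the infimum of all $\beta>0$ for which $\widetilde F_{\beta,q}$ has a local minimum on $\mathcal P$ other than $m_0$. For $1\le i\le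 q$ let $m_i\in\mathcal P$ have $i$-th coordinate $(1+(q-1)s)/q$ and all other coordinates $(1-s)/q$, where $s=s(\beta,q)$ is the largest solution of $\log(1+(q-1)s)-\log(1-s)=\beta s$. Let $\mathcal I_\beta=\{0,\dots,q\}$ if $\beta_1(q)<\beta<q$ and $\mathcal I_\beta=\{1,\dots,q\}$ if $\beta>\beta_1(q)$ and $\beta\ge q$. For $N\ge1$ and $i\in\mathcal I_\beta$ let $m_{i,N}\in\mathcal P_N$ be a point of $\mathcal P_N$ closest to $m_i$ in Euclidean distance (an arbitrary one if there are several), and let $\mathcal M_{i,N}$ be the set of all $\sigma\in\mathcal S_N$ whose vector of colour frequencies $\bigl(\frac1N|\{v:\sigma_v=k\}|\bigr)_{k=1}^q$ equals $m_{i,N}$. Let $\beta>\beta_1(q)$. Then: 1. there is $k_1=k_1(\beta,q)>0$ such that, for every choice of the $m_{i,N}$, the CWP chain is $e^{-k_1N}$-metastable with respect to $\{\mathcal M_{i,N}:i\in\mathcal I_\beta\}$ for all sufficiently large $N$; 2. for every choice of the $m_{i,N}$, every $k_1>0$ for which the CWP chain is $e^{-k_1N}$-metastable with respect to $\{\mathcal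 M_{i,N}:i\in\mathcal I_\beta\}$ for all sufficiently large $N$, and every $k_2\in(0,k_1)$: with $\mathbb P$-probability one, for all sufficiently large $N$ the DCWP chain is $e^{-k_2N}$-metastable with respect to the same sets $\{\mathcal M_{i,N}:i\in\mathcal I_\beta\}$. -/

import Mathlib

open MeasureTheory ProbabilityTheory Filter
open scoped NNReal ENNReal

noncomputable section

namespace Potts

/-! ### Configurations and Hamiltonians -/

/-- Configurations of `N` spins with `q` colours. -/
abbrev Config (N q : ℕ) : Type := Fin N → Fin q

/-- The Hamiltonian `-(1/N) ∑_{i<j} J_{ij} 1{σ_i = σ_j}` for a realisation `J` of the couplings.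
Vertices are numbered from `0`; only the entries `J i j` with `i < j` are used. -/
def hamiltonian {N q : ℕ} (J : ℕ → ℕ → ℝ) (σ : Config N q) : ℝ :=
  -(1 / (N : ℝ)) * ∑ i : Fin N, ∑ j : Fin N, if i < j ∧ σ i = σ j then J i j else 0

/-- The Hamiltonian of the mean-field model: all couplings are `1`. -/
def meanFieldHamiltonian {N q : ℕ} (σ : Config N q) : ℝ :=
  hamiltonian (fun _ _ => 1) σ

/-! ### Gibbs measure and Metropolis dynamics -/

/-- The partition function. -/
def partitionFunction {N q : ℕ} (β : ℝ≥0) (H : Config N q → ℝ) : ℝ :=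
  ∑ σ, Real.exp (-β * H σ)

/-- The Gibbs measure at inverse temperature `β`. -/
def gibbs {N q : ℕ} (β : ℝ≥0) (H : Config N q → ℝ) : Measure (Config N q) :=
  ∑ σ, ENNReal.ofReal (Real.exp (-β * H σ) / partitionFunction β H) • Measure.dirac σ

/-- The Metropolis transition probabilities between distinct configurations. -/
def flipProb {N q : ℕ} (β : ℝ≥0) (H : Config N q → ℝ) (σ η : Config N q) : ℝ :=
  if hammingDist σ η = 1 then ((N : ℝ) * q)⁻¹ * Real.exp (-β * max 0 (H η - H σ)) else 0

/-- The Glauber-Metropolis transition matrix. -/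
def transProb {N q : ℕ} (β : ℝ≥0) (H : Config N q → ℝ) (σ η : Config N q) : ℝ :=
  if σ = η then 1 - ∑ ζ ∈ Finset.univ.erase σ, flipProb β H σ ζ else flipProb β H σ η

theorem flipProb_nonneg {N q : ℕ} (β : ℝ≥0) (H : Config N q → ℝ) (σ η : Config N q) :
    0 ≤ flipProb β H σ η := by
  unfold flipProb
  split_ifs <;> positivity

theorem card_neighbours_le {N q : ℕ} (σ : Config N q) :
    (Finset.univ.filter fun η : Config N q => hammingDist σ η = 1).card ≤ N * q := by
  have hsub : (Finset.univ.filter fun η : Config N q => hammingDist σ η = 1) ⊆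
      Finset.univ.image fun p : Fin N × Fin q => Function.update σ p.1 p.2 := by
    intro η hη
    rw [Finset.mem_filter, hammingDist, Finset.card_eq_one] at hη
    obtain ⟨i, hi⟩ := hη.2
    refine Finset.mem_image.2 ⟨(i, η i), Finset.mem_univ _, ?_⟩
    funext j
    by_cases hj : j = i
    · subst hj; simp
    · have : j ∉ Finset.univ.filter fun k => σ k ≠ η k := by rw [hi]; simpa using hj
      simpa [Function.update_of_ne hj] using this
  calc _ ≤ _ := Finset.card_le_card hsub
    _ ≤ _ := Finset.card_image_le
    _ = N * q := by simp

theorem sum_flipProb_le_one {N q : ℕ} (β : ℝ≥0) (H : Config N q → ℝ) (σ : Config N q) :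
    ∑ ζ ∈ Finset.univ.erase σ, flipProb β H σ ζ ≤ 1 := by
  have hle : ∀ ζ, flipProb β H σ ζ ≤ if hammingDist σ ζ = 1 then ((N : ℝ) * q)⁻¹ else 0 := by
    intro ζ
    unfold flipProb
    split_ifs
    · refine mul_le_of_le_one_right (by positivity) (Real.exp_le_one_iff.2 ?_)
      have := mul_nonneg β.coe_nonneg (le_max_left 0 (H ζ - H σ))
      linarith
    · exact le_rfl
  calc ∑ ζ ∈ Finset.univ.erase σ, flipProb β H σ ζ
      ≤ ∑ ζ, flipProb β H σ ζ :=
        Finset.sum_le_sum_of_subset_of_nonneg (Finset.erase_subset _ _)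
          fun _ _ _ => flipProb_nonneg _ _ _ _
    _ ≤ ∑ ζ, if hammingDist σ ζ = 1 then ((N : ℝ) * q)⁻¹ else 0 :=
        Finset.sum_le_sum fun ζ _ => hle ζ
    _ = ((Finset.univ.filter fun η : Config N q => hammingDist σ η = 1).card : ℝ)
          * ((N : ℝ) * q)⁻¹ := by
        rw [← Finset.sum_filter, Finset.sum_const, nsmul_eq_mul]
    _ ≤ ((N : ℝ) * q) * ((N : ℝ) * q)⁻¹ := by
        gcongr
        exact_mod_cast card_neighbours_le σ
    _ ≤ 1 := mul_inv_le_one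

theorem transProb_nonneg {N q : ℕ} (β : ℝ≥0) (H : Config N q → ℝ) (σ η : Config N q) :
    0 ≤ transProb β H σ η := by
  unfold transProb
  split_ifs
  · linarith [sum_flipProb_le_one β H σ]
  · exact flipProb_nonneg _ _ _ _

theorem sum_transProb {N q : ℕ} (β : ℝ≥0) (H : Config N q → ℝ) (σ : Config N q) :
    ∑ η, transProb β H σ η = 1 := by
  rw [← Finset.add_sum_erase _ _ (Finset.mem_univ σ)]
  have : ∑ η ∈ Finset.univ.erase σ, transProb β H σ η =
      ∑ η ∈ Finset.univ.erase σ, flipProb β H σ η :=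
    Finset.sum_congr rfl fun η hη => if_neg (Finset.ne_of_mem_erase hη).symm
  rw [this]
  simp [transProb]

/-- The one-step transition kernel of the Metropolis chain. -/
def stepKernel {N q : ℕ} (β : ℝ≥0) (H : Config N q → ℝ) : Kernel (Config N q) (Config N q) :=
  Kernel.ofFunOfCountable fun σ => ∑ η, ENNReal.ofReal (transProb β H σ η) • Measure.dirac η

instance {N q : ℕ} (β : ℝ≥0) (H : Config N q → ℝ) : IsMarkovKernel (stepKernel β H) where
  isProbabilityMeasure σ := ⟨by
    change (∑ η, ENNReal.ofReal (transProb β H σ η) • Measure.dirac η) Set.univ = 1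
    simp only [Measure.coe_finsetSum, Finset.sum_apply, Measure.smul_apply, measure_univ,
      smul_eq_mul, mul_one]
    rw [← ENNReal.ofReal_sum_of_nonneg fun η _ => transProb_nonneg β H σ η, sum_transProb,
      ENNReal.ofReal_one]⟩

/-- The law, on the space of trajectories, of the Metropolis chain with initial distribution `ν`. -/
def chainLaw {N q : ℕ} (β : ℝ≥0) (H : Config N q → ℝ) (ν : Measure (Config N q)) :
    Measure (ℕ → Config N q) :=
  Kernel.trajMeasure (X := fun _ => Config N q) ν fun n =>
    (stepKernel β H).comap (fun h : (i : Finset.Iic n) → Config N q =>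
      h ⟨n, Finset.mem_Iic.2 le_rfl⟩) (by fun_prop)

/-- The first return time `inf {t > 0 : x_t ∈ A}`, equal to `⊤` if there is no such `t`. -/
def returnTime {S : Type*} (A : Set S) (x : ℕ → S) : ℕ∞ :=
  ⨅ (t : ℕ) (_ : 0 < t ∧ x t ∈ A), (t : ℕ∞)

/-- The probability that the chain, started from the Gibbs measure conditioned on `A`,
visits `B` before it returns to `A`. -/
def escapeProb {N q : ℕ} (β : ℝ≥0) (H : Config N q → ℝ) (A B : Set (Config N q)) : ℝ≥0∞ :=
  chainLaw β H (cond (gibbs β H) A) {x | returnTime B x < returnTime A x}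

/-- `ρ`-metastability of the Metropolis chain with respect to the collection `M i`, `i ∈ I`, of
non-empty, pairwise disjoint sets. In the denominator `X` runs through the non-empty sets of
configurations outside the union of the `M i`. -/
def IsMetastable {N q : ℕ} {ι : Type*} (β : ℝ≥0) (H : Config N q → ℝ)
    (I : Finset ι) (M : ι → Set (Config N q)) (ρ : ℝ) : Prop :=
  (∀ i ∈ I, (M i).Nonempty) ∧ (I : Set ι).PairwiseDisjoint M ∧
  (I.card : ℝ≥0∞) * (⨆ j ∈ I, escapeProb β H (M j) ((⋃ i ∈ I, M i) \ M j)) /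
      (⨅ (X : Set (Config N q)) (_ : X.Nonempty ∧ X ⊆ (⋃ i ∈ I, M i)ᶜ),
        escapeProb β H X (⋃ i ∈ I, M i))
    ≤ ENNReal.ofReal ρ

/-! ### Free energy and its local minima -/

/-- The limiting free energy of the mean-field model on the simplex. -/
def freeEnergy {q : ℕ} (β : ℝ) (x : Fin q → ℝ) : ℝ :=
  -(1 / 2) * ∑ k, x k ^ 2 + 1 / β * ∑ k, x k * Real.log (x k)

/-- The critical value `β₁(q)`: above it, and not below it, the free energy has local minima on
the simplex other than the uniform vector `(1/q, …, 1/q)`. -/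
def betaOne (q : ℕ) : ℝ :=
  sInf {β : ℝ | 0 < β ∧ ∃ x ∈ stdSimplex ℝ (Fin q), x ≠ (fun _ => 1 / (q : ℝ)) ∧
    IsLocalMinOn (freeEnergy β) (stdSimplex ℝ (Fin q)) x}

/-- The largest solution `s` of `log (1 + (q-1) s) - log (1 - s) = β s`. -/
def order (q : ℕ) (β : ℝ) : ℝ :=
  sSup {s : ℝ | 0 < 1 + ((q : ℝ) - 1) * s ∧ 0 < 1 - s ∧
    Real.log (1 + ((q : ℝ) - 1) * s) - Real.log (1 - s) = β * s}

/-- The points `m_0, m_1, …, m_q`; the colour `k : Fin q` belongs to the index `k.succ`. -/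
def minimum (q : ℕ) (β : ℝ) (i : Fin (q + 1)) (k : Fin q) : ℝ :=
  if i = 0 then 1 / (q : ℝ)
  else if k.succ = i then (1 + ((q : ℝ) - 1) * order q β) / q
  else (1 - order q β) / q

/-- The index set `{0, …, q}` if `β < q`, and `{1, …, q}` if `β ≥ q`. -/
def indexSet (q : ℕ) (β : ℝ) : Finset (Fin (q + 1)) :=
  if β < q then Finset.univ else Finset.univ.erase 0

/-! ### Metastable sets -/

/-- The vector of colour frequencies of a configuration. -/
def empirical {N q : ℕ} (σ : Config N q) (k : Fin q) : ℝ :=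
  ((Finset.univ.filter fun i => σ i = k).card : ℝ) / N

/-- The points of the simplex with coordinates in `ℕ / N`. -/
def latticeSimplex (N q : ℕ) : Set (Fin q → ℝ) :=
  {x | x ∈ stdSimplex ℝ (Fin q) ∧ ∀ k, ∃ n : ℕ, x k = (n : ℝ) / N}

/-- `m N i` is, for every `N ≥ 1` and `i` in the index set, a lattice point closest
(in Euclidean distance) to the minimum with index `i`. -/
def IsLatticeApprox (q : ℕ) (β : ℝ) (m : ℕ → Fin (q + 1) → Fin q → ℝ) : Prop :=
  ∀ N : ℕ, 1 ≤ N → ∀ i ∈ indexSet q β, m N i ∈ latticeSimplex N q ∧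
    ∀ y ∈ latticeSimplex N q,
      ∑ k, (m N i k - minimum q β i k) ^ 2 ≤ ∑ k, (y k - minimum q β i k) ^ 2

/-- The set of configurations whose vector of colour frequencies is `m N i`. -/
def metastableSet {q : ℕ} (m : ℕ → Fin (q + 1) → Fin q → ℝ) (N : ℕ) (i : Fin (q + 1)) :
    Set (Config N q) :=
  {σ | empirical σ = m N i}

/-- For all large `N`, the mean-field chain is `exp (-k N)`-metastable. -/
def MeanFieldMetastable (q : ℕ) (β : ℝ≥0) (m : ℕ → Fin (q + 1) → Fin q → ℝ) (k : ℝ) : Prop :=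
  ∃ N₀ : ℕ, ∀ N : ℕ, N₀ < N →
    IsMetastable β (meanFieldHamiltonian (N := N) (q := q)) (indexSet q β) (metastableSet m N)
      (Real.exp (-k * N))

/-- The event that the disordered chain with `N` spins is `exp (-k N)`-metastable. -/
def metastableEvent {Ω : Type*} (J : ℕ → ℕ → Ω → ℝ) (q : ℕ) (β : ℝ≥0)
    (m : ℕ → Fin (q + 1) → Fin q → ℝ) (k : ℝ) (N : ℕ) : Set Ω :=
  {ω | IsMetastable β (hamiltonian (N := N) (q := q) fun i j => J i j ω) (indexSet q β)
    (metastableSet m N) (Real.exp (-k * N))}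

end Potts

end

/-!
The event `{τ_B < τ_A}` under `P_{μ|A}` has probability `cap(A, B) / μ(A)`, where `cap` is the
capacity of a reversible network. By the Dirichlet principle, a change of the Hamiltonian by at most
`δN` thus changes all these probabilities, and hence the quotient which defines metastability, by
factors `exp(O(δN))` only. A Chernoff bound, a union bound over the `q ^ N` configurations and the
Borel–Cantelli lemma show that almost surely `|H_N - H̃_N| ≤ δN` for all large `N`.

For the mean-field chain, capacities are governed by the free energy of the colour frequencies,
because all configurations of the same frequencies are equivalent. As the `m_i` are the only local
minima, a path along which the free energy hardly increases leads from every configuration to a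
metastable set, which makes the denominator at least `exp(-o(N))`; the free energy barrier around
each `m_i` makes the numerator exponentially small.
-/

noncomputable section

namespace Potts

/-! ### Markov chains and killed chains -/

section MarkovChain

variable {S : Type*} [MeasurableSpace S]

/-- The law on trajectories of the time-homogeneous Markov chain with transition kernel `K` and
initial distribution `ν`. -/
def markovLaw (K : Kernel S S) [IsMarkovKernel K] (ν : Measure S) : Measure (ℕ → S) :=
  Kernel.trajMeasure (X := fun _ => S) ν fun n =>
    K.comap (fun h : (i : Finset.Iic n) → S => h ⟨n, Finset.mem_Iic.2 le_rfl⟩) (by fun_prop)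

instance (K : Kernel S S) [IsMarkovKernel K] (ν : Measure S) [IsProbabilityMeasure ν] :
    IsProbabilityMeasure (markovLaw K ν) := by
  unfold markovLaw
  infer_instance

/-- The transition operator of the chain killed when it is in `C`. -/
def killedStep (K : Kernel S S) (C : Set S) (g : S → ℝ≥0∞) : S → ℝ≥0∞ :=
  Cᶜ.indicator fun x => ∫⁻ y, g y ∂(K x)

/-- The probability that the chain with kernel `K` visits `B`, and does so before visiting `A`,
time `0` included, as a function of the starting point. -/
def hittingProb (K : Kernel S S) (A B : Set S) (x : S) : ℝ≥0∞ :=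
  ∑' n, (killedStep K (A ∪ B))^[n] (B.indicator 1) x

variable {K : Kernel S S} {A B C : Set S}

lemma killedStep_of_mem {x : S} (hx : x ∈ C) (g : S → ℝ≥0∞) : killedStep K C g x = 0 :=
  Set.indicator_of_notMem (s := Cᶜ) (not_not.2 hx) _

lemma killedStep_of_notMem {x : S} (hx : x ∉ C) (g : S → ℝ≥0∞) :
    killedStep K C g x = ∫⁻ y, g y ∂(K x) :=
  Set.indicator_of_mem (s := Cᶜ) hx _

lemma measurable_killedStep (hC : MeasurableSet C) {g : S → ℝ≥0∞} (hg : Measurable g) :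
    Measurable (killedStep K C g) :=
  hg.lintegral_kernel.indicator hC.compl

lemma measurable_killedStep_iterate (hC : MeasurableSet C) {g : S → ℝ≥0∞} (hg : Measurable g)
    (n : ℕ) : Measurable ((killedStep K C)^[n] g) := by
  induction n with
  | zero => exact hg
  | succ n ih =>
    rw [Function.iterate_succ_apply']
    exact measurable_killedStep hC ih

lemma hittingProb_eq_indicator_add (x : S) :
    hittingProb K A B x = B.indicator 1 x +
      ∑' n, (killedStep K (A ∪ B))^[n + 1] (B.indicator 1) x := by
  rw [hittingProb, tsum_eq_zero_add' ENNReal.summable, Function.iterate_zero, id]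

lemma hittingProb_of_mem_union {x : S} (hx : x ∈ A ∪ B) :
    hittingProb K A B x = B.indicator 1 x := by
  simp only [hittingProb_eq_indicator_add, Function.iterate_succ_apply', killedStep_of_mem hx,
    tsum_zero, add_zero]

lemma hittingProb_of_notMem_union (hA : MeasurableSet A) (hB : MeasurableSet B) {x : S}
    (hx : x ∉ A ∪ B) : hittingProb K A B x = ∫⁻ y, hittingProb K A B y ∂(K x) := by
  simp only [hittingProb_eq_indicator_add x, Function.iterate_succ_apply', killedStep_of_notMem hx,
    Set.indicator_of_notMem fun h => hx (Or.inr h), zero_add]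
  exact (lintegral_tsum fun n => (measurable_killedStep_iterate (hA.union hB)
    (measurable_one.indicator hB) n).aemeasurable).symm

lemma coe_lt_returnTime_iff {S : Type*} {A : Set S} {x : ℕ → S} {t : ℕ} :
    (t : ℕ∞) < returnTime A x ↔ ∀ s, 0 < s → s ≤ t → x s ∉ A := by
  rw [← ENat.add_one_le_iff (ENat.natCast_ne_top t), returnTime]
  simp only [le_iInf_iff]
  refine forall_congr' fun s => ⟨fun h hs hst hA => ?_, fun h hs => ?_⟩
  · have : t + 1 ≤ s := by exact_mod_cast h ⟨hs, hA⟩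
    omega
  · have : ¬ s ≤ t := fun hst => h hs.1 hst hs.2
    exact_mod_cast (by omega : t + 1 ≤ s)

lemma returnTime_lt_returnTime_iff {S : Type*} {A B : Set S} (hAB : Disjoint A B) {x : ℕ → S} :
    returnTime B x < returnTime A x ↔
      ∃ n, (∀ s : Fin n, x (s + 1) ∈ (A ∪ B)ᶜ) ∧ x (n + 1) ∈ B := by
  classical
  have hlt : returnTime B x < returnTime A x ↔
      ∃ t, (0 < t ∧ x t ∈ B) ∧ ∀ s, 0 < s → s ≤ t → x s ∉ A := by
    rw [returnTime]
    simp only [iInf_lt_iff, exists_prop, coe_lt_returnTime_iff]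
  rw [hlt]
  constructor
  · rintro ⟨t, htB, htA⟩
    have hex : ∃ t, 0 < t ∧ x t ∈ B := ⟨t, htB⟩
    obtain ⟨n, hn⟩ := Nat.exists_eq_add_one_of_ne_zero (Nat.find_spec hex).1.ne'
    refine ⟨n, fun s hs => ?_, hn ▸ (Nat.find_spec hex).2⟩
    have hfirst : (s : ℕ) + 1 < Nat.find hex := by omega
    exact hs.elim (htA _ s.1.succ_pos (hfirst.le.trans (Nat.find_min' hex htB)))
      fun h => Nat.find_min hex hfirst ⟨s.1.succ_pos, h⟩
  · rintro ⟨n, hn, hB⟩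
    refine ⟨n + 1, ⟨n.succ_pos, hB⟩, fun s hs hsn hA => ?_⟩
    obtain rfl | hlt := hsn.eq_or_lt
    · exact Set.disjoint_left.1 hAB hA hB
    · exact hn ⟨s - 1, by omega⟩ (Or.inl (by rwa [Nat.sub_add_cancel hs]))

variable [IsMarkovKernel K] (ν : Measure S)

variable (K) in
lemma map_markovLaw_zero : (markovLaw K ν).map (fun x => x 0) = ν := by
  have h : (fun x : ℕ → S => x 0) =
      (fun y : (i : Finset.Iic 0) → S => y ⟨0, by simp⟩) ∘ Preorder.frestrictLe 0 := rfl
  rw [h, ← Measure.map_map (by fun_prop) (by fun_prop), markovLaw, Kernel.trajMeasure,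
    Measure.map_comp _ _ (by fun_prop), Kernel.traj_map_frestrictLe, Kernel.partialTraj_self,
    Measure.id_comp, Measure.map_map (by fun_prop) (by fun_prop)]
  exact Measure.map_id

variable [IsProbabilityMeasure ν]

lemma lintegral_markovLaw_succ (n : ℕ) {F : ((i : Finset.Iic n) → S) → ℝ≥0∞} (hF : Measurable F)
    {g : S → ℝ≥0∞} (hg : Measurable g) :
    ∫⁻ x, F (Preorder.frestrictLe n x) * g (x (n + 1)) ∂(markovLaw K ν) =
      ∫⁻ x, F (Preorder.frestrictLe n x) * ∫⁻ y, g y ∂(K (x n)) ∂(markovLaw K ν) := by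
  have hcompProd : (markovLaw K ν).map (Preorder.frestrictLe n) ⊗ₘ
      K.comap (fun h : (i : Finset.Iic n) → S => h ⟨n, Finset.mem_Iic.2 le_rfl⟩) (by fun_prop) =
      (markovLaw K ν).map fun x => (Preorder.frestrictLe n x, x (n + 1)) :=
    Kernel.map_frestrictLe_trajMeasure_compProd_eq_map_trajMeasure (X := fun _ => S)
  calc ∫⁻ x, F (Preorder.frestrictLe n x) * g (x (n + 1)) ∂(markovLaw K ν)
      = ∫⁻ p, F p.1 * g p.2 ∂((markovLaw K ν).map
          (fun x : ℕ → S => (Preorder.frestrictLe n x, x (n + 1)))) := by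
        rw [lintegral_map (by fun_prop) (by fun_prop)]
    _ = ∫⁻ x, ∫⁻ y, F (Preorder.frestrictLe n x) * g y ∂(K (x n)) ∂(markovLaw K ν) := by
        rw [← hcompProd, Measure.lintegral_compProd (by fun_prop),
          lintegral_map (by fun_prop) (by fun_prop)]
        simp only [Kernel.comap_apply, Preorder.frestrictLe_apply]
    _ = _ := lintegral_congr fun x => lintegral_const_mul _ hg

/-- Integrating out the last step kills the chain once more, which gives an induction on `n`. -/
lemma lintegral_markovLaw_prod_indicator (hC : MeasurableSet C) (n : ℕ) {g : S → ℝ≥0∞}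
    (hg : Measurable g) :
    ∫⁻ x, (∏ s : Fin n, Cᶜ.indicator 1 (x (s + 1))) * g (x (n + 1)) ∂(markovLaw K ν) =
      ∫⁻ x, ∫⁻ y, (killedStep K C)^[n] g y ∂(K x) ∂ν := by
  have hone : Measurable (Cᶜ.indicator (1 : S → ℝ≥0∞)) := measurable_one.indicator hC.compl
  induction n generalizing g with
  | zero =>
    have hstep := lintegral_markovLaw_succ (K := K) ν 0 (measurable_const (a := 1)) hg
    have hK : Measurable fun x => ∫⁻ y, g y ∂(K x) := hg.lintegral_kernel
    simp only [one_mul, zero_add] at hstep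
    simp only [Finset.univ_eq_empty, Finset.prod_empty, one_mul, zero_add, hstep,
      Function.iterate_zero, id]
    rw [← lintegral_map (f := fun x => ∫⁻ y, g y ∂(K x)) hK (by fun_prop), map_markovLaw_zero]
  | succ n ih =>
    have hkilled : ∀ x, Cᶜ.indicator 1 x * ∫⁻ y, g y ∂(K x) = killedStep K C g x := fun x => by
      by_cases hx : x ∈ C
      · rw [killedStep_of_mem hx, Set.indicator_of_notMem (s := Cᶜ) (not_not.2 hx), zero_mul]
      · rw [killedStep_of_notMem hx, Set.indicator_of_mem (s := Cᶜ) hx, Pi.one_apply, one_mul]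
    rw [Function.iterate_succ_apply, ← ih (measurable_killedStep hC hg)]
    have hstep := lintegral_markovLaw_succ (K := K) ν (n + 1)
      (F := fun y => ∏ s : Fin (n + 1), Cᶜ.indicator 1 (y ⟨s + 1, Finset.mem_Iic.2 s.2⟩))
      (Finset.measurable_prod _ fun s _ => hone.comp (measurable_pi_apply _)) hg
    refine hstep.trans (lintegral_congr fun x => ?_)
    rw [← hkilled, ← mul_assoc]
    exact congrArg (· * _) (Fin.prod_univ_castSucc _)

theorem markovLaw_returnTime_lt (hA : MeasurableSet A) (hB : MeasurableSet B)
    (hAB : Disjoint A B) :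
    markovLaw K ν {x | returnTime B x < returnTime A x} =
      ∫⁻ x, ∫⁻ y, hittingProb K A B y ∂(K x) ∂ν := by
  let E (n : ℕ) : Set (ℕ → S) := {x | (∀ s : Fin n, x (s + 1) ∈ (A ∪ B)ᶜ) ∧ x (n + 1) ∈ B}
  have hE : ∀ n, MeasurableSet (E n) := fun n => by
    have hprev : MeasurableSet {x : ℕ → S | ∀ s : Fin n, x (s + 1) ∈ (A ∪ B)ᶜ} := by
      simp only [Set.ofPred_forall]
      exact .iInter fun s => measurable_pi_apply _ (hA.union hB).compl
    exact hprev.inter (measurable_pi_apply (n + 1) hB)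
  have hdisj : Pairwise (Function.onFun Disjoint E) :=
    (pairwise_disjoint_on E).2 fun m n hmn => Set.disjoint_left.2 fun x hm hn =>
      hn.1 ⟨m, hmn⟩ (Or.inr hm.2)
  have hmeasure : ∀ n, markovLaw K ν (E n) =
      ∫⁻ x, ∫⁻ y, (killedStep K (A ∪ B))^[n] (B.indicator 1) y ∂(K x) ∂ν := fun n => by
    classical
    rw [← lintegral_markovLaw_prod_indicator ν (hA.union hB) n (measurable_one.indicator hB),
      ← lintegral_indicator_one (hE n)]
    refine lintegral_congr fun x => ?_
    simp only [Set.indicator_apply, Pi.one_apply, Finset.prod_ite_zero, Finset.prod_const_one,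
      Finset.mem_univ, forall_const, ite_zero_mul_ite_zero, mul_one]
    rfl
  have hmeas : ∀ n, Measurable ((killedStep K (A ∪ B))^[n] (B.indicator 1)) :=
    measurable_killedStep_iterate (hA.union hB) (measurable_one.indicator hB)
  have hset : {x | returnTime B x < returnTime A x} = ⋃ n, E n := by
    ext x
    simp only [E, Set.mem_ofPred_eq, returnTime_lt_returnTime_iff hAB, Set.mem_iUnion]
  simp only [hset, measure_iUnion hdisj hE, hmeasure, hittingProb]
  rw [← lintegral_tsum fun n => (hmeas n).lintegral_kernel.aemeasurable]
  exact lintegral_congr fun x => (lintegral_tsum fun n => (hmeas n).aemeasurable).symm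

theorem hittingProb_le_one (hA : MeasurableSet A) (hB : MeasurableSet B) (hAB : Disjoint A B)
    (x : S) : hittingProb K A B x ≤ 1 := by
  by_cases hx : x ∈ A ∪ B
  · rw [hittingProb_of_mem_union hx]
    exact Set.indicator_le_self' (fun _ _ => zero_le) x
  · have hmeas : Measurable fun z => ∫⁻ y, hittingProb K A B y ∂(K z) :=
      (Measurable.tsum fun n => measurable_killedStep_iterate (hA.union hB)
        (measurable_one.indicator hB) n).lintegral_kernel
    rw [hittingProb_of_notMem_union hA hB hx, ← lintegral_dirac' x hmeas,
      ← markovLaw_returnTime_lt (Measure.dirac x) hA hB hAB]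
    exact prob_le_one

end MarkovChain

/-! ### Electrical networks and the Dirichlet principle -/

section Network

variable {S : Type*} [Fintype S] {c c' : S → S → ℝ} {A B : Set S} {f g : S → ℝ}

/-- The Dirichlet form of the finite network with conductances `c`; each edge is counted once. -/
def dirichletForm (c : S → S → ℝ) (f : S → ℝ) : ℝ :=
  1 / 2 * ∑ x, ∑ y, c x y * (f x - f y) ^ 2

/-- The Laplacian of the network with conductances `c`, with the sign that makes it
positive semidefinite. -/
def laplacian (c : S → S → ℝ) (f : S → ℝ) (x : S) : ℝ :=
  ∑ y, c x y * (f x - f y)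

/-- The capacity between `A` and `B`: the minimal energy of a potential equal to `1` on `A` and to
`0` on `B`. It is the junk value `0` unless `A` and `B` are disjoint. -/
def capacity (c : S → S → ℝ) (A B : Set S) : ℝ :=
  sInf (dirichletForm c '' {f | (∀ x ∈ A, f x = 1) ∧ ∀ x ∈ B, f x = 0})

lemma dirichletForm_nonneg (hc : ∀ x y, 0 ≤ c x y) (f : S → ℝ) : 0 ≤ dirichletForm c f :=
  mul_nonneg (by norm_num) <| Finset.sum_nonneg fun x _ => Finset.sum_nonneg fun y _ =>
    mul_nonneg (hc x y) (sq_nonneg _)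

lemma dirichletForm_le_mul {K : ℝ} (h : ∀ x y, c' x y ≤ K * c x y) (f : S → ℝ) :
    dirichletForm c' f ≤ K * dirichletForm c f := by
  simp only [dirichletForm, Finset.mul_sum]
  refine Finset.sum_le_sum fun x _ => Finset.sum_le_sum fun y _ => ?_
  have := mul_le_mul_of_nonneg_right (h x y) (sq_nonneg (f x - f y))
  linarith

lemma sum_mul_laplacian (hc : ∀ x y, c x y = c y x) (f g : S → ℝ) :
    ∑ x, f x * laplacian c g x = 1 / 2 * ∑ x, ∑ y, c x y * ((f x - f y) * (g x - g y)) := by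
  have hswap : ∑ x, ∑ y, c x y * (f x * (g x - g y)) = ∑ x, ∑ y, c x y * (f y * (g y - g x)) := by
    rw [Finset.sum_comm]
    simp only [hc]
  calc ∑ x, f x * laplacian c g x = ∑ x, ∑ y, c x y * (f x * (g x - g y)) := by
        simp only [laplacian, Finset.mul_sum, mul_left_comm]
    _ = 1 / 2 * (∑ x, ∑ y, c x y * (f x * (g x - g y)) +
          ∑ x, ∑ y, c x y * (f y * (g y - g x))) := by rw [← hswap]; ring
    _ = _ := by
        simp only [← Finset.sum_add_distrib, ← mul_add]
        congr 1
        exact Finset.sum_congr rfl fun x _ => Finset.sum_congr rfl fun y _ => by ring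

lemma dirichletForm_eq_sum_mul_laplacian (hc : ∀ x y, c x y = c y x) (f : S → ℝ) :
    dirichletForm c f = ∑ x, f x * laplacian c f x := by
  simp only [sum_mul_laplacian hc, dirichletForm, sq]

/-- A potential that is harmonic off a set `D` is orthogonal to the functions vanishing on `D`. -/
lemma dirichletForm_le_of_harmonic (hc0 : ∀ x y, 0 ≤ c x y) (hc : ∀ x y, c x y = c y x) {D : Set S}
    (hg : ∀ x ∉ D, laplacian c g x = 0) (hfg : ∀ x ∈ D, f x = g x) :
    dirichletForm c g ≤ dirichletForm c f := by
  have horth : ∑ x, (f x - g x) * laplacian c g x = 0 := Finset.sum_eq_zero fun x _ => by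
    by_cases hx : x ∈ D
    · rw [hfg x hx, sub_self, zero_mul]
    · rw [hg x hx, mul_zero]
  have hexpand : dirichletForm c f = dirichletForm c (f - g) + dirichletForm c g +
      2 * ∑ x, (f x - g x) * laplacian c g x := by
    rw [sum_mul_laplacian hc (fun x => f x - g x)]
    simp only [dirichletForm, Finset.mul_sum, ← Finset.sum_add_distrib, Pi.sub_apply]
    exact Finset.sum_congr rfl fun x _ => Finset.sum_congr rfl fun y _ => by ring
  rw [hexpand, horth]
  linarith [dirichletForm_nonneg hc0 (f - g)]

lemma capacity_le_dirichletForm (hc : ∀ x y, 0 ≤ c x y) (hA : ∀ x ∈ A, f x = 1)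
    (hB : ∀ x ∈ B, f x = 0) : capacity c A B ≤ dirichletForm c f :=
  csInf_le ⟨0, Set.forall_mem_image.2 fun f _ => dirichletForm_nonneg hc f⟩ ⟨f, ⟨hA, hB⟩, rfl⟩

lemma le_capacity (hAB : Disjoint A B) {a : ℝ}
    (h : ∀ f : S → ℝ, (∀ x ∈ A, f x = 1) → (∀ x ∈ B, f x = 0) → a ≤ dirichletForm c f) :
    a ≤ capacity c A B :=
  le_csInf (Set.Nonempty.image _ ⟨A.indicator 1, fun _ hx => Set.indicator_of_mem hx _,
    fun _ hx => Set.indicator_of_notMem (Set.disjoint_right.1 hAB hx) _⟩)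
    (Set.forall_mem_image.2 fun f hf => h f hf.1 hf.2)

lemma capacity_nonneg (hc : ∀ x y, 0 ≤ c x y) (A B : Set S) : 0 ≤ capacity c A B :=
  Real.sInf_nonneg (Set.forall_mem_image.2 fun f _ => dirichletForm_nonneg hc f)

lemma capacity_le_mul {K : ℝ} (hK : 0 < K) (hc' : ∀ x y, 0 ≤ c' x y)
    (h : ∀ x y, c' x y ≤ K * c x y) (hAB : Disjoint A B) :
    capacity c' A B ≤ K * capacity c A B := by
  rw [← div_le_iff₀' hK]
  refine le_capacity hAB fun f hA hB => ?_
  rw [div_le_iff₀' hK]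
  exact (capacity_le_dirichletForm hc' hA hB).trans (dirichletForm_le_mul h f)

lemma capacity_eq_sum_laplacian (hc0 : ∀ x y, 0 ≤ c x y) (hc : ∀ x y, c x y = c y x)
    (hAB : Disjoint A B) (hA : ∀ x ∈ A, g x = 1) (hB : ∀ x ∈ B, g x = 0)
    (hg : ∀ x ∉ A ∪ B, laplacian c g x = 0) :
    capacity c A B = ∑ x, A.indicator (laplacian c g) x := by
  have henergy : dirichletForm c g = ∑ x, A.indicator (laplacian c g) x := by
    rw [dirichletForm_eq_sum_mul_laplacian hc]
    refine Finset.sum_congr rfl fun x _ => ?_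
    by_cases hxA : x ∈ A
    · rw [hA x hxA, one_mul, Set.indicator_of_mem hxA]
    rw [Set.indicator_of_notMem hxA]
    by_cases hxB : x ∈ B
    · rw [hB x hxB, zero_mul]
    · rw [hg x (by simp [hxA, hxB]), mul_zero]
  rw [← henergy]
  refine (capacity_le_dirichletForm hc0 hA hB).antisymm
    (le_capacity hAB fun f hfA hfB => dirichletForm_le_of_harmonic hc0 hc hg ?_)
  rintro x (hx | hx)
  · rw [hfA x hx, hA x hx]
  · rw [hfB x hx, hB x hx]

end Network

/-! ### The escape probability as a capacity -/

section Metropolis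

variable {N q : ℕ} (β : ℝ≥0) (H : Config N q → ℝ)

/-- The unnormalised Gibbs weight. -/
def weight (σ : Config N q) : ℝ :=
  Real.exp (-β * H σ)

/-- The total Gibbs weight of a set of configurations. -/
def setWeight (A : Set (Config N q)) : ℝ :=
  ∑ σ, A.indicator (weight β H) σ

/-- The conductances of the reversible network underlying the Metropolis chain: the Gibbs weight
times the transition probability between distinct configurations. -/
def conductance (σ η : Config N q) : ℝ :=
  if hammingDist σ η = 1 then ((N : ℝ) * q)⁻¹ * Real.exp (-β * max (H σ) (H η)) else 0

lemma weight_pos (σ : Config N q) : 0 < weight β H σ := Real.exp_pos _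

lemma setWeight_pos {A : Set (Config N q)} (hA : A.Nonempty) : 0 < setWeight β H A := by
  obtain ⟨σ, hσ⟩ := hA
  refine Finset.sum_pos' (fun η _ => Set.indicator_nonneg (fun η _ => (weight_pos β H η).le) η)
    ⟨σ, Finset.mem_univ σ, ?_⟩
  rw [Set.indicator_of_mem hσ]
  exact weight_pos β H σ

lemma partitionFunction_pos [Nonempty (Config N q)] : 0 < partitionFunction β H :=
  Finset.sum_pos (fun _ _ => Real.exp_pos _) Finset.univ_nonempty

lemma conductance_nonneg (σ η : Config N q) : 0 ≤ conductance β H σ η := by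
  unfold conductance
  split_ifs <;> positivity

lemma conductance_comm (σ η : Config N q) : conductance β H σ η = conductance β H η σ := by
  rw [conductance, conductance, hammingDist_comm, max_comm]

lemma weight_mul_flipProb (σ η : Config N q) :
    weight β H σ * flipProb β H σ η = conductance β H σ η := by
  have hmax : max (H σ) (H η) = H σ + max 0 (H η - H σ) := by
    rw [← max_add_add_left, add_zero, add_sub_cancel]
  unfold weight flipProb conductance
  split_ifs
  · rw [mul_left_comm, ← Real.exp_add, hmax]
    ring_nf
  · exact mul_zero _

lemma laplacian_conductance (g : Config N q → ℝ) (σ : Config N q) :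
    laplacian (conductance β H) g σ = weight β H σ * (g σ - ∑ η, transProb β H σ η * g η) := by
  have hgen : g σ - ∑ η, transProb β H σ η * g η = ∑ η, transProb β H σ η * (g σ - g η) := by
    simp only [mul_sub, Finset.sum_sub_distrib, ← Finset.sum_mul, sum_transProb, one_mul]
  rw [hgen, Finset.mul_sum]
  refine Finset.sum_congr rfl fun η _ => ?_
  by_cases h : σ = η
  · rw [h, sub_self, mul_zero, mul_zero, mul_zero]
  · rw [transProb, if_neg h, ← mul_assoc, weight_mul_flipProb]

lemma lintegral_stepKernel (σ : Config N q) (g : Config N q → ℝ≥0∞) :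
    ∫⁻ η, g η ∂(stepKernel β H σ) = ∑ η, ENNReal.ofReal (transProb β H σ η) * g η := by
  change ∫⁻ η, g η ∂(∑ η, ENNReal.ofReal (transProb β H σ η) • Measure.dirac η) = _
  simp only [lintegral_finsetSum_measure, lintegral_smul_measure, lintegral_dirac, smul_eq_mul]

lemma toReal_lintegral_stepKernel (σ : Config N q) {g : Config N q → ℝ≥0∞} (hg : ∀ η, g η ≠ ⊤) :
    (∫⁻ η, g η ∂(stepKernel β H σ)).toReal = ∑ η, transProb β H σ η * (g η).toReal := by
  rw [lintegral_stepKernel, ENNReal.toReal_sum fun η _ => ENNReal.mul_ne_top ENNReal.ofReal_ne_top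
    (hg η)]
  simp only [ENNReal.toReal_mul, ENNReal.toReal_ofReal (transProb_nonneg β H σ _)]

lemma lintegral_gibbs (g : Config N q → ℝ≥0∞) :
    ∫⁻ σ, g σ ∂(gibbs β H) =
      ∑ σ, ENNReal.ofReal (weight β H σ / partitionFunction β H) * g σ := by
  simp only [gibbs, weight, lintegral_finsetSum_measure, lintegral_smul_measure, lintegral_dirac,
    smul_eq_mul]

lemma setLIntegral_gibbs {A : Set (Config N q)} (hA : A.Nonempty) {g : Config N q → ℝ}
    (hg : ∀ σ, 0 ≤ g σ) :
    ∫⁻ σ in A, ENNReal.ofReal (g σ) ∂(gibbs β H) =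
      ENNReal.ofReal ((∑ σ, A.indicator (fun σ => weight β H σ * g σ) σ) /
        partitionFunction β H) := by
  classical
  have : Nonempty (Config N q) := ⟨hA.some⟩
  have hZ := partitionFunction_pos β H
  have hw := fun σ => (weight_pos β H σ).le
  rw [← lintegral_indicator A.toFinite.measurableSet, lintegral_gibbs, Finset.sum_div,
    ENNReal.ofReal_sum_of_nonneg fun σ _ =>
      div_nonneg (Set.indicator_nonneg (fun σ _ => mul_nonneg (hw σ) (hg σ)) σ) hZ.le]
  refine Finset.sum_congr rfl fun σ _ => ?_
  by_cases h : σ ∈ A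
  · rw [Set.indicator_of_mem h, Set.indicator_of_mem h,
      ← ENNReal.ofReal_mul (div_nonneg (hw σ) hZ.le), div_mul_eq_mul_div]
  · rw [Set.indicator_of_notMem h, Set.indicator_of_notMem h, mul_zero, zero_div,
      ENNReal.ofReal_zero]

lemma gibbs_apply {A : Set (Config N q)} (hA : A.Nonempty) :
    gibbs β H A = ENNReal.ofReal (setWeight β H A / partitionFunction β H) := by
  simpa [setWeight] using setLIntegral_gibbs β H hA fun _ => zero_le_one

lemma lintegral_cond_gibbs {A : Set (Config N q)} (hA : A.Nonempty) {g : Config N q → ℝ}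
    (hg : ∀ σ, 0 ≤ g σ) :
    ∫⁻ σ, ENNReal.ofReal (g σ) ∂(cond (gibbs β H) A) =
      ENNReal.ofReal ((∑ σ, A.indicator (fun σ => weight β H σ * g σ) σ) / setWeight β H A) := by
  have : Nonempty (Config N q) := ⟨hA.some⟩
  have hZ := partitionFunction_pos β H
  have hW := setWeight_pos β H hA
  rw [ProbabilityTheory.cond, lintegral_smul_measure, setLIntegral_gibbs β H hA hg,
    gibbs_apply β H hA, ← ENNReal.ofReal_inv_of_pos (by positivity), smul_eq_mul,
    ← ENNReal.ofReal_mul (by positivity)]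
  congr 1
  field_simp

lemma isProbabilityMeasure_cond_gibbs {A : Set (Config N q)} (hA : A.Nonempty) :
    IsProbabilityMeasure (cond (gibbs β H) A) := by
  have : Nonempty (Config N q) := ⟨hA.some⟩
  refine cond_isProbabilityMeasure_of_finite ?_ ?_ <;> rw [gibbs_apply β H hA]
  · rw [Ne, ENNReal.ofReal_eq_zero, not_le]
    exact div_pos (setWeight_pos β H hA) (partitionFunction_pos β H)
  · exact ENNReal.ofReal_ne_top

/-- The equilibrium potential of the pair `A`, `B`: the probability that the chain hits `A` before
`B`, equal to `1` on `A` and to `0` on `B`. -/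
def equilibriumPotential (A B : Set (Config N q)) (σ : Config N q) : ℝ :=
  1 - (hittingProb (stepKernel β H) A B σ).toReal

variable {A B : Set (Config N q)}

lemma equilibriumPotential_of_mem_left (hAB : Disjoint A B) {σ : Config N q} (hσ : σ ∈ A) :
    equilibriumPotential β H A B σ = 1 := by
  rw [equilibriumPotential, hittingProb_of_mem_union (Or.inl hσ),
    Set.indicator_of_notMem (Set.disjoint_left.1 hAB hσ), ENNReal.toReal_zero, sub_zero]

lemma equilibriumPotential_of_mem_right {σ : Config N q} (hσ : σ ∈ B) :
    equilibriumPotential β H A B σ = 0 := by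
  rw [equilibriumPotential, hittingProb_of_mem_union (Or.inr hσ), Set.indicator_of_mem hσ,
    Pi.one_apply, ENNReal.toReal_one, sub_self]

lemma hittingProb_ne_top (hAB : Disjoint A B) (σ : Config N q) :
    hittingProb (stepKernel β H) A B σ ≠ ⊤ :=
  ne_top_of_le_ne_top ENNReal.one_ne_top
    (hittingProb_le_one A.toFinite.measurableSet B.toFinite.measurableSet hAB σ)

lemma laplacian_equilibriumPotential (hAB : Disjoint A B) (σ : Config N q) :
    laplacian (conductance β H) (equilibriumPotential β H A B) σ =
      weight β H σ * ((∫⁻ η, hittingProb (stepKernel β H) A B η ∂(stepKernel β H σ)).toReal -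
        (hittingProb (stepKernel β H) A B σ).toReal) := by
  simp only [laplacian_conductance, equilibriumPotential, mul_sub, mul_one,
    Finset.sum_sub_distrib, sum_transProb,
    toReal_lintegral_stepKernel β H σ (hittingProb_ne_top β H hAB)]
  ring

theorem escapeProb_eq_capacity (hA : A.Nonempty) (hAB : Disjoint A B) :
    escapeProb β H A B =
      ENNReal.ofReal (capacity (conductance β H) A B / setWeight β H A) := by
  have hmA : MeasurableSet A := A.toFinite.measurableSet
  have hmB : MeasurableSet B := B.toFinite.measurableSet
  have hprob := isProbabilityMeasure_cond_gibbs β H hA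
  have hfin : ∀ σ, ∫⁻ η, hittingProb (stepKernel β H) A B η ∂(stepKernel β H σ) ≠ ⊤ := fun σ => by
    rw [lintegral_stepKernel]
    exact ENNReal.sum_ne_top.2 fun η _ =>
      ENNReal.mul_ne_top ENNReal.ofReal_ne_top (hittingProb_ne_top β H hAB η)
  have hharm : ∀ σ ∉ A ∪ B, laplacian (conductance β H) (equilibriumPotential β H A B) σ = 0 :=
    fun σ hσ => by
      rw [laplacian_equilibriumPotential β H hAB, ← hittingProb_of_notMem_union hmA hmB hσ,
        sub_self, mul_zero]
  have hesc : escapeProb β H A B = ∫⁻ σ, ENNReal.ofReal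
      (∫⁻ η, hittingProb (stepKernel β H) A B η ∂(stepKernel β H σ)).toReal
        ∂(cond (gibbs β H) A) := by
    simp only [ENNReal.ofReal_toReal (hfin _)]
    exact markovLaw_returnTime_lt _ hmA hmB hAB
  rw [hesc, lintegral_cond_gibbs β H hA fun _ => ENNReal.toReal_nonneg,
    capacity_eq_sum_laplacian (conductance_nonneg β H) (conductance_comm β H) hAB
      (fun σ hσ => equilibriumPotential_of_mem_left β H hAB hσ)
      (fun σ hσ => equilibriumPotential_of_mem_right β H hσ) hharm]
  congr! 3 with σ
  by_cases hσ : σ ∈ A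
  · rw [Set.indicator_of_mem hσ, Set.indicator_of_mem hσ,
      laplacian_equilibriumPotential β H hAB, hittingProb_of_mem_union (Or.inl hσ),
      Set.indicator_of_notMem (Set.disjoint_left.1 hAB hσ), ENNReal.toReal_zero, sub_zero]
  · rw [Set.indicator_of_notMem hσ, Set.indicator_of_notMem hσ]

end Metropolis

/-! ### Perturbations of the Hamiltonian -/

section Perturbation

variable {N q : ℕ} (β : ℝ≥0) {H H' : Config N q → ℝ} {δ : ℝ}

lemma exp_neg_mul_le_exp_mul_mul_exp {a b : ℝ} (h : a - b ≤ δ) :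
    Real.exp (-β * b) ≤ Real.exp (β * δ) * Real.exp (-β * a) := by
  rw [← Real.exp_add, Real.exp_le_exp]
  nlinarith [β.coe_nonneg]

lemma setWeight_le_of_sub_le (h : ∀ σ, H σ - H' σ ≤ δ) (A : Set (Config N q)) :
    setWeight β H' A ≤ Real.exp (β * δ) * setWeight β H A := by
  unfold setWeight
  rw [Finset.mul_sum]
  refine Finset.sum_le_sum fun σ _ => ?_
  by_cases hσ : σ ∈ A
  · rw [Set.indicator_of_mem hσ, Set.indicator_of_mem hσ]
    exact exp_neg_mul_le_exp_mul_mul_exp β (h σ)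
  · rw [Set.indicator_of_notMem hσ, Set.indicator_of_notMem hσ, mul_zero]

lemma conductance_le_of_sub_le (h : ∀ σ, H σ - H' σ ≤ δ) (σ η : Config N q) :
    conductance β H' σ η ≤ Real.exp (β * δ) * conductance β H σ η := by
  unfold conductance
  split_ifs
  · have hmax : max (H σ) (H η) - max (H' σ) (H' η) ≤ δ := by
      rw [sub_le_iff_le_add, ← max_add_add_left]
      exact max_le_max (sub_le_iff_le_add.1 (h σ)) (sub_le_iff_le_add.1 (h η))
    rw [mul_left_comm]
    gcongr
    exact exp_neg_mul_le_exp_mul_mul_exp β hmax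
  · rw [mul_zero]

lemma escapeProb_le_of_abs_sub_le (h : ∀ σ, |H σ - H' σ| ≤ δ) {A B : Set (Config N q)}
    (hA : A.Nonempty) (hAB : Disjoint A B) :
    escapeProb β H' A B ≤ ENNReal.ofReal (Real.exp (2 * (β * δ))) * escapeProb β H A B := by
  rw [escapeProb_eq_capacity β H hA hAB, escapeProb_eq_capacity β H' hA hAB,
    ← ENNReal.ofReal_mul (Real.exp_pos _).le]
  refine ENNReal.ofReal_le_ofReal ?_
  have hcap : capacity (conductance β H') A B ≤
      Real.exp (β * δ) * capacity (conductance β H) A B :=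
    capacity_le_mul (Real.exp_pos _) (conductance_nonneg β H')
      (conductance_le_of_sub_le β fun σ => (abs_le.1 (h σ)).2) hAB
  have hweight : setWeight β H A ≤ Real.exp (β * δ) * setWeight β H' A :=
    setWeight_le_of_sub_le β (fun σ => by linarith [(abs_le.1 (h σ)).1]) A
  have hnonneg := capacity_nonneg (conductance_nonneg β H) A B
  rw [mul_div_assoc', div_le_div_iff₀ (setWeight_pos β H' hA) (setWeight_pos β H hA)]
  calc capacity (conductance β H') A B * setWeight β H A
      ≤ (Real.exp (β * δ) * capacity (conductance β H) A B) *
          (Real.exp (β * δ) * setWeight β H' A) := by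
        gcongr
        exact (setWeight_pos β H hA).le
    _ = _ := by rw [two_mul, Real.exp_add]; ring

lemma IsMetastable.mono {ι : Type*} {I : Finset ι} {M : ι → Set (Config N q)} {ρ ρ' : ℝ}
    {β : ℝ≥0} (hM : IsMetastable β H I M ρ) (h : ρ ≤ ρ') : IsMetastable β H I M ρ' :=
  ⟨hM.1, hM.2.1, hM.2.2.trans (ENNReal.ofReal_le_ofReal h)⟩

theorem IsMetastable.of_abs_sub_le {ι : Type*} {I : Finset ι} {M : ι → Set (Config N q)} {ρ : ℝ}
    (hM : IsMetastable β H I M ρ) (h : ∀ σ, |H σ - H' σ| ≤ δ) :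
    IsMetastable β H' I M (Real.exp (4 * (β * δ)) * ρ) := by
  obtain ⟨hne, hdisj, hle⟩ := hM
  refine ⟨hne, hdisj, ?_⟩
  set K : ℝ≥0∞ := ENNReal.ofReal (Real.exp (2 * (β * δ)))
  have hK0 : K ≠ 0 := by simp [K, Real.exp_pos]
  have hKtop : K ≠ ⊤ := ENNReal.ofReal_ne_top
  set U := ⋃ i ∈ I, M i
  have hnum : (⨆ j ∈ I, escapeProb β H' (M j) (U \ M j)) ≤
      K * ⨆ j ∈ I, escapeProb β H (M j) (U \ M j) := by
    refine iSup₂_le fun j hj =>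
      (escapeProb_le_of_abs_sub_le β h (hne j hj) Set.disjoint_sdiff_right).trans ?_
    gcongr
    exact le_iSup₂ (f := fun j _ => escapeProb β H (M j) (U \ M j)) j hj
  have hden : K⁻¹ * (⨅ (X : Set (Config N q)) (_ : X.Nonempty ∧ X ⊆ Uᶜ), escapeProb β H X U) ≤
      ⨅ (X : Set (Config N q)) (_ : X.Nonempty ∧ X ⊆ Uᶜ), escapeProb β H' X U := by
    refine le_iInf₂ fun X hX => ?_
    rw [mul_comm, ← div_eq_mul_inv]
    exact ENNReal.div_le_of_le_mul' ((iInf₂_le X hX).trans (escapeProb_le_of_abs_sub_le β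
      (fun σ => by rw [abs_sub_comm]; exact h σ) hX.1 (Set.disjoint_left.2 hX.2)))
  calc _ ≤ (I.card : ℝ≥0∞) * (K * ⨆ j ∈ I, escapeProb β H (M j) (U \ M j)) /
        (K⁻¹ * (⨅ (X : Set (Config N q)) (_ : X.Nonempty ∧ X ⊆ Uᶜ), escapeProb β H X U)) := by
        gcongr
    _ = (K * K) * ((I.card : ℝ≥0∞) * (⨆ j ∈ I, escapeProb β H (M j) (U \ M j)) /
        (⨅ (X : Set (Config N q)) (_ : X.Nonempty ∧ X ⊆ Uᶜ), escapeProb β H X U)) := by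
        rw [div_eq_mul_inv, ENNReal.mul_inv (Or.inl (ENNReal.inv_ne_zero.2 hKtop))
          (Or.inl (ENNReal.inv_ne_top.2 hK0)), inv_inv, div_eq_mul_inv]
        ring
    _ ≤ (K * K) * ENNReal.ofReal ρ := by gcongr
    _ = ENNReal.ofReal (Real.exp (4 * (β * δ)) * ρ) := by
        rw [← ENNReal.ofReal_mul (Real.exp_pos _).le, ← Real.exp_add,
          ← ENNReal.ofReal_mul (Real.exp_pos _).le]
        congr 3
        ring

end Perturbation

/-! ### Concentration -/

section Concentration

variable {Ω ι : Type*} [MeasurableSpace Ω] {P : Measure Ω} [IsProbabilityMeasure P]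
  {X : ι → Ω → ℝ} {Y : Ω → ℝ}

lemma measureReal_le_sum_le_exp (hind : iIndepFun X P) (hX : ∀ i, AEMeasurable (X i) P) {l δ : ℝ}
    (hl : 0 ≤ l) (hint : ∀ i, l ∈ integrableExpSet (X i) P)
    (hmgf : ∀ i, mgf (X i) P l ≤ Real.exp (l * δ)) (s : Finset ι) (a : ℝ) :
    P.real {ω | a ≤ ∑ i ∈ s, X i ω} ≤ Real.exp (-(l * (a - δ * s.card))) := by
  have hsum : mgf (∑ i ∈ s, X i) P l = ∏ i ∈ s, mgf (X i) P l := hind.mgf_sum₀ hX s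
  have hint_sum : Integrable (fun ω => Real.exp (l * (∑ i ∈ s, X i) ω)) P := by
    rw [← mgf_pos_iff, hsum]
    exact Finset.prod_pos fun i _ => mgf_pos (hint i)
  have hchernoff := measure_ge_le_exp_mul_mgf a hl hint_sum
  simp only [Finset.sum_apply] at hchernoff
  calc P.real {ω | a ≤ ∑ i ∈ s, X i ω} ≤ Real.exp (-l * a) * ∏ i ∈ s, mgf (X i) P l := by
        rwa [← hsum]
    _ ≤ Real.exp (-l * a) * ∏ _i ∈ s, Real.exp (l * δ) := by
        gcongr with i
        · exact fun i _ => mgf_nonneg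
        · exact hmgf i
    _ = Real.exp (-(l * (a - δ * s.card))) := by
        rw [Finset.prod_const, ← Real.exp_nat_mul, ← Real.exp_add]
        ring_nf

lemma measureReal_le_abs_sum_le_exp (hind : iIndepFun X P) (hX : ∀ i, AEMeasurable (X i) P)
    {l δ : ℝ} (hl : 0 ≤ l) (hint : ∀ i, l ∈ integrableExpSet (X i) P)
    (hint' : ∀ i, -l ∈ integrableExpSet (X i) P)
    (hmgf : ∀ i, mgf (X i) P l ≤ Real.exp (l * δ))
    (hmgf' : ∀ i, mgf (X i) P (-l) ≤ Real.exp (l * δ)) (s : Finset ι) (a : ℝ) :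
    P.real {ω | a ≤ |∑ i ∈ s, X i ω|} ≤ 2 * Real.exp (-(l * (a - δ * s.card))) := by
  have hneg : P.real {ω | a ≤ ∑ i ∈ s, (-X i) ω} ≤ Real.exp (-(l * (a - δ * s.card))) :=
    measureReal_le_sum_le_exp (hind.comp (fun _ x => -x) fun _ => measurable_neg)
      (fun i => (hX i).neg) hl (fun i => by simpa [integrableExpSet] using hint' i)
      (fun i => (mgf_neg (X := X i)).trans_le (hmgf' i)) s a
  calc P.real {ω | a ≤ |∑ i ∈ s, X i ω|}
      = P.real ({ω | a ≤ ∑ i ∈ s, X i ω} ∪ {ω | a ≤ ∑ i ∈ s, (-X i) ω}) := by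
        congr 1 with ω
        simp [le_abs]
    _ ≤ _ := measureReal_union_le _ _
    _ ≤ _ := by linarith [measureReal_le_sum_le_exp hind hX hl hint hmgf s a]

lemma eventually_mgf_le_exp (hmean : P[Y] = 0) (hexp : (0 : ℝ) ∈ interior (integrableExpSet Y P))
    {δ : ℝ} (hδ : 0 < δ) : ∀ᶠ t in nhds 0, mgf Y P t ≤ Real.exp (|t| * δ) := by
  have hderiv : HasDerivAt (mgf Y P) 0 0 := by
    have h := (differentiableAt_mgf hexp).hasDerivAt
    rwa [deriv_mgf_zero hexp, hmean] at h
  filter_upwards [(hasDerivAt_iff_isLittleO.1 hderiv).bound hδ] with t ht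
  simp only [mgf_zero, sub_zero, smul_zero, Real.norm_eq_abs] at ht
  linarith [(abs_le.1 ht).2, Real.add_one_le_exp (|t| * δ)]

lemma exists_mgf_le_exp (hmean : P[Y] = 0) (hexp : (0 : ℝ) ∈ interior (integrableExpSet Y P))
    {δ : ℝ} (hδ : 0 < δ) :
    ∃ l > 0, l ∈ integrableExpSet Y P ∧ -l ∈ integrableExpSet Y P ∧
      mgf Y P l ≤ Real.exp (l * δ) ∧ mgf Y P (-l) ≤ Real.exp (l * δ) := by
  have hnhds : ∀ᶠ t in nhds 0, t ∈ integrableExpSet Y P ∧ mgf Y P t ≤ Real.exp (|t| * δ) :=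
    (eventually_mem_set.2 (mem_interior_iff_mem_nhds.1 hexp)).and
      (eventually_mgf_le_exp hmean hexp hδ)
  have hneg : Tendsto (fun t : ℝ => -t) (nhds 0) (nhds 0) := by
    simpa using (continuous_neg (G := ℝ)).tendsto 0
  obtain ⟨l, ⟨⟨hl, hl'⟩, hn, hn'⟩, hpos⟩ :=
    (((hnhds.and (hneg.eventually hnhds)).filter_mono nhdsWithin_le_nhds).and
      (self_mem_nhdsWithin (s := Set.Ioi (0 : ℝ)))).exists
  rw [abs_neg] at hn'
  rw [abs_of_pos hpos] at hl' hn'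
  exact ⟨l, hpos, hl, hn, hl', hn'⟩

lemma summable_pow_mul_exp_neg_mul_sq (a : ℝ) {c : ℝ} (hc : 0 < c) :
    Summable fun N : ℕ => a ^ N * Real.exp (-(c * N ^ 2)) := by
  have hlim : Tendsto (fun N : ℕ => |a| * Real.exp (-c * N)) atTop (nhds 0) := by
    have h := (Real.tendsto_exp_atBot.comp
      (tendsto_natCast_atTop_atTop.const_mul_atTop_of_neg (neg_lt_zero.2 hc))).const_mul |a|
    rwa [mul_zero] at h
  refine Summable.of_norm_bounded_eventually_nat summable_geometric_two ?_
  filter_upwards [hlim.eventually_le_const (by norm_num : (0 : ℝ) < 1 / 2)] with N hN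
  calc ‖a ^ N * Real.exp (-(c * N ^ 2))‖ = (|a| * Real.exp (-c * N)) ^ N := by
        rw [norm_mul, norm_pow, Real.norm_eq_abs, Real.norm_of_nonneg (Real.exp_pos _).le, mul_pow,
          ← Real.exp_nat_mul]
        ring_nf
    _ ≤ (1 / 2) ^ N := pow_le_pow_left₀ (by positivity) hN N

/-- The union bound costs a factor `q ^ N`, which the Chernoff bound `exp (-c N ^ 2)` for the single
sums absorbs; the Borel–Cantelli lemma concludes. -/
theorem ae_eventually_forall_abs_sum_lt (hind : iIndepFun X P)
    (hid : ∀ i, IdentDistrib (X i) Y P P) (hmean : P[Y] = 0)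
    (hexp : (0 : ℝ) ∈ interior (integrableExpSet Y P)) {κ : ℕ → Type*} [∀ N, Fintype (κ N)]
    {q : ℕ} (hκ : ∀ N, Fintype.card (κ N) ≤ q ^ N) (s : ∀ N, κ N → Finset ι)
    (hs : ∀ N k, (s N k).card ≤ N ^ 2) {ε : ℝ} (hε : 0 < ε) :
    ∀ᵐ ω ∂P, ∀ᶠ N : ℕ in atTop, ∀ k, |∑ i ∈ s N k, X i ω| < ε * N ^ 2 := by
  obtain ⟨l, hl, hint, hint', hmgf, hmgf'⟩ := exists_mgf_le_exp hmean hexp (half_pos hε)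
  have hint_iff : ∀ i t, t ∈ integrableExpSet (X i) P ↔ t ∈ integrableExpSet Y P := fun i t =>
    ((hid i).comp (u := fun x => Real.exp (t * x)) (by fun_prop)).integrable_iff
  set bad : ℕ → Set Ω := fun N => ⋃ k, {ω | ε * N ^ 2 ≤ |∑ i ∈ s N k, X i ω|}
  have hchernoff : ∀ N k, P {ω | ε * N ^ 2 ≤ |∑ i ∈ s N k, X i ω|} ≤
      ENNReal.ofReal (2 * Real.exp (-(l * ε / 2 * N ^ 2))) := fun N k => by
    rw [← ofReal_measureReal]
    refine ENNReal.ofReal_le_ofReal ((measureReal_le_abs_sum_le_exp hind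
      (fun i => (hid i).aemeasurable_fst) hl.le (fun i => (hint_iff i l).2 hint)
      (fun i => (hint_iff i (-l)).2 hint') (fun i => by rwa [mgf_congr_of_identDistrib _ _ (hid i)])
      (fun i => by rwa [mgf_congr_of_identDistrib _ _ (hid i)]) _ _).trans ?_)
    have hcard : ((s N k).card : ℝ) ≤ N ^ 2 := mod_cast hs N k
    refine mul_le_mul_of_nonneg_left (Real.exp_le_exp.2 ?_) zero_le_two
    nlinarith [mul_le_mul_of_nonneg_left hcard (mul_pos hl hε).le]
  have hbad : ∀ N, P (bad N) ≤
      ENNReal.ofReal (2 * ((q : ℝ) ^ N * Real.exp (-(l * ε / 2 * N ^ 2)))) := fun N =>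
    calc P (bad N) ≤ ∑ k, P {ω | ε * N ^ 2 ≤ |∑ i ∈ s N k, X i ω|} :=
          measure_iUnion_fintype_le P _
      _ ≤ Fintype.card (κ N) * ENNReal.ofReal (2 * Real.exp (-(l * ε / 2 * N ^ 2))) := by
          rw [← nsmul_eq_mul]
          exact Finset.sum_le_card_nsmul _ _ _ fun k _ => hchernoff N k
      _ ≤ ((q ^ N : ℕ) : ℝ≥0∞) * ENNReal.ofReal (2 * Real.exp (-(l * ε / 2 * N ^ 2))) := by
          gcongr
          exact hκ N
      _ = _ := by
          rw [← ENNReal.ofReal_natCast, ← ENNReal.ofReal_mul (Nat.cast_nonneg _), Nat.cast_pow,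
            mul_left_comm]
  have hsummable := (summable_pow_mul_exp_neg_mul_sq q (by positivity : 0 < l * ε / 2)).mul_left 2
  have hne_top : ∑' N, P (bad N) ≠ ⊤ := ne_top_of_le_ne_top
    (by rw [← ENNReal.ofReal_tsum_of_nonneg (fun N => by positivity) hsummable]
        exact ENNReal.ofReal_ne_top) (ENNReal.tsum_le_tsum hbad)
  filter_upwards [ae_eventually_notMem hne_top] with ω hω
  filter_upwards [hω] with N hN k
  exact not_le.1 fun h => hN (Set.mem_iUnion.2 ⟨k, h⟩)

end Concentration

/-! ### The disordered Hamiltonian -/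

section Disorder

/-- The pairs of vertices of the same colour, as indices of the array of couplings. -/
def monochromaticPairs {N q : ℕ} (σ : Config N q) : Finset {p : ℕ × ℕ // p.1 < p.2} :=
  (Finset.univ.filter fun p : {p : Fin N × Fin N // p.1 < p.2} => σ p.1.1 = σ p.1.2).image
    fun p => ⟨(p.1.1, p.1.2), p.2⟩

lemma card_monochromaticPairs_le {N q : ℕ} (σ : Config N q) :
    (monochromaticPairs σ).card ≤ N ^ 2 := by
  refine Finset.card_image_le.trans ((Finset.card_le_univ _).trans
    ((Fintype.card_subtype_le _).trans ?_))
  simp [sq]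

lemma hamiltonian_eq_sum_monochromaticPairs {N q : ℕ} (J : ℕ → ℕ → ℝ) (σ : Config N q) :
    hamiltonian J σ = -(1 / (N : ℝ)) * ∑ p ∈ monochromaticPairs σ, J p.1.1 p.1.2 := by
  have hinj : Function.Injective fun p : {p : Fin N × Fin N // p.1 < p.2} =>
      (⟨(p.1.1, p.1.2), p.2⟩ : {p : ℕ × ℕ // p.1 < p.2}) := by
    rintro ⟨⟨i, j⟩, _⟩ ⟨⟨i', j'⟩, _⟩ h
    simpa [Fin.ext_iff] using h
  rw [monochromaticPairs, Finset.sum_image fun _ _ _ _ h => hinj h, Finset.sum_filter,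
    ← Finset.sum_subtype (Finset.univ.filter fun x : Fin N × Fin N => x.1 < x.2) (by simp)
      (fun p => if σ p.1 = σ p.2 then J p.1 p.2 else 0), Finset.sum_filter, hamiltonian,
    ← Fintype.sum_prod_type' (f := fun i j : Fin N => if i < j ∧ σ i = σ j then J i j else 0)]
  simp only [ite_and]

variable {Ω : Type*} [MeasurableSpace Ω] {P : Measure Ω} [IsProbabilityMeasure P]
  {J : ℕ → ℕ → Ω → ℝ}

theorem ae_eventually_abs_hamiltonian_sub_le
    (hJ_indep : iIndepFun (fun p : {p : ℕ × ℕ // p.1 < p.2} => J p.1.1 p.1.2) P)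
    (hJ_ident : ∀ i j, i < j → IdentDistrib (J i j) (J 0 1) P P)
    (hJ_mean : ∫ ω, J 0 1 ω ∂P = 1)
    (hJ_exp : (0 : ℝ) ∈ interior (integrableExpSet (J 0 1) P)) (q : ℕ) {ε : ℝ} (hε : 0 < ε) :
    ∀ᵐ ω ∂P, ∀ᶠ N : ℕ in atTop, ∀ σ : Config N q,
      |meanFieldHamiltonian σ - hamiltonian (fun i j => J i j ω) σ| ≤ ε * N := by
  have hint : Integrable (J 0 1) P := integrable_of_mem_interior_integrableExpSet hJ_exp
  have hmean : P[fun ω => J 0 1 ω - 1] = 0 := by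
    rw [integral_sub hint (integrable_const _), hJ_mean]
    simp
  have hexp : (0 : ℝ) ∈ interior (integrableExpSet (fun ω => J 0 1 ω - 1) P) := by
    refine interior_mono (fun t ht => ?_) hJ_exp
    simp only [integrableExpSet, Set.mem_ofPred_eq, mul_sub, Real.exp_sub] at ht ⊢
    exact ht.div_const _
  filter_upwards [ae_eventually_forall_abs_sum_lt (κ := fun N => Config N q) (q := q)
    (hJ_indep.comp (fun _ x => x - 1) fun _ => by fun_prop)
    (fun p => (hJ_ident _ _ p.2).comp (u := fun x => x - 1) (by fun_prop)) hmean hexp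
    (fun N => by simp) (fun N σ => monochromaticPairs σ)
    (fun N σ => card_monochromaticPairs_le σ) hε] with ω hω
  filter_upwards [hω, eventually_gt_atTop 0] with N hN hN0 σ
  have hN0 : (0 : ℝ) < N := mod_cast hN0
  have hsum : meanFieldHamiltonian σ - hamiltonian (fun i j => J i j ω) σ =
      1 / (N : ℝ) * ∑ p ∈ monochromaticPairs σ, (J p.1.1 p.1.2 ω - 1) := by
    rw [meanFieldHamiltonian, hamiltonian_eq_sum_monochromaticPairs,
      hamiltonian_eq_sum_monochromaticPairs, Finset.sum_sub_distrib]
    ring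
  have hlt : |∑ p ∈ monochromaticPairs σ, (J p.1.1 p.1.2 ω - 1)| < ε * N ^ 2 := hN σ
  rw [hsum, abs_mul, abs_of_pos (by positivity), one_div, inv_mul_le_iff₀ hN0]
  linarith

theorem ae_eventually_isMetastable
    (hJ_indep : iIndepFun (fun p : {p : ℕ × ℕ // p.1 < p.2} => J p.1.1 p.1.2) P)
    (hJ_ident : ∀ i j, i < j → IdentDistrib (J i j) (J 0 1) P P)
    (hJ_mean : ∫ ω, J 0 1 ω ∂P = 1)
    (hJ_exp : (0 : ℝ) ∈ interior (integrableExpSet (J 0 1) P)) {q : ℕ} {β : ℝ≥0}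
    {ι : Type*} {I : Finset ι} {M : ∀ N, ι → Set (Config N q)} {k₁ k₂ : ℝ} (hk : k₂ < k₁)
    (hM : ∀ᶠ N : ℕ in atTop,
      IsMetastable β meanFieldHamiltonian I (M N) (Real.exp (-k₁ * N))) :
    ∀ᵐ ω ∂P, ∀ᶠ N : ℕ in atTop,
      IsMetastable β (hamiltonian fun i j => J i j ω) I (M N) (Real.exp (-k₂ * N)) := by
  have hk' := sub_pos.2 hk
  set ε := (k₁ - k₂) / (4 * (β + 1))
  have hε : 0 < ε := by positivity
  have hβε : 4 * (β * ε) ≤ k₁ - k₂ :=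
    calc 4 * (β * ε) ≤ 4 * ((β + 1) * ε) := by linarith
      _ = k₁ - k₂ := by simp only [ε]; field_simp
  filter_upwards [ae_eventually_abs_hamiltonian_sub_le hJ_indep hJ_ident hJ_mean hJ_exp q hε]
    with ω hω
  filter_upwards [hω, hM] with N hN hMN
  refine (hMN.of_abs_sub_le β hN).mono ?_
  rw [← Real.exp_add, Real.exp_le_exp]
  nlinarith [(Nat.cast_nonneg N : (0 : ℝ) ≤ N)]

end Disorder

/-! ### The energy of one colour -/

section ColourEnergy

/-- The contribution of one colour, of frequency `x`, to the free energy. -/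
def colourEnergy (β x : ℝ) : ℝ := -(1 / 2) * x ^ 2 + 1 / β * (x * Real.log x)

variable {q : ℕ} {β x : ℝ}

lemma freeEnergy_eq_sum (β : ℝ) (x : Fin q → ℝ) :
    freeEnergy β x = ∑ k, colourEnergy β (x k) := by
  simp only [freeEnergy, colourEnergy, Finset.sum_add_distrib, Finset.mul_sum]

lemma continuous_colourEnergy (β : ℝ) : Continuous (colourEnergy β) := by
  unfold colourEnergy
  have := Real.continuous_mul_log
  fun_prop

lemma continuous_freeEnergy (β : ℝ) : Continuous (freeEnergy (q := q) β) := by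
  rw [show freeEnergy (q := q) β = fun x => ∑ k, colourEnergy β (x k) from
    funext (freeEnergy_eq_sum β)]
  exact continuous_finsetSum _ fun k _ => (continuous_colourEnergy β).comp (continuous_apply k)

lemma hasDerivAt_colourEnergy (β : ℝ) (hx : x ≠ 0) :
    HasDerivAt (colourEnergy β) (-x + 1 / β * (Real.log x + 1)) x := by
  refine (((hasDerivAt_pow 2 x).const_mul (-(1 / 2) : ℝ)).add
    ((Real.hasDerivAt_mul_log hx).const_mul (1 / β))).congr_deriv ?_
  norm_num
  ring

lemma deriv_colourEnergy (β : ℝ) (hx : x ≠ 0) :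
    deriv (colourEnergy β) x = -x + 1 / β * (Real.log x + 1) :=
  (hasDerivAt_colourEnergy β hx).deriv

lemma hasDerivAt_deriv_colourEnergy (β : ℝ) (hx : x ≠ 0) :
    HasDerivAt (deriv (colourEnergy β)) (-1 + 1 / β * x⁻¹) x := by
  refine ((hasDerivAt_id x).neg.add
    (((Real.hasDerivAt_log hx).add_const 1).const_mul (1 / β))).congr_of_eventuallyEq ?_
  filter_upwards [isOpen_ne.mem_nhds hx] with y hy using deriv_colourEnergy β hy

lemma tendsto_deriv_colourEnergy_nhdsGT_zero (hβ : 0 < β) :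
    Tendsto (deriv (colourEnergy β)) (nhdsWithin 0 (Set.Ioi 0)) atBot := by
  have hneg : Tendsto (fun t : ℝ => -t) (nhdsWithin 0 (Set.Ioi 0)) (nhds (-0)) :=
    continuous_neg.continuousWithinAt
  refine (hneg.add_atBot ((tendsto_atBot_add_const_right _ 1
    Real.tendsto_log_nhdsGT_zero).const_mul_atBot (one_div_pos.2 hβ))).congr' ?_
  filter_upwards [self_mem_nhdsWithin] with t ht
  exact (deriv_colourEnergy β (ne_of_gt ht)).symm

lemma strictMonoOn_deriv_colourEnergy (hβ : 0 < β) :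
    StrictMonoOn (deriv (colourEnergy β)) (Set.Ioc 0 (1 / β)) := by
  refine strictMonoOn_of_deriv_pos (convex_Ioc _ _)
    (fun x hx => (hasDerivAt_deriv_colourEnergy β hx.1.ne').continuousAt.continuousWithinAt)
    fun x hx => ?_
  rw [interior_Ioc] at hx
  have hx0 := hx.1
  have hβx : β * x < 1 := by rw [← lt_div_iff₀' hβ]; exact hx.2
  rw [(hasDerivAt_deriv_colourEnergy β hx0.ne').deriv, ← one_div, one_div_mul_one_div,
    lt_neg_add_iff_add_lt, add_zero, lt_div_iff₀ (by positivity), one_mul]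
  exact hβx

lemma strictAntiOn_deriv_colourEnergy (hβ : 0 < β) :
    StrictAntiOn (deriv (colourEnergy β)) (Set.Ioi (1 / β)) := by
  have hβ' : 0 < 1 / β := one_div_pos.2 hβ
  refine strictAntiOn_of_deriv_neg (convex_Ioi _)
    (fun x hx => (hasDerivAt_deriv_colourEnergy β
      (hβ'.trans hx).ne').continuousAt.continuousWithinAt) fun x hx => ?_
  rw [interior_Ioi] at hx
  have hx0 : 0 < x := hβ'.trans hx
  have hβx : 1 < β * x := by rw [← div_lt_iff₀' hβ]; exact hx
  rw [(hasDerivAt_deriv_colourEnergy β hx0.ne').deriv, ← one_div, one_div_mul_one_div,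
    neg_add_lt_iff_lt_add, add_zero, div_lt_iff₀ (by positivity), one_mul]
  exact hβx

lemma convexOn_colourEnergy (hβ : 0 < β) :
    ConvexOn ℝ (Set.Icc 0 (1 / β)) (colourEnergy β) := by
  refine MonotoneOn.convexOn_of_deriv (convex_Icc _ _) (continuous_colourEnergy β).continuousOn
    ?_ ?_ <;> rw [interior_Icc]
  · exact fun x hx =>
      (hasDerivAt_colourEnergy β hx.1.ne').differentiableAt.differentiableWithinAt
  · exact (strictMonoOn_deriv_colourEnergy hβ).monotoneOn.mono Set.Ioo_subset_Ioc_self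

lemma strictConcaveOn_colourEnergy (hβ : 0 < β) :
    StrictConcaveOn ℝ (Set.Ioi (1 / β)) (colourEnergy β) := by
  refine StrictAntiOn.strictConcaveOn_of_deriv (convex_Ioi _)
    (continuous_colourEnergy β).continuousOn ?_
  rw [interior_Ioi]
  exact strictAntiOn_deriv_colourEnergy hβ

lemma card_mul_colourEnergy_le {ι : Type*} (hβ : 0 < β) {t : Finset ι} (ht : t.Nonempty)
    {y : ι → ℝ} (hy : ∀ k ∈ t, y k ∈ Set.Icc 0 (1 / β)) :
    (t.card : ℝ) * colourEnergy β ((∑ k ∈ t, y k) / t.card) ≤ ∑ k ∈ t, colourEnergy β (y k) := by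
  have hc : (0 : ℝ) < t.card := by exact_mod_cast ht.card_pos
  have hJensen := (convexOn_colourEnergy hβ).map_sum_le (w := fun _ => 1 / (t.card : ℝ))
    (fun _ _ => by positivity) (by simp [hc.ne']) hy
  simp only [smul_eq_mul, ← Finset.mul_sum] at hJensen
  rwa [one_div, inv_mul_eq_div, inv_mul_eq_div, le_div_iff₀' hc] at hJensen

end ColourEnergy

/-! ### The equation for the order parameter -/

section OrderParameter

/-- The difference of the two sides of the equation that defines `order`. -/
def orderEq (q : ℕ) (β s : ℝ) : ℝ :=
  Real.log (1 + ((q : ℝ) - 1) * s) - Real.log (1 - s) - β * s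

/-- The derivative of `orderEq`, for `0 ≤ s < 1`. -/
def orderSlope (q : ℕ) (β s : ℝ) : ℝ :=
  ((q : ℝ) - 1) / (1 + ((q : ℝ) - 1) * s) + 1 / (1 - s) - β

variable {q : ℕ} {β s t : ℝ}

@[simp]
lemma orderEq_zero (q : ℕ) (β : ℝ) : orderEq q β 0 = 0 := by simp [orderEq]

@[simp]
lemma orderSlope_zero (q : ℕ) (β : ℝ) : orderSlope q β 0 = q - β := by simp [orderSlope]

lemma one_le_cast_sub_one (hq : 2 ≤ q) : (1 : ℝ) ≤ (q : ℝ) - 1 := by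
  have : (2 : ℝ) ≤ q := by exact_mod_cast hq
  linarith

lemma one_add_mul_pos (hq : 2 ≤ q) (hs : 0 ≤ s) : 0 < 1 + ((q : ℝ) - 1) * s := by
  have := one_le_cast_sub_one hq
  positivity

lemma hasDerivAt_orderEq (hq : 2 ≤ q) (β : ℝ) (hs : s ∈ Set.Ico 0 1) :
    HasDerivAt (orderEq q β) (orderSlope q β s) s := by
  have hlin : HasDerivAt (fun s : ℝ => 1 + ((q : ℝ) - 1) * s) ((q : ℝ) - 1) s := by
    simpa using ((hasDerivAt_id s).const_mul ((q : ℝ) - 1)).const_add 1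
  have hsub : HasDerivAt (fun s : ℝ => 1 - s) (-1) s := by
    simpa using (hasDerivAt_id s).const_sub 1
  have hmul : HasDerivAt (fun s : ℝ => β * s) β s := by
    simpa using (hasDerivAt_id s).const_mul β
  refine (((hlin.log (one_add_mul_pos hq hs.1).ne').sub
    (hsub.log (sub_pos.2 hs.2).ne')).sub hmul).congr_deriv ?_
  rw [orderSlope, neg_div, sub_neg_eq_add]

lemma continuousOn_orderEq (hq : 2 ≤ q) (β : ℝ) : ContinuousOn (orderEq q β) (Set.Ico 0 1) :=
  fun _ hs => (hasDerivAt_orderEq hq β hs).continuousAt.continuousWithinAt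

lemma continuousAt_orderSlope (hq : 2 ≤ q) (β : ℝ) (hs : s ∈ Set.Ico 0 1) :
    ContinuousAt (orderSlope q β) s := by
  have hlin := (one_add_mul_pos hq hs.1).ne'
  have hsub : 1 - s ≠ 0 := (sub_pos.2 hs.2).ne'
  unfold orderSlope
  fun_prop (disch := assumption)

lemma strictConvexOn_orderSlope (hq : 2 ≤ q) (β : ℝ) :
    StrictConvexOn ℝ (Set.Ico 0 1) (orderSlope q β) := by
  have hinv : StrictConvexOn ℝ (Set.Ioi 0) fun x : ℝ => x ^ (-1 : ℤ) :=
    strictConvexOn_zpow (by norm_num) (by norm_num)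
  have hq1 := one_le_cast_sub_one hq
  refine ⟨convex_Ico 0 1, fun x hx y hy hxy a b ha hb hab => ?_⟩
  have hleft := hinv.convexOn.2 (one_add_mul_pos hq hx.1) (one_add_mul_pos hq hy.1) ha.le hb.le hab
  have hright := hinv.2 (sub_pos.2 hx.2) (sub_pos.2 hy.2) (sub_right_injective.ne hxy) ha hb hab
  simp only [smul_eq_mul, zpow_neg_one] at hleft hright ⊢
  rw [show a * (1 + ((q : ℝ) - 1) * x) + b * (1 + ((q : ℝ) - 1) * y) =
    1 + ((q : ℝ) - 1) * (a * x + b * y) by linear_combination hab] at hleft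
  rw [show a * (1 - x) + b * (1 - y) = 1 - (a * x + b * y) by linear_combination hab] at hright
  have hmul := mul_le_mul_of_nonneg_left hleft (zero_le_one.trans hq1)
  have hβ : a * β + b * β = β := by rw [← add_mul, hab, one_mul]
  simp only [orderSlope, div_eq_mul_inv, one_mul]
  linarith

lemma exists_orderSlope_eq (hq : 2 ≤ q) (β : ℝ) (hs : 0 ≤ s) (hst : s < t) (ht : t < 1) :
    ∃ r ∈ Set.Ioo s t, orderEq q β t - orderEq q β s = orderSlope q β r * (t - s) := by
  obtain ⟨r, hr, h⟩ := exists_hasDerivAt_eq_slope (orderEq q β) (orderSlope q β) hst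
    ((continuousOn_orderEq hq β).mono fun x hx => ⟨hs.trans hx.1, hx.2.trans_lt ht⟩)
    fun x hx => hasDerivAt_orderEq hq β ⟨hs.trans hx.1.le, hx.2.trans ht⟩
  exact ⟨r, hr, by rw [h, div_mul_cancel₀ _ (sub_pos.2 hst).ne']⟩

-- By Rolle, the convex function `orderSlope` vanishes both to the left and to the right of `s`.
lemma orderSlope_neg_of_zero_of_zero (hq : 2 ≤ q) (hs : 0 < s) (hst : s < t) (ht : t < 1)
    (hs0 : orderEq q β s = 0) (ht0 : orderEq q β t = 0) : orderSlope q β s < 0 := by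
  obtain ⟨r₁, hr₁, h₁⟩ := exists_orderSlope_eq hq β le_rfl hs (hst.trans ht)
  obtain ⟨r₂, hr₂, h₂⟩ := exists_orderSlope_eq hq β hs.le hst ht
  rw [orderEq_zero, hs0, sub_self, eq_comm, mul_eq_zero, or_iff_left (sub_pos.2 hs).ne'] at h₁
  rw [hs0, ht0, sub_self, eq_comm, mul_eq_zero, or_iff_left (sub_pos.2 hst).ne'] at h₂
  have hr := hr₁.2.trans hr₂.1
  have hmax := (strictConvexOn_orderSlope hq β).lt_on_openSegment
    ⟨hr₁.1.le, hr₁.2.trans (hst.trans ht)⟩ ⟨(hs.trans hr₂.1).le, hr₂.2.trans ht⟩ hr.ne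
    (z := s) (by rw [openSegment_eq_Ioo hr]; exact ⟨hr₁.2, hr₂.1⟩)
  rwa [h₁, h₂, max_self] at hmax

lemma exists_orderSlope_neg (hq : 2 ≤ q) (hs : s ∈ Set.Ioo 0 1) (hneg : orderEq q β s < 0) :
    ∃ r ∈ Set.Ioo 0 s, orderSlope q β r < 0 := by
  obtain ⟨r, hr, h⟩ := exists_orderSlope_eq hq β le_rfl hs.1 hs.2
  rw [orderEq_zero, sub_zero, sub_zero] at h
  exact ⟨r, hr, neg_of_mul_neg_left (h ▸ hneg) hs.1.le⟩

lemma orderSlope_pos_of_neg_of_zero (hq : 2 ≤ q) (hs : 0 < s) (hst : s < t) (ht : t < 1)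
    (hneg : orderEq q β s < 0) (ht0 : orderEq q β t = 0) : 0 < orderSlope q β t := by
  obtain ⟨r₁, hr₁, h₁⟩ := exists_orderSlope_neg hq ⟨hs, hst.trans ht⟩ hneg
  obtain ⟨r₂, hr₂, h₂⟩ := exists_orderSlope_eq hq β hs.le hst ht
  have h₂' : 0 < orderSlope q β r₂ :=
    pos_of_mul_pos_left (h₂ ▸ by linarith) (sub_pos.2 hst).le
  refine h₂'.trans ((strictConvexOn_orderSlope hq β).convexOn.lt_right_of_left_lt
    ⟨hr₁.1.le, hr₁.2.trans (hst.trans ht)⟩ ⟨(hs.trans hst).le, ht⟩ ?_ (h₁.trans h₂'))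
  rw [openSegment_eq_Ioo (hr₁.2.trans hst)]
  exact ⟨hr₁.2.trans hr₂.1, hr₂.2⟩

lemma eventually_orderSlope_neg_nhdsGT_zero (hq : 2 ≤ q) (hs : s ∈ Set.Ioo 0 1)
    (hneg : orderEq q β s < 0) (hβ : (q : ℝ) ≤ β) :
    ∀ᶠ t in nhdsWithin 0 (Set.Ioi 0), orderSlope q β t < 0 := by
  obtain ⟨r, hr, h⟩ := exists_orderSlope_neg hq hs hneg
  filter_upwards [Ioo_mem_nhdsGT hr.1] with t ht
  refine ((strictConvexOn_orderSlope hq β).lt_on_openSegment (by simp) ⟨hr.1.le, hr.2.trans hs.2⟩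
    hr.1.ne (openSegment_eq_Ioo hr.1 ▸ ht)).trans_le (max_le ?_ h.le)
  rwa [orderSlope_zero, sub_nonpos]

lemma log_one_add_mul_nonneg (hq : 2 ≤ q) (hs : 0 ≤ s) :
    0 ≤ Real.log (1 + ((q : ℝ) - 1) * s) := by
  have := one_le_cast_sub_one hq
  exact Real.log_nonneg (by nlinarith)

lemma pos_of_orderEq_neg (hq : 2 ≤ q) (hs : s ∈ Set.Ioo 0 1) (hneg : orderEq q β s < 0) :
    0 < β := by
  have h₁ := log_one_add_mul_nonneg hq hs.1.le
  have h₂ : Real.log (1 - s) ≤ 0 := Real.log_nonpos (by linarith [hs.2]) (by linarith [hs.1])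
  unfold orderEq at hneg
  exact pos_of_mul_pos_left (by linarith : 0 < β * s) hs.1.le

lemma orderEq_pos_of_one_sub_exp_le (hq : 2 ≤ q) (hβ : 0 < β) (hs : s ∈ Set.Ico 0 1)
    (hexp : 1 - Real.exp (-β - 1) ≤ s) : 0 < orderEq q β s := by
  have h₁ := log_one_add_mul_nonneg hq hs.1
  have h₂ : Real.log (1 - s) ≤ -β - 1 := by
    rw [Real.log_le_iff_le_exp (sub_pos.2 hs.2)]
    linarith
  have h₃ : β * s ≤ β := mul_le_of_le_one_right hβ.le hs.2.le
  unfold orderEq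
  linarith

lemma exists_greatest_orderEq_eq_zero (hq : 2 ≤ q) (hs : s ∈ Set.Ioo 0 1)
    (hneg : orderEq q β s < 0) :
    ∃ m ∈ Set.Ioo s 1, orderEq q β m = 0 ∧ ∀ t ∈ Set.Ioo 0 1, orderEq q β t = 0 → t ≤ m := by
  set c : ℝ := 1 - Real.exp (-β - 1)
  have hpos : ∀ t ∈ Set.Ico 0 1, c ≤ t → 0 < orderEq q β t := fun t ht =>
    orderEq_pos_of_one_sub_exp_le hq (pos_of_orderEq_neg hq hs hneg) ht
  have hsc : s < c := by
    by_contra! h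
    exact hneg.not_gt (hpos s ⟨hs.1.le, hs.2⟩ h)
  have hc1 : c < 1 := sub_lt_self 1 (Real.exp_pos _)
  have hcont : ContinuousOn (orderEq q β) (Set.Icc s c) :=
    (continuousOn_orderEq hq β).mono fun x hx => ⟨hs.1.le.trans hx.1, hx.2.trans_lt hc1⟩
  have hcompact : IsCompact (Set.Icc s c ∩ orderEq q β ⁻¹' {0}) :=
    isCompact_Icc.of_isClosed_subset
      (hcont.preimage_isClosed_of_isClosed isClosed_Icc isClosed_singleton) Set.inter_subset_left
  obtain ⟨m, ⟨hm, hm0⟩, hmax⟩ := hcompact.exists_isGreatest <|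
    intermediate_value_Icc hsc.le hcont
      ⟨hneg.le, (hpos c ⟨(hs.1.trans hsc).le, hc1⟩ le_rfl).le⟩
  have hm0 : orderEq q β m = 0 := hm0
  refine ⟨m, ⟨hm.1.lt_of_ne ?_, hm.2.trans_lt hc1⟩, hm0, fun t ht ht0 => ?_⟩
  · rintro rfl
    exact hneg.ne hm0
  · rcases le_or_gt t s with hts | hst
    · exact hts.trans hm.1
    · refine hmax ⟨⟨hst.le, ?_⟩, ht0⟩
      by_contra! h
      exact (hpos t ⟨ht.1.le, ht.2⟩ h.le).ne' ht0

lemma order_eq_of_isGreatest (hq : 2 ≤ q) {m : ℝ} (hm : m ∈ Set.Ioo 0 1)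
    (hm0 : orderEq q β m = 0) (hmax : ∀ t ∈ Set.Ioo 0 1, orderEq q β t = 0 → t ≤ m) :
    order q β = m := by
  refine IsGreatest.csSup_eq ⟨⟨one_add_mul_pos hq hm.1.le, sub_pos.2 hm.2, sub_eq_zero.1 hm0⟩, ?_⟩
  rintro t ⟨-, ht1, ht⟩
  rcases le_or_gt t 0 with ht0 | ht0
  · exact ht0.trans hm.1.le
  · exact hmax t ⟨ht0, sub_pos.1 ht1⟩ (sub_eq_zero.2 ht)

lemma order_spec (hq : 2 ≤ q) (hs : s ∈ Set.Ioo 0 1) (hneg : orderEq q β s < 0) :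
    order q β ∈ Set.Ioo s 1 ∧ orderEq q β (order q β) = 0 ∧
      ∀ t ∈ Set.Ioo 0 1, orderEq q β t = 0 → t ≤ order q β := by
  obtain ⟨m, hm, hm0, hmax⟩ := exists_greatest_orderEq_eq_zero hq hs hneg
  rw [order_eq_of_isGreatest hq ⟨hs.1.trans hm.1, hm.2⟩ hm0 hmax]
  exact ⟨hm, hm0, hmax⟩

end OrderParameter

/-! ### Local minima of the free energy on the simplex -/

section LocalMinima

variable {q : ℕ} {β s : ℝ} {x : Fin q → ℝ}

/-- The point of the simplex with one distinguished coordinate `i` and order parameter `s`. -/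
def orderedPoint (i : Fin q) (s : ℝ) : Fin q → ℝ := fun k =>
  if k = i then (1 + ((q : ℝ) - 1) * s) / q else (1 - s) / q

lemma orderedPoint_self (i : Fin q) (s : ℝ) :
    orderedPoint i s i = (1 + ((q : ℝ) - 1) * s) / q := if_pos rfl

lemma orderedPoint_of_ne {i k : Fin q} (hk : k ≠ i) (s : ℝ) :
    orderedPoint i s k = (1 - s) / q := if_neg hk

lemma card_univ_erase (i : Fin q) : ((Finset.univ.erase i).card : ℝ) = (q : ℝ) - 1 := by
  rw [Finset.card_erase_of_mem (Finset.mem_univ i), Finset.card_univ, Fintype.card_fin,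
    Nat.cast_sub (Fin.pos i), Nat.cast_one]

lemma sum_comp_orderedPoint (i : Fin q) (s : ℝ) (f : ℝ → ℝ) :
    ∑ k, f (orderedPoint i s k) =
      f ((1 + ((q : ℝ) - 1) * s) / q) + ((q : ℝ) - 1) * f ((1 - s) / q) := by
  rw [← Finset.add_sum_erase _ _ (Finset.mem_univ i), orderedPoint_self,
    Finset.sum_congr rfl fun k hk => by rw [orderedPoint_of_ne (Finset.ne_of_mem_erase hk)],
    Finset.sum_const, nsmul_eq_mul, card_univ_erase]

lemma orderedPoint_mem_stdSimplex (i : Fin q) (hs : s ∈ Set.Icc 0 1) :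
    orderedPoint i s ∈ stdSimplex ℝ (Fin q) := by
  have hq : (1 : ℝ) ≤ q := by exact_mod_cast Fin.pos i
  refine ⟨fun k => ?_, ?_⟩
  · unfold orderedPoint
    split_ifs
    · exact div_nonneg (add_nonneg zero_le_one (mul_nonneg (sub_nonneg.2 hq) hs.1)) (by linarith)
    · exact div_nonneg (sub_nonneg.2 hs.2) (by linarith)
  · rw [show ∑ k, orderedPoint i s k = _ from sum_comp_orderedPoint i s id, id, id]
    field_simp
    ring

lemma orderedPoint_zero (i : Fin q) : orderedPoint i 0 = fun _ => 1 / (q : ℝ) := by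
  funext k
  simp [orderedPoint]

lemma continuous_orderedPoint (i : Fin q) : Continuous (orderedPoint i) := by
  refine continuous_pi fun k => ?_
  unfold orderedPoint
  split_ifs <;> fun_prop

lemma hasDerivAt_freeEnergy_orderedPoint (hq : 2 ≤ q) (hβ : 0 < β) (i : Fin q)
    (hs : s ∈ Set.Ico 0 1) :
    HasDerivAt (fun s => freeEnergy β (orderedPoint i s))
      (((q : ℝ) - 1) / (q * β) * orderEq q β s) s := by
  have hq0 : (0 : ℝ) < q := by exact_mod_cast Fin.pos i
  have hlin := one_add_mul_pos hq hs.1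
  have hsub : 0 < 1 - s := sub_pos.2 hs.2
  simp only [freeEnergy_eq_sum, sum_comp_orderedPoint]
  have hlin' : HasDerivAt (fun s : ℝ => (1 + ((q : ℝ) - 1) * s) / q) (((q : ℝ) - 1) / q) s := by
    simpa using (((hasDerivAt_id s).const_mul ((q : ℝ) - 1)).const_add 1).div_const (q : ℝ)
  have hsub' : HasDerivAt (fun s : ℝ => (1 - s) / q) (-1 / q) s := by
    simpa using ((hasDerivAt_id s).const_sub 1).div_const (q : ℝ)
  refine (((hasDerivAt_colourEnergy β (div_pos hlin hq0).ne').comp s hlin').add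
    (((hasDerivAt_colourEnergy β (div_pos hsub hq0).ne').comp s hsub').const_mul
      ((q : ℝ) - 1))).congr_deriv ?_
  rw [orderEq, Real.log_div hlin.ne' hq0.ne', Real.log_div hsub.ne' hq0.ne']
  field_simp
  ring

lemma eventually_lt_nhdsGT_of_deriv_neg {f : ℝ → ℝ} {a : ℝ}
    (hf : ContinuousAt f a) (hf' : ∀ᶠ t in nhdsWithin a (Set.Ioi a), deriv f t < 0) :
    ∀ᶠ t in nhdsWithin a (Set.Ioi a), f t < f a := by
  obtain ⟨b, hab, hb⟩ := (mem_nhdsGT_iff_exists_Ioo_subset (a := a)).1 hf'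
  have hcont : ContinuousOn f (Set.Ico a b) := by
    intro t ht
    rcases ht.1.eq_or_lt with rfl | hat
    · exact hf.continuousWithinAt
    · exact (differentiableAt_of_deriv_ne_zero (hb ⟨hat, ht.2⟩).ne).continuousAt.continuousWithinAt
  have hanti : StrictAntiOn f (Set.Ico a b) :=
    strictAntiOn_of_deriv_neg (convex_Ico a b) hcont fun t ht => by
      rw [interior_Ico] at ht
      exact hb ht
  filter_upwards [Ioo_mem_nhdsGT hab] with t ht
  exact hanti ⟨le_rfl, hab⟩ (Set.Ioo_subset_Ico_self ht) ht.1

lemma not_isLocalMinOn_orderedPoint (hq : 2 ≤ q) (hβ : 0 < β) (i : Fin q) (hs : s ∈ Set.Ico 0 1)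
    (hs0 : orderEq q β s = 0)
    (hslope : ∀ᶠ t in nhdsWithin s (Set.Ioi s), orderSlope q β t < 0) :
    ¬ IsLocalMinOn (freeEnergy β) (stdSimplex ℝ (Fin q)) (orderedPoint i s) := by
  intro hmin
  have hq1 := one_le_cast_sub_one hq
  have hconst : 0 < ((q : ℝ) - 1) / (q * β) :=
    div_pos (by linarith) (mul_pos (by linarith) hβ)
  have hs1 : ∀ᶠ t in nhdsWithin s (Set.Ioi s), t ∈ Set.Ico 0 1 :=
    mem_of_superset (Ioo_mem_nhdsGT hs.2) fun t ht => ⟨hs.1.trans ht.1.le, ht.2⟩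
  have hneg : ∀ᶠ t in nhdsWithin s (Set.Ioi s), orderEq q β t < 0 := by
    rw [← hs0]
    refine eventually_lt_nhdsGT_of_deriv_neg (hasDerivAt_orderEq hq β hs).continuousAt ?_
    filter_upwards [hs1, hslope] with t ht ht'
    rwa [(hasDerivAt_orderEq hq β ht).deriv]
  have hdecr : ∀ᶠ t in nhdsWithin s (Set.Ioi s),
      freeEnergy β (orderedPoint i t) < freeEnergy β (orderedPoint i s) := by
    refine eventually_lt_nhdsGT_of_deriv_neg
      (hasDerivAt_freeEnergy_orderedPoint hq hβ i hs).continuousAt ?_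
    filter_upwards [hs1, hneg] with t ht ht'
    rw [(hasDerivAt_freeEnergy_orderedPoint hq hβ i ht).deriv]
    exact mul_neg_of_pos_of_neg hconst ht'
  have htend : Tendsto (orderedPoint i) (nhdsWithin s (Set.Ioi s))
      (nhdsWithin (orderedPoint i s) (stdSimplex ℝ (Fin q))) :=
    tendsto_nhdsWithin_of_tendsto_nhds_of_eventually_within _
      ((continuous_orderedPoint i).continuousAt.tendsto.mono_left nhdsWithin_le_nhds)
      (hs1.mono fun t ht => orderedPoint_mem_stdSimplex i ⟨ht.1, ht.2.le⟩)
  obtain ⟨t, hlt, hle⟩ := (hdecr.and (htend.eventually hmin)).exists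
  exact hlt.not_ge hle

/-- The vector obtained from `x` by moving the mass `t` from coordinate `l` to coordinate `k`. -/
def transfer (x : Fin q → ℝ) (k l : Fin q) (t : ℝ) : Fin q → ℝ :=
  x + t • (Pi.single k 1 - Pi.single l 1)

section Transfer

variable {k l : Fin q}

lemma sum_comp_transfer (hkl : k ≠ l) (x : Fin q → ℝ) (t : ℝ) (f : ℝ → ℝ) :
    ∑ j, f (transfer x k l t j) + f (x k) + f (x l) =
      ∑ j, f (x j) + f (x k + t) + f (x l - t) := by
  have hdiff : ∑ j, (f (transfer x k l t j) - f (x j)) =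
      (f (x k + t) - f (x k)) + (f (x l - t) - f (x l)) := by
    rw [Fintype.sum_eq_add k l hkl fun j hj => by simp [transfer, hj.1, hj.2]]
    simp [transfer, hkl, hkl.symm, sub_eq_add_neg]
  rw [Finset.sum_sub_distrib] at hdiff
  linarith

lemma transfer_mem_stdSimplex (hkl : k ≠ l) (hx : x ∈ stdSimplex ℝ (Fin q)) {t : ℝ}
    (ht : t ∈ Set.Icc (-x k) (x l)) : transfer x k l t ∈ stdSimplex ℝ (Fin q) := by
  refine ⟨fun j => ?_, ?_⟩
  · have hj := hx.1 j
    rcases eq_or_ne j k with rfl | hjk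
    · simp only [transfer, Pi.add_apply, Pi.smul_apply, Pi.sub_apply, Pi.single_eq_same,
        Pi.single_eq_of_ne hkl, smul_eq_mul]
      linarith [ht.1]
    rcases eq_or_ne j l with rfl | hjl
    · simp only [transfer, Pi.add_apply, Pi.smul_apply, Pi.sub_apply, Pi.single_eq_same,
        Pi.single_eq_of_ne hjk, smul_eq_mul]
      linarith [ht.2]
    · simpa [transfer, hjk, hjl] using hj
  · have hsum := sum_comp_transfer hkl x t id
    simp only [id, hx.2] at hsum
    linarith

lemma isLocalMinOn_colourEnergy_add (hx : x ∈ stdSimplex ℝ (Fin q))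
    (hmin : IsLocalMinOn (freeEnergy β) (stdSimplex ℝ (Fin q)) x) (hkl : k ≠ l) :
    IsLocalMinOn (fun t => colourEnergy β (x k + t) + colourEnergy β (x l - t))
      (Set.Icc (-x k) (x l)) 0 := by
  have hzero : transfer x k l 0 = x := by simp [transfer]
  have hcont : Continuous (transfer x k l) := by unfold transfer; fun_prop
  have htend : Tendsto (transfer x k l) (nhdsWithin 0 (Set.Icc (-x k) (x l)))
      (nhdsWithin x (stdSimplex ℝ (Fin q))) := by
    refine tendsto_nhdsWithin_of_tendsto_nhds_of_eventually_within _ ?_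
      (eventually_nhdsWithin_of_forall fun t ht => transfer_mem_stdSimplex hkl hx ht)
    conv in nhds x => rw [← hzero]
    exact hcont.continuousAt.tendsto.mono_left nhdsWithin_le_nhds
  filter_upwards [htend.eventually hmin] with t ht
  have hsum := sum_comp_transfer hkl x t (colourEnergy β)
  rw [freeEnergy_eq_sum, freeEnergy_eq_sum] at ht
  simp only [add_zero, sub_zero]
  linarith

lemma hasDerivAt_colourEnergy_add {t : ℝ} (hk : x k + t ≠ 0) (hl : x l - t ≠ 0) :
    HasDerivAt (fun t => colourEnergy β (x k + t) + colourEnergy β (x l - t))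
      (deriv (colourEnergy β) (x k + t) - deriv (colourEnergy β) (x l - t)) t := by
  have hadd := (hasDerivAt_colourEnergy β hk).differentiableAt.hasDerivAt.comp_const_add (x k) t
  have hsub := (hasDerivAt_colourEnergy β hl).differentiableAt.hasDerivAt.comp_const_sub (x l) t
  exact (hadd.add hsub).congr_deriv (sub_eq_add_neg _ _).symm

-- Adding a little mass to an empty coordinate pays off: `x log x` has slope `-∞` at `0`.
lemma pos_of_isLocalMinOn (hβ : 0 < β) (hx : x ∈ stdSimplex ℝ (Fin q))
    (hmin : IsLocalMinOn (freeEnergy β) (stdSimplex ℝ (Fin q)) x) (k : Fin q) : 0 < x k := by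
  refine (hx.1 k).lt_of_ne fun hk => ?_
  obtain ⟨l, hl⟩ : ∃ l, 0 < x l := by
    by_contra! h
    linarith [hx.2, Finset.sum_nonpos fun l (_ : l ∈ Finset.univ) => h l]
  have hkl : k ≠ l := by
    rintro rfl
    exact hl.ne hk
  have hlt : ∀ᶠ t in nhdsWithin 0 (Set.Ioi 0), t < x l :=
    (eventually_lt_nhds hl).filter_mono nhdsWithin_le_nhds
  have hslope : ∀ᶠ t in nhdsWithin 0 (Set.Ioi 0),
      deriv (colourEnergy β) t - deriv (colourEnergy β) (x l - t) < 0 := by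
    have hfin : ContinuousAt (fun t => deriv (colourEnergy β) (x l - t)) 0 :=
      ContinuousAt.comp (g := deriv (colourEnergy β)) (by
        simpa using (hasDerivAt_deriv_colourEnergy β hl.ne').continuousAt) (by fun_prop)
    have htend := (tendsto_deriv_colourEnergy_nhdsGT_zero hβ).atBot_add
      (hfin.tendsto.neg.mono_left nhdsWithin_le_nhds)
    exact (htend.eventually_lt_atBot 0).mono fun t ht => by rwa [← sub_eq_add_neg] at ht
  have hdecr := eventually_lt_nhdsGT_of_deriv_neg
    (f := fun t => colourEnergy β (x k + t) + colourEnergy β (x l - t)) (a := 0)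
    (by have := continuous_colourEnergy β; fun_prop) (by
      filter_upwards [hslope, hlt, self_mem_nhdsWithin] with t ht htl ht0
      rw [(hasDerivAt_colourEnergy_add (by rw [← hk, zero_add]; exact ne_of_gt ht0)
        (sub_pos.2 htl).ne').deriv, ← hk, zero_add]
      exact ht)
  have hpair := (eventually_nhdsWithin_iff.1
    (isLocalMinOn_colourEnergy_add hx hmin hkl)).filter_mono (nhdsWithin_le_nhds (s := Set.Ioi 0))
  obtain ⟨t, ⟨⟨htd, htl⟩, htm⟩, ht0⟩ :=
    (((hdecr.and hlt).and hpair).and self_mem_nhdsWithin).exists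
  exact htd.not_ge (htm ⟨by rw [← hk, neg_zero]; exact le_of_lt ht0, htl.le⟩)

lemma isLocalMin_colourEnergy_add (hβ : 0 < β) (hx : x ∈ stdSimplex ℝ (Fin q))
    (hmin : IsLocalMinOn (freeEnergy β) (stdSimplex ℝ (Fin q)) x) (hkl : k ≠ l) :
    IsLocalMin (fun t => colourEnergy β (x k + t) + colourEnergy β (x l - t)) 0 :=
  (isLocalMinOn_colourEnergy_add hx hmin hkl).isLocalMin <| Icc_mem_nhds
    (neg_lt_zero.2 (pos_of_isLocalMinOn hβ hx hmin k)) (pos_of_isLocalMinOn hβ hx hmin l)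

lemma deriv_colourEnergy_eq_of_isLocalMinOn (hβ : 0 < β) (hx : x ∈ stdSimplex ℝ (Fin q))
    (hmin : IsLocalMinOn (freeEnergy β) (stdSimplex ℝ (Fin q)) x) (k l : Fin q) :
    deriv (colourEnergy β) (x k) = deriv (colourEnergy β) (x l) := by
  rcases eq_or_ne k l with rfl | hkl
  · rfl
  have h := (isLocalMin_colourEnergy_add hβ hx hmin hkl).hasDerivAt_eq_zero
    (hasDerivAt_colourEnergy_add (by simpa using (pos_of_isLocalMinOn hβ hx hmin k).ne')
      (by simpa using (pos_of_isLocalMinOn hβ hx hmin l).ne'))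
  rwa [add_zero, sub_zero, sub_eq_zero] at h

lemma eq_of_one_div_lt_of_isLocalMinOn (hβ : 0 < β) (hx : x ∈ stdSimplex ℝ (Fin q))
    (hmin : IsLocalMinOn (freeEnergy β) (stdSimplex ℝ (Fin q)) x)
    (hk : 1 / β < x k) (hl : 1 / β < x l) : k = l := by
  by_contra hkl
  have hloc := isLocalMin_colourEnergy_add hβ hx hmin hkl
  have hnear : ∀ z, 1 / β < z → ∀ᶠ t in nhds (0 : ℝ), 1 / β < z + t ∧ 1 / β < z - t := by
    intro z hz
    refine Eventually.and ?_ ?_ <;>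
      exact continuousAt_const.eventually_lt (by fun_prop) (by simpa using hz)
  have hneg : Tendsto (fun t : ℝ => -t) (nhds 0) (nhds 0) := by
    simpa using (continuous_neg (G := ℝ)).tendsto 0
  have hmid : ∀ z t, t ≠ 0 → 1 / β < z + t ∧ 1 / β < z - t →
      colourEnergy β (z + t) + colourEnergy β (z - t) < 2 * colourEnergy β z := by
    rintro z t ht ⟨h₁, h₂⟩
    have h := (strictConcaveOn_colourEnergy hβ).2 h₁ h₂ (by grind) (one_half_pos (α := ℝ))
      one_half_pos (by norm_num)
    simp only [smul_eq_mul] at h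
    rw [show 1 / 2 * (z + t) + 1 / 2 * (z - t) = z by ring] at h
    linarith
  obtain ⟨t, ⟨⟨⟨⟨h₁, h₂⟩, htk⟩, htl⟩, ht⟩⟩ :=
    ((((hloc.and (hneg.eventually hloc)).and (hnear _ hk)).and (hnear _ hl)).filter_mono
      nhdsWithin_le_nhds |>.and (self_mem_nhdsWithin (s := {0}ᶜ))).exists
  simp only [add_zero, sub_zero, sub_neg_eq_add, ← sub_eq_add_neg] at h₁ h₂
  linarith [hmid _ t ht htk, hmid _ t ht htl]

end Transfer

lemma eq_orderedPoint_of_forall_ne (hx : ∑ k, x k = 1) {i j : Fin q} (hji : j ≠ i)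
    (h : ∀ k, k ≠ i → x k = x j) : x = orderedPoint i (1 - q * x j) := by
  have hq0 : (q : ℝ) ≠ 0 := by exact_mod_cast (Fin.pos i).ne'
  funext k
  rcases eq_or_ne k i with rfl | hk
  · rw [← Finset.add_sum_erase _ _ (Finset.mem_univ k),
      Finset.sum_congr rfl fun l hl => h l (Finset.ne_of_mem_erase hl), Finset.sum_const,
      nsmul_eq_mul, card_univ_erase] at hx
    rw [orderedPoint_self]
    field_simp
    linear_combination (q : ℝ) * hx
  · rw [orderedPoint_of_ne hk, h k hk]
    field_simp
    ring

lemma orderEq_eq_zero_of_deriv_eq (hq : 2 ≤ q) (hβ : 0 < β) (hs : s ∈ Set.Ico 0 1)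
    (h : deriv (colourEnergy β) ((1 + ((q : ℝ) - 1) * s) / q) =
      deriv (colourEnergy β) ((1 - s) / q)) : orderEq q β s = 0 := by
  have hq0 : (0 : ℝ) < q := by linarith [one_le_cast_sub_one hq]
  have hlin := one_add_mul_pos hq hs.1
  have hsub : 0 < 1 - s := sub_pos.2 hs.2
  rw [deriv_colourEnergy β (div_pos hlin hq0).ne', deriv_colourEnergy β (div_pos hsub hq0).ne',
    Real.log_div hlin.ne' hq0.ne', Real.log_div hsub.ne' hq0.ne'] at h
  unfold orderEq
  field_simp at h
  exact mul_left_cancel₀ hq0.ne' (by linear_combination h)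

lemma eq_uniform_or_eq_orderedPoint (hq : 2 ≤ q) (hβ : 0 < β) (hx : x ∈ stdSimplex ℝ (Fin q))
    (hmin : IsLocalMinOn (freeEnergy β) (stdSimplex ℝ (Fin q)) x) :
    x = (fun _ => 1 / (q : ℝ)) ∨
      ∃ i, ∃ s ∈ Set.Ioo 0 1, x = orderedPoint i s ∧ orderEq q β s = 0 := by
  have hpos := pos_of_isLocalMinOn hβ hx hmin
  have hderiv := deriv_colourEnergy_eq_of_isLocalMinOn hβ hx hmin
  have hsmall : ∀ k l, x k ≤ 1 / β → x l ≤ 1 / β → x k = x l := fun k l hk hl =>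
    (strictMonoOn_deriv_colourEnergy hβ).injOn ⟨hpos k, hk⟩ ⟨hpos l, hl⟩ (hderiv k l)
  have : Nontrivial (Fin q) := Fin.nontrivial_iff_two_le.2 hq
  have hq0 : (0 : ℝ) < q := by linarith [one_le_cast_sub_one hq]
  by_cases hlarge : ∃ i, 1 / β < x i
  · right
    obtain ⟨i, hi⟩ := hlarge
    have hle : ∀ k, k ≠ i → x k ≤ 1 / β := fun k hk =>
      not_lt.1 fun h => hk (eq_of_one_div_lt_of_isLocalMinOn hβ hx hmin h hi)
    obtain ⟨j, hj⟩ := exists_ne i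
    have hxs := eq_orderedPoint_of_forall_ne hx.2 hj fun k hk =>
      hsmall k j (hle k hk) (hle j hj)
    set s := 1 - q * x j
    have hxi : x i = (1 + ((q : ℝ) - 1) * s) / q := by rw [hxs, orderedPoint_self]
    have hxj : x j = (1 - s) / q := by rw [hxs, orderedPoint_of_ne hj]
    have hs : s ∈ Set.Ioo 0 1 := by
      refine ⟨?_, sub_lt_self 1 (mul_pos hq0 (hpos j))⟩
      have hdiff : x i - x j = s := by
        rw [hxi, hxj]
        field_simp
        ring
      exact hdiff ▸ sub_pos.2 ((hle j hj).trans_lt hi)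
    exact ⟨i, s, hs, hxs, orderEq_eq_zero_of_deriv_eq hq hβ ⟨hs.1.le, hs.2⟩
      (hxi ▸ hxj ▸ hderiv i j)⟩
  · left
    push Not at hlarge
    funext k
    have hsum := hx.2
    rw [Finset.sum_congr rfl fun l _ => hsmall l k (hlarge l) (hlarge k), Finset.sum_const,
      Finset.card_univ, Fintype.card_fin, nsmul_eq_mul] at hsum
    rw [eq_div_iff hq0.ne', mul_comm, hsum]

end LocalMinima

/-! ### Descent to a local minimum -/

section Landscape

variable {E : Type*} [MetricSpace E] {S : Set E} {F : E → ℝ} {x : E}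

lemma exists_shell_of_isLocalMinOn (hS : IsCompact S) (hF : ContinuousOn F S)
    (hx : IsLocalMinOn F S x) {T : Set E} (hT : T.Finite)
    (hmins : ∀ y ∈ S, IsLocalMinOn F S y → y ∈ T) :
    ∃ r > 0, ∃ c > 0, (∀ y ∈ T, y ≠ x → 2 * r ≤ dist y x) ∧
      ∀ y ∈ S, dist y x ∈ Set.Icc (r / 2) r → F x + c ≤ F y := by
  obtain ⟨ε, hε, hmin⟩ := Metric.eventually_nhds_iff_ball.1 (eventually_nhdsWithin_iff.1 hx)
  obtain ⟨δ, hδ, hsep⟩ := Metric.mem_nhds_iff.1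
    ((hT.sdiff (t := {x})).isClosed.compl_mem_nhds fun h => h.2 rfl)
  set r := min (ε / 2) (δ / 2)
  have hr : 0 < r := lt_min (half_pos hε) (half_pos hδ)
  have hrε : r < ε := (min_le_left _ _).trans_lt (half_lt_self hε)
  have hrδ : 2 * r ≤ δ := by linarith [min_le_right (ε / 2) (δ / 2)]
  have hdist : ∀ y ∈ T, y ≠ x → 2 * r ≤ dist y x := fun y hy hyx =>
    not_lt.1 fun h => hsep (Metric.mem_ball.2 (h.trans_le hrδ)) ⟨hy, hyx⟩
  set K := S ∩ {y | dist y x ∈ Set.Icc (r / 2) r}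
  have hK : IsCompact K := hS.inter_right
    (isClosed_Icc.preimage (by fun_prop : Continuous fun y => dist y x))
  have hstrict : ∀ y ∈ K, F x < F y := by
    rintro y ⟨hyS, hy⟩
    have hyε : y ∈ Metric.ball x ε := hy.2.trans_lt hrε
    refine (hmin y hyε hyS).lt_of_ne fun heq => ?_
    -- If `F y = F x`, then `y` is itself a local minimum, closer to `x` than `hdist` permits.
    have hlocal : IsLocalMinOn F S y := by
      filter_upwards [mem_nhdsWithin_of_mem_nhds (Metric.isOpen_ball.mem_nhds hyε),
        self_mem_nhdsWithin] with z hz hzS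
      exact heq ▸ hmin z hz hzS
    have hyx : y ≠ x := dist_pos.1 ((half_pos hr).trans_le hy.1)
    linarith [hdist y (hmins y hyS hlocal) hyx, hy.2]
  have hgap : ∃ c > 0, ∀ y ∈ K, F x + c ≤ F y := by
    rcases K.eq_empty_or_nonempty with hempty | hne
    · exact ⟨1, one_pos, by simp [hempty]⟩
    · obtain ⟨z, hz, hzmin⟩ := hK.exists_isMinOn hne (hF.mono Set.inter_subset_left)
      exact ⟨F z - F x, sub_pos.2 (hstrict z hz), fun y hy => by
        linarith [isMinOn_iff.1 hzmin y hy]⟩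
  obtain ⟨c, hc, hcK⟩ := hgap
  exact ⟨r, hr, c, hc, hdist, fun y hyS hy => hcK y ⟨hyS, hy⟩⟩

lemma exists_chain_to_localMin (hS : IsCompact S) (hF : ContinuousOn F S) (hx : x ∈ S) {η : ℝ}
    (hη : 0 < η) :
    ∃ y ∈ S, IsLocalMinOn F S y ∧ Relation.ReflTransGen
      (fun a b => b ∈ S ∧ F b ≤ F x ∧ dist a b < η) x y := by
  -- The set `C` of points reachable from `x` is compact; its minimiser is the local minimum.
  set C := {y | Relation.ReflTransGen (fun a b => b ∈ S ∧ F b ≤ F x ∧ dist a b < η) x y}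
  have hCS : C ⊆ S ∩ {y | F y ≤ F x} := by
    intro y hy
    rcases Relation.ReflTransGen.cases_tail hy with rfl | ⟨z, -, h⟩
    · exact ⟨hx, le_refl (F _)⟩
    · exact ⟨h.1, h.2.1⟩
  have hsub : IsCompact (S ∩ {y | F y ≤ F x}) :=
    hS.of_isClosed_subset (hF.preimage_isClosed_of_isClosed hS.isClosed isClosed_Iic)
      Set.inter_subset_left
  have hclosed : IsClosed C := by
    refine isClosed_of_closure_subset fun y hy => ?_
    have hyS := closure_minimal hCS hsub.isClosed hy
    obtain ⟨z, hz, hzy⟩ := Metric.mem_closure_iff.1 hy η hη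
    exact Relation.ReflTransGen.tail hz ⟨hyS.1, hyS.2, by rwa [dist_comm]⟩
  obtain ⟨y, hy, hmin⟩ := (hsub.of_isClosed_subset hclosed hCS).exists_isMinOn
    ⟨x, Relation.ReflTransGen.refl⟩ (hF.mono fun z hz => (hCS hz).1)
  refine ⟨y, (hCS hy).1, ?_, hy⟩
  filter_upwards [mem_nhdsWithin_of_mem_nhds (Metric.ball_mem_nhds y hη), self_mem_nhdsWithin]
    with z hz hzS
  refine not_lt.1 fun hlt => hlt.not_ge (isMinOn_iff.1 hmin z ?_)
  exact Relation.ReflTransGen.tail hy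
    ⟨hzS, hlt.le.trans (hCS hy).2, by rwa [dist_comm, ← Metric.mem_ball]⟩

end Landscape

/-! ### The minima above the critical temperature -/

section Minima

variable {q : ℕ} {β s : ℝ} {x y : Fin q → ℝ}

lemma isLocalMinOn_uniform (hβ : 0 < β) (hβq : β < q) :
    IsLocalMinOn (freeEnergy β) (stdSimplex ℝ (Fin q)) fun _ => 1 / (q : ℝ) := by
  have hne : (Finset.univ : Finset (Fin q)).Nonempty :=
    Finset.card_pos.1 (by simpa using Nat.cast_pos.1 (hβ.trans hβq))
  have hnear : ∀ᶠ y : Fin q → ℝ in nhds (fun _ => 1 / (q : ℝ)), ∀ k, y k < 1 / β :=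
    eventually_all.2 fun k => (continuous_apply k).continuousAt.eventually_lt continuousAt_const
      (one_div_lt_one_div_of_lt hβ hβq)
  filter_upwards [hnear.filter_mono nhdsWithin_le_nhds, self_mem_nhdsWithin] with y hy hmem
  have hJensen := card_mul_colourEnergy_le hβ hne fun k _ => ⟨hmem.1 k, (hy k).le⟩
  rw [hmem.2, Finset.card_univ, Fintype.card_fin] at hJensen
  rwa [freeEnergy_eq_sum, freeEnergy_eq_sum, Finset.sum_const, Finset.card_univ,
    Fintype.card_fin, nsmul_eq_mul]

lemma isLocalMin_freeEnergy_orderedPoint (hq : 2 ≤ q) (hβ : 0 < β) (i : Fin q)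
    (hs : s ∈ Set.Ioo 0 1) (hs0 : orderEq q β s = 0) (hslope : 0 < orderSlope q β s) :
    IsLocalMin (fun t => freeEnergy β (orderedPoint i t)) s := by
  have hq1 := one_le_cast_sub_one hq
  have hconst : 0 < ((q : ℝ) - 1) / (q * β) :=
    div_pos (by linarith) (mul_pos (by linarith) hβ)
  have hs' := Set.Ioo_subset_Ico_self hs
  have hderiv : deriv (fun t => freeEnergy β (orderedPoint i t)) =ᶠ[nhds s]
      fun t => ((q : ℝ) - 1) / (q * β) * orderEq q β t := by
    filter_upwards [Ioo_mem_nhds hs.1 hs.2] with t ht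
    exact (hasDerivAt_freeEnergy_orderedPoint hq hβ i (Set.Ioo_subset_Ico_self ht)).deriv
  refine isLocalMin_of_deriv_deriv_pos ?_ ?_
    (hasDerivAt_freeEnergy_orderedPoint hq hβ i hs').continuousAt
  · rw [hderiv.deriv_eq, ((hasDerivAt_orderEq hq β hs').const_mul _).deriv]
    exact mul_pos hconst hslope
  · rw [hderiv.eq_of_nhds, hs0, mul_zero]

-- Jensen's inequality on the convex range of `colourEnergy` averages all coordinates except `i`.
lemma freeEnergy_orderedPoint_le (hq : 2 ≤ q) (hβ : 0 < β) (hy : y ∈ stdSimplex ℝ (Fin q))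
    {i : Fin q} (hle : ∀ k, k ≠ i → y k ≤ 1 / β) :
    freeEnergy β (orderedPoint i ((q * y i - 1) / ((q : ℝ) - 1))) ≤ freeEnergy β y := by
  have hq1 := one_le_cast_sub_one hq
  have hq0 : (q : ℝ) ≠ 0 := by linarith
  have hq1' : (q : ℝ) - 1 ≠ 0 := by linarith
  have hne : (Finset.univ.erase i).Nonempty := by
    rw [← Finset.card_pos, ← Nat.cast_pos (α := ℝ), card_univ_erase]
    linarith
  have hJensen := card_mul_colourEnergy_le hβ hne fun k hk =>
    ⟨hy.1 k, hle k (Finset.ne_of_mem_erase hk)⟩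
  have hsum := hy.2
  rw [← Finset.add_sum_erase _ _ (Finset.mem_univ i), ← eq_sub_iff_add_eq'] at hsum
  rw [card_univ_erase, hsum] at hJensen
  have hself : (1 + ((q : ℝ) - 1) * ((q * y i - 1) / ((q : ℝ) - 1))) / q = y i := by
    field_simp
    ring
  have hother : (1 - (q * y i - 1) / ((q : ℝ) - 1)) / q = (1 - y i) / ((q : ℝ) - 1) := by
    field_simp
    ring
  rw [freeEnergy_eq_sum, sum_comp_orderedPoint, freeEnergy_eq_sum,
    ← Finset.add_sum_erase _ _ (Finset.mem_univ i), hself, hother]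
  gcongr

lemma one_sub_div_lt_one_div (hq : 2 ≤ q) (hβ : 0 < β) (hs : s ∈ Set.Ioo 0 1)
    (hslope : 0 < orderSlope q β s) : (1 - s) / q < 1 / β := by
  have hq1 := one_le_cast_sub_one hq
  have hsub : 0 < 1 - s := sub_pos.2 hs.2
  have hle : ((q : ℝ) - 1) / (1 + ((q : ℝ) - 1) * s) ≤ ((q : ℝ) - 1) / (1 - s) :=
    div_le_div_of_nonneg_left (by linarith) hsub (by nlinarith [hs.1])
  have hlt : β < q / (1 - s) := by
    calc β < ((q : ℝ) - 1) / (1 + ((q : ℝ) - 1) * s) + 1 / (1 - s) := sub_pos.1 hslope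
      _ ≤ ((q : ℝ) - 1) / (1 - s) + 1 / (1 - s) := by gcongr
      _ = q / (1 - s) := by ring
  rwa [div_lt_div_iff₀ (by linarith) hβ, one_mul, mul_comm, ← lt_div_iff₀ hsub]

lemma isLocalMinOn_orderedPoint (hq : 2 ≤ q) (hβ : 0 < β) (i : Fin q)
    (hs : s ∈ Set.Ioo 0 1) (hs0 : orderEq q β s = 0) (hslope : 0 < orderSlope q β s) :
    IsLocalMinOn (freeEnergy β) (stdSimplex ℝ (Fin q)) (orderedPoint i s) := by
  have hq1 := one_le_cast_sub_one hq
  have htend : Tendsto (fun y : Fin q → ℝ => (q * y i - 1) / ((q : ℝ) - 1))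
      (nhds (orderedPoint i s)) (nhds s) := by
    have hval : (q * orderedPoint i s i - 1) / ((q : ℝ) - 1) = s := by
      rw [orderedPoint_self, mul_div_cancel₀ _ (by linarith), add_sub_cancel_left,
        mul_div_cancel_left₀ _ (by linarith)]
    conv in nhds s => rw [← hval]
    exact Continuous.tendsto (by fun_prop) _
  have hnear : ∀ᶠ y in nhds (orderedPoint i s), ∀ k, k ≠ i → y k < 1 / β := by
    refine eventually_all.2 fun k => eventually_imp_distrib_left.2 fun hk => ?_
    exact (continuous_apply k).continuousAt.eventually_lt continuousAt_const
      (orderedPoint_of_ne hk s ▸ one_sub_div_lt_one_div hq hβ hs hslope)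
  filter_upwards [(htend.eventually (isLocalMin_freeEnergy_orderedPoint hq hβ i hs hs0
    hslope)).filter_mono nhdsWithin_le_nhds, hnear.filter_mono nhdsWithin_le_nhds,
    self_mem_nhdsWithin] with y hmin hle hmem
  exact hmin.trans (freeEnergy_orderedPoint_le hq hβ hmem fun k hk => (hle k hk).le)

-- At low temperature a one-colour vertex has less free energy than the uniform vector.
lemma exists_isLocalMinOn_ne_uniform (hq : 2 ≤ q) :
    {β : ℝ | 0 < β ∧ ∃ x ∈ stdSimplex ℝ (Fin q), x ≠ (fun _ => 1 / (q : ℝ)) ∧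
      IsLocalMinOn (freeEnergy β) (stdSimplex ℝ (Fin q)) x}.Nonempty := by
  have hq1 := one_le_cast_sub_one hq
  have hlog : 0 < Real.log q := Real.log_pos (by linarith)
  set i : Fin q := ⟨0, by omega⟩
  have hvertex := orderedPoint_mem_stdSimplex i (Set.right_mem_Icc.2 zero_le_one)
  obtain ⟨x, hx, hmin⟩ := (isCompact_stdSimplex ℝ (Fin q)).exists_isMinOn ⟨_, hvertex⟩
    (continuous_freeEnergy (8 * Real.log q)).continuousOn
  refine ⟨8 * Real.log q, by positivity, x, hx, fun h => ?_, hmin.localize⟩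
  have hle := isMinOn_iff.1 hmin _ hvertex
  have hone : (1 + ((q : ℝ) - 1) * 1) / q = 1 := by field_simp; ring
  rw [h, freeEnergy_eq_sum (x := orderedPoint i 1), sum_comp_orderedPoint, freeEnergy_eq_sum,
    hone, Finset.sum_const, Finset.card_univ, Fintype.card_fin, nsmul_eq_mul] at hle
  simp only [colourEnergy, sub_self, zero_div, one_div, Real.log_inv, Real.log_one] at hle
  norm_num at hle
  field_simp at hle
  nlinarith

lemma exists_orderEq_neg (hq : 2 ≤ q) (hβ : betaOne q < β) :
    0 < β ∧ ∃ s ∈ Set.Ioo 0 1, orderEq q β s < 0 := by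
  obtain ⟨β', ⟨hβ', x, hx, hne, hmin⟩, hlt⟩ :=
    exists_lt_of_csInf_lt (exists_isLocalMinOn_ne_uniform hq) hβ
  obtain ⟨i, s, hs, -, hs0⟩ := (eq_uniform_or_eq_orderedPoint hq hβ' hx hmin).resolve_left hne
  have hmul := mul_lt_mul_of_pos_right hlt hs.1
  refine ⟨hβ'.trans hlt, s, hs, ?_⟩
  unfold orderEq at hs0 ⊢
  linarith

lemma order_mem_Ioo (hq : 2 ≤ q) (hβ : betaOne q < β) : order q β ∈ Set.Ioo 0 1 := by
  obtain ⟨-, s, hs, hneg⟩ := exists_orderEq_neg hq hβ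
  have ho := (order_spec hq hs hneg).1
  exact ⟨hs.1.trans ho.1, ho.2⟩

lemma orderEq_order (hq : 2 ≤ q) (hβ : betaOne q < β) : orderEq q β (order q β) = 0 := by
  obtain ⟨-, s, hs, hneg⟩ := exists_orderEq_neg hq hβ
  exact (order_spec hq hs hneg).2.1

lemma le_order (hq : 2 ≤ q) (hβ : betaOne q < β) (hs : s ∈ Set.Ioo 0 1)
    (hs0 : orderEq q β s = 0) : s ≤ order q β := by
  obtain ⟨-, t, ht, hneg⟩ := exists_orderEq_neg hq hβ
  exact (order_spec hq ht hneg).2.2 s hs hs0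

lemma orderSlope_order_pos (hq : 2 ≤ q) (hβ : betaOne q < β) :
    0 < orderSlope q β (order q β) := by
  obtain ⟨-, s, hs, hneg⟩ := exists_orderEq_neg hq hβ
  obtain ⟨ho, ho0, -⟩ := order_spec hq hs hneg
  exact orderSlope_pos_of_neg_of_zero hq hs.1 ho.1 ho.2 hneg ho0

lemma minimum_zero (q : ℕ) (β : ℝ) : minimum q β 0 = fun _ => 1 / (q : ℝ) :=
  funext fun _ => if_pos rfl

lemma minimum_succ (β : ℝ) (i : Fin q) :
    minimum q β i.succ = orderedPoint i (order q β) := by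
  funext k
  simp [minimum, orderedPoint, Fin.succ_ne_zero]

lemma succ_mem_indexSet (β : ℝ) (i : Fin q) : i.succ ∈ indexSet q β := by
  unfold indexSet
  split_ifs <;> simp [Fin.succ_ne_zero]

lemma zero_mem_indexSet_iff : 0 ∈ indexSet q β ↔ β < q := by
  unfold indexSet
  split_ifs with h <;> simp [h]

lemma exists_eq_minimum (hq : 2 ≤ q) (hβ : betaOne q < β) (hx : x ∈ stdSimplex ℝ (Fin q))
    (hmin : IsLocalMinOn (freeEnergy β) (stdSimplex ℝ (Fin q)) x) :
    ∃ i ∈ indexSet q β, minimum q β i = x := by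
  obtain ⟨hβ0, t, ht, hneg⟩ := exists_orderEq_neg hq hβ
  rcases eq_uniform_or_eq_orderedPoint hq hβ0 hx hmin with rfl | ⟨i, s, hs, rfl, hs0⟩
  · refine ⟨0, zero_mem_indexSet_iff.2 (not_le.1 fun hle => ?_), minimum_zero q β⟩
    rw [← orderedPoint_zero ⟨0, by omega⟩] at hmin
    exact not_isLocalMinOn_orderedPoint hq hβ0 _ (Set.left_mem_Ico.2 one_pos) (orderEq_zero q β)
      (eventually_orderSlope_neg_nhdsGT_zero hq ht hneg hle) hmin
  · refine ⟨i.succ, succ_mem_indexSet β i, ?_⟩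
    rw [minimum_succ]
    refine congrArg _ ((le_order hq hβ hs hs0).eq_of_not_lt fun hlt => ?_).symm
    have hslope := orderSlope_neg_of_zero_of_zero hq hs.1 hlt (order_mem_Ioo hq hβ).2 hs0
      (orderEq_order hq hβ)
    have hs' := Set.Ioo_subset_Ico_self hs
    exact not_isLocalMinOn_orderedPoint hq hβ0 i hs' hs0
      (((continuousAt_orderSlope hq β hs').eventually_lt continuousAt_const hslope).filter_mono
        nhdsWithin_le_nhds) hmin

lemma minimum_mem_stdSimplex (hq : 2 ≤ q) (hβ : betaOne q < β) (i : Fin (q + 1)) :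
    minimum q β i ∈ stdSimplex ℝ (Fin q) := by
  cases i using Fin.cases with
  | zero =>
    rw [minimum_zero, ← orderedPoint_zero ⟨0, by omega⟩]
    exact orderedPoint_mem_stdSimplex _ (Set.left_mem_Icc.2 zero_le_one)
  | succ i =>
    rw [minimum_succ]
    exact orderedPoint_mem_stdSimplex i (Set.Ioo_subset_Icc_self (order_mem_Ioo hq hβ))

lemma isLocalMinOn_minimum (hq : 2 ≤ q) (hβ : betaOne q < β) {i : Fin (q + 1)}
    (hi : i ∈ indexSet q β) :
    IsLocalMinOn (freeEnergy β) (stdSimplex ℝ (Fin q)) (minimum q β i) := by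
  have hβ0 := (exists_orderEq_neg hq hβ).1
  cases i using Fin.cases with
  | zero => exact minimum_zero q β ▸ isLocalMinOn_uniform hβ0 (zero_mem_indexSet_iff.1 hi)
  | succ i =>
    exact minimum_succ β i ▸ isLocalMinOn_orderedPoint hq hβ0 i (order_mem_Ioo hq hβ)
      (orderEq_order hq hβ) (orderSlope_order_pos hq hβ)

lemma orderedPoint_apply_lt_self (hs : 0 < s) {i j : Fin q} (hji : j ≠ i) :
    orderedPoint i s j < orderedPoint i s i := by
  have hq0 : (0 : ℝ) < q := by exact_mod_cast Fin.pos i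
  rw [orderedPoint_self, orderedPoint_of_ne hji]
  gcongr
  nlinarith

lemma minimum_injective (hq : 2 ≤ q) (hβ : betaOne q < β) :
    Function.Injective (minimum q β) := by
  have ho := (order_mem_Ioo hq hβ).1
  have : Nontrivial (Fin q) := Fin.nontrivial_iff_two_le.2 hq
  have hzero : ∀ i : Fin q, minimum q β 0 ≠ minimum q β i.succ := by
    intro i h
    obtain ⟨j, hj⟩ := exists_ne i
    rw [minimum_zero, minimum_succ] at h
    exact (orderedPoint_apply_lt_self ho hj).ne (by rw [← h])
  intro i j hij
  cases i using Fin.cases <;> cases j using Fin.cases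
  case zero.zero => rfl
  case zero.succ j => exact absurd hij (hzero j)
  case succ.zero i => exact absurd hij.symm (hzero i)
  case succ.succ i j =>
    rw [minimum_succ, minimum_succ] at hij
    by_contra hne
    have hne : i ≠ j := fun h => hne (by rw [h])
    have h₁ := orderedPoint_apply_lt_self ho hne
    have h₂ := orderedPoint_apply_lt_self ho hne.symm
    rw [← hij, orderedPoint_self] at h₁
    rw [orderedPoint_self] at h₂
    exact lt_irrefl _ (h₁.trans (by simpa [orderedPoint_self] using h₂))

lemma exists_shell_minimum (hq : 2 ≤ q) (hβ : betaOne q < β) {i : Fin (q + 1)}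
    (hi : i ∈ indexSet q β) :
    ∃ r > 0, ∃ c > 0, (∀ j, j ≠ i → 2 * r ≤ dist (minimum q β j) (minimum q β i)) ∧
      ∀ y ∈ stdSimplex ℝ (Fin q), dist y (minimum q β i) ∈ Set.Icc (r / 2) r →
        freeEnergy β (minimum q β i) + c ≤ freeEnergy β y := by
  obtain ⟨r, hr, c, hc, hsep, hshell⟩ := exists_shell_of_isLocalMinOn
    (isCompact_stdSimplex ℝ (Fin q)) (continuous_freeEnergy β).continuousOn
    (isLocalMinOn_minimum hq hβ hi) (Set.finite_range (minimum q β))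
    fun y hy hmin => (exists_eq_minimum hq hβ hy hmin).imp fun _ h => h.2
  exact ⟨r, hr, c, hc, fun j hj => hsep _ ⟨j, rfl⟩ ((minimum_injective hq hβ).ne hj), hshell⟩

end Minima

/-! ### Classes of configurations with given colour counts -/

section ColourClass

variable {N q : ℕ} {β : ℝ≥0}

/-- The number of vertices of each colour, bounded by `N` in its type so that there are finitely
many possible values. -/
def colourCount (σ : Config N q) (k : Fin q) : Fin (N + 1) :=
  ⟨(Finset.univ.filter fun i => σ i = k).card,
    Nat.lt_succ_of_le ((Finset.card_filter_le _ _).trans (by simp))⟩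

lemma val_colourCount (σ : Config N q) (k : Fin q) :
    (colourCount σ k : ℕ) = (Finset.univ.filter fun i => σ i = k).card := rfl

lemma cast_colourCount {R : Type*} [NonAssocSemiring R] (σ : Config N q) (k : Fin q) :
    ((colourCount σ k : ℕ) : R) = ∑ i, if σ i = k then 1 else 0 := by
  rw [val_colourCount, Finset.sum_boole]

lemma empirical_apply (σ : Config N q) (k : Fin q) :
    empirical σ k = ((colourCount σ k : ℕ) : ℝ) / N := rfl

lemma empirical_eq_iff (hN : 0 < N) {σ η : Config N q} :
    empirical σ = empirical η ↔ colourCount σ = colourCount η := by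
  have hN' : (N : ℝ) ≠ 0 := by exact_mod_cast hN.ne'
  simp only [funext_iff, empirical_apply, div_left_inj' hN', Nat.cast_inj, Fin.ext_iff]

lemma empirical_congr {σ η : Config N q} (h : colourCount σ = colourCount η) :
    empirical σ = empirical η :=
  funext fun k => by rw [empirical_apply, empirical_apply, h]

lemma sum_colourCount (σ : Config N q) : ∑ k, (colourCount σ k : ℕ) = N := by
  simp only [val_colourCount]
  rw [← Finset.card_eq_sum_card_fiberwise (f := σ) (s := Finset.univ) (t := Finset.univ)
    (by simp), Finset.card_univ, Fintype.card_fin]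

lemma empirical_mem_stdSimplex (hN : 0 < N) (σ : Config N q) :
    empirical σ ∈ stdSimplex ℝ (Fin q) := by
  have hN' : (N : ℝ) ≠ 0 := by exact_mod_cast hN.ne'
  refine ⟨fun k => by rw [empirical_apply]; positivity, ?_⟩
  simp only [empirical_apply]
  rw [← Finset.sum_div, div_eq_one_iff_eq hN']
  exact_mod_cast sum_colourCount σ

lemma colourCount_comp_perm (σ : Config N q) (g : Equiv.Perm (Fin N)) :
    colourCount (σ ∘ g) = colourCount σ :=
  funext fun k => Fin.ext <| by
    rw [val_colourCount, val_colourCount]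
    exact Finset.card_equiv g fun i => by simp only [Finset.mem_filter_univ, Function.comp_apply]

lemma exists_perm_of_colourCount_eq {σ η : Config N q} (h : colourCount η = colourCount σ) :
    ∃ g : Equiv.Perm (Fin N), σ ∘ g = η := by
  have e (k : Fin q) : Nonempty ({i // η i = k} ≃ {i // σ i = k}) := by
    refine Fintype.card_eq.1 ?_
    rw [Fintype.card_subtype, Fintype.card_subtype, ← val_colourCount, ← val_colourCount, h]
  exact ⟨Equiv.ofFiberEquiv fun k => (e k).some, funext (Equiv.ofFiberEquiv_map _)⟩

lemma hammingDist_comp_perm (σ η : Config N q) (g : Equiv.Perm (Fin N)) :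
    hammingDist (σ ∘ g) (η ∘ g) = hammingDist σ η :=
  Finset.card_equiv g fun i => by simp only [Finset.mem_filter_univ, Function.comp_apply]

/-- The configurations with the same colour counts as `σ`, that is, the orbit of `σ` under
permutations of the vertices. -/
def colourClass (σ : Config N q) : Finset (Config N q) :=
  Finset.univ.filter fun η => colourCount η = colourCount σ

lemma mem_colourClass {σ η : Config N q} :
    η ∈ colourClass σ ↔ colourCount η = colourCount σ :=
  Finset.mem_filter_univ η

lemma card_colourClass_pos (σ : Config N q) : 0 < (colourClass σ).card :=
  Finset.card_pos.2 ⟨σ, mem_colourClass.2 rfl⟩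

lemma card_colourClass_mul_sum_comp_perm (σ : Config N q) (F : Config N q → ℝ) :
    (colourClass σ).card * ∑ g : Equiv.Perm (Fin N), F (σ ∘ g) =
      N.factorial * ∑ τ ∈ colourClass σ, F τ := by
  have horbit : ∀ τ ∈ colourClass σ,
      ∑ g : Equiv.Perm (Fin N), F (τ ∘ g) = ∑ g : Equiv.Perm (Fin N), F (σ ∘ g) := by
    intro τ hτ
    obtain ⟨h, rfl⟩ := exists_perm_of_colourCount_eq (mem_colourClass.1 hτ)
    exact Fintype.sum_equiv (Equiv.mulLeft h) _ _ fun _ => rfl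
  have hinvariant (g : Equiv.Perm (Fin N)) :
      ∑ τ ∈ colourClass σ, F (τ ∘ g) = ∑ τ ∈ colourClass σ, F τ :=
    Finset.sum_equiv (g.symm.arrowCongr (Equiv.refl (Fin q)))
      (fun τ => by
        rw [mem_colourClass, mem_colourClass]
        exact iff_of_eq (congrArg (· = colourCount σ) (colourCount_comp_perm τ g).symm))
      fun _ _ => rfl
  calc ((colourClass σ).card : ℝ) * ∑ g : Equiv.Perm (Fin N), F (σ ∘ g)
      = ∑ τ ∈ colourClass σ, ∑ g : Equiv.Perm (Fin N), F (τ ∘ g) := by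
        rw [Finset.sum_congr rfl horbit, Finset.sum_const, nsmul_eq_mul]
    _ = ∑ g : Equiv.Perm (Fin N), ∑ τ ∈ colourClass σ, F (τ ∘ g) := Finset.sum_comm
    _ = N.factorial * ∑ τ ∈ colourClass σ, F τ := by
        rw [Finset.sum_congr rfl fun g _ => hinvariant g, Finset.sum_const, Finset.card_univ,
          Fintype.card_perm, Fintype.card_fin, nsmul_eq_mul]

lemma card_colourClass_mul_prod_factorial (σ : Config N q) :
    (colourClass σ).card * ∏ k, (colourCount σ k : ℕ).factorial = N.factorial := by
  have hstab : (∏ k, (colourCount σ k : ℕ).factorial) =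
      (Finset.univ.filter fun g : Equiv.Perm (Fin N) => σ ∘ g = σ).card := by
    rw [← Fintype.card_subtype, DomMulAct.stabilizer_card]
    exact Finset.prod_congr rfl fun k _ => by rw [Fintype.card_subtype, val_colourCount]
  have h := card_colourClass_mul_sum_comp_perm σ fun τ => if τ = σ then 1 else 0
  rw [Finset.sum_boole, Finset.sum_ite_eq', if_pos (mem_colourClass.2 rfl), mul_one,
    ← hstab] at h
  exact_mod_cast h

/-! ### Energy and entropy of a class -/

lemma sum_sq_colourCount (σ : Config N q) :
    ∑ k, ((colourCount σ k : ℕ) : ℝ) ^ 2 =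
      ∑ i : Fin N, ∑ j : Fin N, if σ i = σ j then (1 : ℝ) else 0 := by
  simp only [cast_colourCount, sq, Finset.sum_mul_sum]
  rw [Finset.sum_comm]
  refine Finset.sum_congr rfl fun i _ => ?_
  rw [Finset.sum_comm]
  refine Finset.sum_congr rfl fun j _ => ?_
  simp only [ite_mul, one_mul, zero_mul, Finset.sum_ite_eq, Finset.mem_univ, if_true]
  exact if_congr eq_comm rfl rfl

lemma two_mul_sum_lt_pairs_add (σ : Config N q) :
    2 * ∑ i : Fin N, ∑ j : Fin N, (if i < j ∧ σ i = σ j then (1 : ℝ) else 0) + N =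
      ∑ k, ((colourCount σ k : ℕ) : ℝ) ^ 2 := by
  have hswap : ∑ i : Fin N, ∑ j : Fin N, (if i < j ∧ σ i = σ j then (1 : ℝ) else 0) =
      ∑ i : Fin N, ∑ j : Fin N, (if j < i ∧ σ i = σ j then (1 : ℝ) else 0) := by
    rw [Finset.sum_comm]
    simp only [eq_comm]
  have hdiag : (N : ℝ) = ∑ i : Fin N, ∑ j : Fin N, (if i = j then (1 : ℝ) else 0) := by simp
  rw [sum_sq_colourCount, two_mul]
  nth_rewrite 2 [hswap]
  nth_rewrite 1 [hdiag]
  simp only [← Finset.sum_add_distrib]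
  refine Finset.sum_congr rfl fun i _ => Finset.sum_congr rfl fun j _ => ?_
  rcases lt_trichotomy i j with h | h | h
  · simp [h, h.not_gt, h.ne]
  · simp [h]
  · simp [h, h.not_gt, h.ne']

lemma meanFieldHamiltonian_eq (hN : 0 < N) (σ : Config N q) :
    meanFieldHamiltonian σ = -((N : ℝ) / 2) * ∑ k, empirical σ k ^ 2 + 1 / 2 := by
  have hN' : (N : ℝ) ≠ 0 := by exact_mod_cast hN.ne'
  unfold meanFieldHamiltonian hamiltonian
  simp only [empirical_apply, div_pow]
  rw [← Finset.sum_div, ← two_mul_sum_lt_pairs_add σ]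
  field_simp
  ring

lemma weight_meanFieldHamiltonian_congr (hN : 0 < N) {σ η : Config N q}
    (h : colourCount σ = colourCount η) :
    weight β meanFieldHamiltonian σ = weight β meanFieldHamiltonian η := by
  rw [weight, weight, meanFieldHamiltonian_eq hN, meanFieldHamiltonian_eq hN, empirical_congr h]

lemma le_log_factorial (n : ℕ) : n * Real.log n - n ≤ Real.log n.factorial := by
  rcases eq_or_ne n 0 with rfl | hn
  · simp
  have : (0 : ℝ) < n := by exact_mod_cast Nat.pos_of_ne_zero hn
  have hf : (0 : ℝ) < n.factorial := by exact_mod_cast n.factorial_pos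
  have h := Real.log_le_log (by positivity)
    (Real.pow_div_factorial_le_exp (x := (n : ℝ)) (by positivity) n)
  rw [Real.log_exp, Real.log_div (by positivity) hf.ne', Real.log_pow] at h
  linarith

lemma log_factorial_le (n : ℕ) :
    Real.log n.factorial ≤ n * Real.log n - n + (Real.log (n + 1) + 1) := by
  rcases n with _ | n
  · simp
  have hanti := Stirling.log_stirlingSeq'_antitone (Nat.zero_le n)
  simp only [Function.comp_apply, Nat.succ_eq_add_one, zero_add,
    Stirling.log_stirlingSeq_formula, Nat.factorial_one, Nat.cast_one, Real.log_one] at hanti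
  have hn : (0 : ℝ) < (n + 1 : ℕ) := by positivity
  rw [Real.log_mul two_ne_zero hn.ne', Real.log_div hn.ne' (Real.exp_pos 1).ne',
    Real.log_div one_ne_zero (Real.exp_pos 1).ne', Real.log_exp, Real.log_one, mul_one] at hanti
  have hmono : Real.log (n + 1 : ℕ) ≤ Real.log ((n + 1 : ℕ) + 1) :=
    Real.log_le_log hn (by linarith)
  have hnonneg : 0 ≤ Real.log (n + 1 : ℕ) := Real.log_natCast_nonneg _
  linarith

lemma mul_sum_empirical_mul_log (hN : 0 < N) (σ : Config N q) :
    (N : ℝ) * ∑ k, empirical σ k * Real.log (empirical σ k) =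
      ∑ k, ((colourCount σ k : ℕ) : ℝ) * Real.log (colourCount σ k : ℕ) - N * Real.log N := by
  have hN' : (0 : ℝ) < N := by exact_mod_cast hN
  have hlog : (N : ℝ) * Real.log N = ∑ k, ((colourCount σ k : ℕ) : ℝ) * Real.log N := by
    rw [← Finset.sum_mul]
    exact_mod_cast congrArg (fun n : ℕ => (n : ℝ) * Real.log N) (sum_colourCount σ).symm
  rw [hlog, ← Finset.sum_sub_distrib, Finset.mul_sum]
  refine Finset.sum_congr rfl fun k _ => ?_
  rw [empirical_apply]
  rcases eq_or_ne (colourCount σ k : ℕ) 0 with h | h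
  · simp [h]
  · rw [Real.log_div (by exact_mod_cast h) hN'.ne']
    field_simp

lemma log_card_colourClass (σ : Config N q) :
    Real.log (colourClass σ).card =
      Real.log N.factorial - ∑ k, Real.log (colourCount σ k : ℕ).factorial := by
  have hfac (n : ℕ) : (n.factorial : ℝ) ≠ 0 := by exact_mod_cast n.factorial_ne_zero
  have hcard : ((colourClass σ).card : ℝ) ≠ 0 := by exact_mod_cast (card_colourClass_pos σ).ne'
  rw [← card_colourClass_mul_prod_factorial σ, Nat.cast_mul, Nat.cast_prod,
    Real.log_mul hcard (Finset.prod_ne_zero_iff.2 fun k _ => hfac _),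
    Real.log_prod fun k _ => hfac _, add_sub_cancel_right]

lemma abs_log_card_colourClass_add_le (hN : 0 < N) (σ : Config N q) :
    |Real.log (colourClass σ).card + N * ∑ k, empirical σ k * Real.log (empirical σ k)| ≤
      (q + 1) * (Real.log (N + 1) + 1) := by
  have hsum : ∑ k, ((colourCount σ k : ℕ) : ℝ) = N := by exact_mod_cast sum_colourCount σ
  have hlow := Finset.sum_le_sum fun k (_ : k ∈ Finset.univ) =>
    le_log_factorial (colourCount σ k : ℕ)
  have hup : ∑ k, Real.log (colourCount σ k : ℕ).factorial ≤
      ∑ k, (((colourCount σ k : ℕ) : ℝ) * Real.log (colourCount σ k : ℕ) -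
      (colourCount σ k : ℕ) + (Real.log (N + 1) + 1)) := by
    refine Finset.sum_le_sum fun k _ => (log_factorial_le _).trans ?_
    have : ((colourCount σ k : ℕ) : ℝ) ≤ N := by
      exact_mod_cast Nat.le_of_lt_succ (colourCount σ k).2
    gcongr
  rw [Finset.sum_sub_distrib, hsum] at hlow
  rw [Finset.sum_add_distrib, Finset.sum_sub_distrib, hsum, Finset.sum_const, Finset.card_univ,
    Fintype.card_fin, nsmul_eq_mul] at hup
  have hlog : 0 ≤ Real.log ((N : ℝ) + 1) := by exact_mod_cast Real.log_natCast_nonneg (N + 1)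
  have : 0 ≤ (q : ℝ) * (Real.log (N + 1) + 1) := by positivity
  rw [log_card_colourClass, mul_sum_empirical_mul_log hN, abs_le]
  constructor <;> linarith [le_log_factorial N, log_factorial_le N]

/-- The total mean-field weight of the class of `σ`. -/
def classWeight (β : ℝ≥0) (σ : Config N q) : ℝ :=
  (colourClass σ).card * weight β meanFieldHamiltonian σ

lemma classWeight_pos (β : ℝ≥0) (σ : Config N q) : 0 < classWeight β σ :=
  mul_pos (by exact_mod_cast card_colourClass_pos σ) (weight_pos _ _ _)

/-- A bound for the error in the approximation of `log (classWeight β σ)` by the free energy; it is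
logarithmic in `N`. -/
def entropyError (β : ℝ≥0) (q N : ℕ) : ℝ := (q + 1) * (Real.log (N + 1) + 1) + β / 2

lemma abs_log_classWeight_add_le (hN : 0 < N) (hβ : 0 < β) (σ : Config N q) :
    |Real.log (classWeight β σ) + β * N * freeEnergy β (empirical σ)| ≤ entropyError β q N := by
  have : (0 : ℝ) < β := hβ
  have hcard : ((colourClass σ).card : ℝ) ≠ 0 := by exact_mod_cast (card_colourClass_pos σ).ne'
  have hlog : Real.log (classWeight β σ) + β * N * freeEnergy β (empirical σ) =
      (Real.log (colourClass σ).card + N * ∑ k, empirical σ k * Real.log (empirical σ k)) -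
        β / 2 := by
    rw [classWeight, weight, Real.log_mul hcard (Real.exp_pos _).ne', Real.log_exp,
      meanFieldHamiltonian_eq hN, freeEnergy]
    field_simp
    ring
  rw [hlog, entropyError]
  have h := abs_le.1 (abs_log_card_colourClass_add_le hN σ)
  exact abs_le.2 ⟨by linarith [h.1], by linarith [h.2]⟩

lemma classWeight_le_exp (hN : 0 < N) (hβ : 0 < β) (σ : Config N q) :
    classWeight β σ ≤ Real.exp (-(β * N * freeEnergy β (empirical σ)) + entropyError β q N) := by
  rw [← Real.log_le_iff_le_exp (classWeight_pos β σ)]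
  linarith [(abs_le.1 (abs_log_classWeight_add_le hN hβ σ)).2]

lemma exp_le_classWeight (hN : 0 < N) (hβ : 0 < β) (σ : Config N q) :
    Real.exp (-(β * N * freeEnergy β (empirical σ)) - entropyError β q N) ≤ classWeight β σ := by
  rw [← Real.le_log_iff_exp_le (classWeight_pos β σ)]
  linarith [(abs_le.1 (abs_log_classWeight_add_le hN hβ σ)).1]

end ColourClass

/-! ### Dirichlet form bounds for the mean-field chain -/

section DirichletForm

variable {N q : ℕ} {β : ℝ≥0}

lemma setWeight_mono (β : ℝ≥0) (H : Config N q → ℝ) {A B : Set (Config N q)} (h : A ⊆ B) :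
    setWeight β H A ≤ setWeight β H B :=
  Finset.sum_le_sum fun _ _ =>
    Set.indicator_le_indicator_of_subset h (fun _ => (weight_pos β H _).le) _

lemma setWeight_inter_coe (β : ℝ≥0) (H : Config N q → ℝ) (X : Set (Config N q))
    (s : Finset (Config N q)) :
    setWeight β H (X ∩ s) = ∑ σ ∈ s, X.indicator (weight β H) σ := by
  simp only [setWeight, Set.inter_comm X, ← Set.indicator_indicator]
  exact Finset.sum_indicator_subset _ (Finset.subset_univ s)

lemma setWeight_colourClass (hN : 0 < N) (σ : Config N q) :
    setWeight β meanFieldHamiltonian (colourClass σ : Set (Config N q)) = classWeight β σ := by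
  rw [setWeight, Finset.sum_indicator_subset _ (Finset.subset_univ _), classWeight,
    ← nsmul_eq_mul, ← Finset.sum_const]
  exact Finset.sum_congr rfl fun τ hτ =>
    weight_meanFieldHamiltonian_congr hN (mem_colourClass.1 hτ)

lemma setWeight_inter_colourClass_le (hN : 0 < N) (X : Set (Config N q)) (σ : Config N q) :
    setWeight β meanFieldHamiltonian (X ∩ colourClass σ) ≤ classWeight β σ :=
  (setWeight_mono _ _ Set.inter_subset_right).trans_eq (setWeight_colourClass hN σ)

lemma setWeight_le_of_inter_colourClass_le {H : Config N q → ℝ} {X : Set (Config N q)} {B : ℝ}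
    (hB : 0 ≤ B) (h : ∀ σ ∈ X, setWeight β H (X ∩ colourClass σ) ≤ B) :
    setWeight β H X ≤ ((N : ℝ) + 1) ^ q * B := by
  have hfiber (n : Fin q → Fin (N + 1)) :
      ∑ σ with colourCount σ = n, X.indicator (weight β H) σ ≤ B := by
    by_cases hn : ∃ σ ∈ X, colourCount σ = n
    · obtain ⟨σ, hσ, rfl⟩ := hn
      exact (setWeight_inter_coe β H X (colourClass σ)).symm.trans_le (h σ hσ)
    · refine (Finset.sum_eq_zero fun σ hσ => ?_).trans_le hB
      exact Set.indicator_of_notMem (fun hX => hn ⟨σ, hX, (Finset.mem_filter.1 hσ).2⟩) _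
  calc setWeight β H X
      = ∑ n, ∑ σ with colourCount σ = n, X.indicator (weight β H) σ :=
        (Finset.sum_fiberwise _ _ _).symm
    _ ≤ ∑ _n : Fin q → Fin (N + 1), B := Finset.sum_le_sum fun n _ => hfiber n
    _ = ((N : ℝ) + 1) ^ q * B := by
        rw [Finset.sum_const, Finset.card_univ, nsmul_eq_mul, Fintype.card_fun, Fintype.card_fin,
          Fintype.card_fin]
        push_cast
        rfl

lemma conductance_comp_perm (hN : 0 < N) (σ η : Config N q) (g : Equiv.Perm (Fin N)) :
    conductance β meanFieldHamiltonian (σ ∘ g) (η ∘ g) =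
      conductance β meanFieldHamiltonian σ η := by
  have hH (τ : Config N q) :
      meanFieldHamiltonian (τ ∘ g) = meanFieldHamiltonian τ := by
    rw [meanFieldHamiltonian_eq hN, meanFieldHamiltonian_eq hN,
      empirical_congr (colourCount_comp_perm τ g)]
  rw [conductance, conductance, hammingDist_comp_perm, hH, hH]

lemma card_mul_conductance_mul_sum_sq_sub_le (hN : 0 < N) (σ η : Config N q)
    (f : Config N q → ℝ) :
    (colourClass σ).card * (conductance β meanFieldHamiltonian σ η *
      ∑ g : Equiv.Perm (Fin N), (f (σ ∘ g) - f (η ∘ g)) ^ 2) ≤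
        2 * N.factorial * dirichletForm (conductance β meanFieldHamiltonian) f := by
  set c := conductance β (meanFieldHamiltonian (N := N) (q := q))
  let E (τ : Config N q) : ℝ := ∑ τ', c τ τ' * (f τ - f τ') ^ 2
  have hterm (τ τ' : Config N q) : 0 ≤ c τ τ' * (f τ - f τ') ^ 2 :=
    mul_nonneg (conductance_nonneg _ _ _ _) (sq_nonneg _)
  calc (colourClass σ).card * (c σ η * ∑ g : Equiv.Perm (Fin N), (f (σ ∘ g) - f (η ∘ g)) ^ 2)
      = (colourClass σ).card * ∑ g : Equiv.Perm (Fin N),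
          c (σ ∘ g) (η ∘ g) * (f (σ ∘ g) - f (η ∘ g)) ^ 2 := by
        rw [Finset.mul_sum]
        simp only [c, conductance_comp_perm hN]
    _ ≤ (colourClass σ).card * ∑ g : Equiv.Perm (Fin N), E (σ ∘ g) := by
        gcongr with g
        exact Finset.single_le_sum (fun τ' _ => hterm (σ ∘ g) τ') (Finset.mem_univ (η ∘ g))
    _ = N.factorial * ∑ τ ∈ colourClass σ, E τ := card_colourClass_mul_sum_comp_perm σ E
    _ ≤ N.factorial * ∑ τ, E τ := by
        gcongr
        · exact fun τ _ _ => Finset.sum_nonneg fun τ' _ => hterm τ τ'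
        · exact Finset.subset_univ _
    _ = 2 * N.factorial * dirichletForm c f := by
        rw [dirichletForm]
        ring

lemma min_classWeight_mul_sum_sq_sub_le (hN : 0 < N) (hq : 0 < q) {σ η : Config N q}
    (h : hammingDist σ η = 1) (f : Config N q → ℝ) :
    min (classWeight β σ) (classWeight β η) *
      ∑ g : Equiv.Perm (Fin N), (f (σ ∘ g) - f (η ∘ g)) ^ 2 ≤
        N * q * (2 * N.factorial * dirichletForm (conductance β meanFieldHamiltonian) f) := by
  wlog hle : meanFieldHamiltonian η ≤ meanFieldHamiltonian σ generalizing σ η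
  · simpa only [min_comm, sub_sq_comm] using this ((hammingDist_comm η σ).trans h)
      (le_of_not_ge hle)
  have hweight : classWeight β σ =
      N * q * ((colourClass σ).card * conductance β meanFieldHamiltonian σ η) := by
    rw [conductance, if_pos h, max_eq_left hle, classWeight, weight]
    field_simp
  calc min (classWeight β σ) (classWeight β η) *
        ∑ g : Equiv.Perm (Fin N), (f (σ ∘ g) - f (η ∘ g)) ^ 2
      ≤ classWeight β σ * ∑ g : Equiv.Perm (Fin N), (f (σ ∘ g) - f (η ∘ g)) ^ 2 := by
        gcongr
        exact min_le_left _ _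
    _ = N * q * ((colourClass σ).card * (conductance β meanFieldHamiltonian σ η *
          ∑ g : Equiv.Perm (Fin N), (f (σ ∘ g) - f (η ∘ g)) ^ 2)) := by
        rw [hweight]
        ring
    _ ≤ _ := by
        gcongr N * q * ?_
        exact card_mul_conductance_mul_sum_sq_sub_le hN σ η f

lemma one_le_mul_sum_sq_sub {a : ℕ → ℝ} {L : ℕ} (h0 : a 0 = 1) (hL : a L = 0) :
    1 ≤ (L : ℝ) * ∑ k ∈ Finset.range L, (a k - a (k + 1)) ^ 2 := by
  have h := sq_sum_le_card_mul_sum_sq (s := Finset.range L) (f := fun k => a k - a (k + 1))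
  rwa [Finset.sum_range_sub', h0, hL, sub_zero, one_pow, Finset.card_range] at h

section Path

variable {X : Set (Config N q)} {f : Config N q → ℝ} {p : ℕ → Config N q} {L : ℕ} {K : ℝ}

lemma indicator_weight_comp_perm_le (hN : 0 < N) (hX : ∀ σ ∈ X, f σ = 1)
    (g : Equiv.Perm (Fin N)) (hend : f (p L ∘ g) = 0) :
    X.indicator (weight β meanFieldHamiltonian) (p 0 ∘ g) ≤
      weight β meanFieldHamiltonian (p 0) *
        (L * ∑ k ∈ Finset.range L, (f (p k ∘ g) - f (p (k + 1) ∘ g)) ^ 2) := by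
  have hw := weight_pos β meanFieldHamiltonian (p 0)
  refine Set.indicator_apply_le' (fun hg => ?_) fun _ => by positivity
  rw [weight_meanFieldHamiltonian_congr hN (colourCount_comp_perm (p 0) g)]
  exact le_mul_of_one_le_right hw.le
    (one_le_mul_sum_sq_sub (a := fun k => f (p k ∘ g)) (hX _ hg) hend)

-- Averaging over all relabellings of the vertices turns one path into a flow spread uniformly over
-- the classes it visits, so that only class weights enter.
lemma setWeight_inter_colourClass_le_of_path (hN : 0 < N) (hq : 0 < q) (hK : 0 ≤ K)
    (hX : ∀ σ ∈ X, f σ = 1) (hstep : ∀ k < L, hammingDist (p k) (p (k + 1)) = 1)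
    (hend : ∀ g : Equiv.Perm (Fin N), f (p L ∘ g) = 0)
    (hlevel : ∀ k ≤ L, classWeight β (p 0) ≤ K * classWeight β (p k)) :
    setWeight β meanFieldHamiltonian (X ∩ colourClass (p 0)) ≤
      K * (2 * N * q * (L : ℝ) ^ 2 * dirichletForm (conductance β meanFieldHamiltonian) f) := by
  set D := dirichletForm (conductance β meanFieldHamiltonian) f
  let S (k : ℕ) : ℝ := ∑ g : Equiv.Perm (Fin N), (f (p k ∘ g) - f (p (k + 1) ∘ g)) ^ 2
  have hS (k : ℕ) : 0 ≤ S k := Finset.sum_nonneg fun _ _ => sq_nonneg _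
  have hedge : ∀ k ∈ Finset.range L,
      classWeight β (p 0) * S k ≤ K * (N * q * (2 * N.factorial * D)) := by
    intro k hk
    have hk' := Finset.mem_range.1 hk
    calc classWeight β (p 0) * S k
        ≤ K * min (classWeight β (p k)) (classWeight β (p (k + 1))) * S k := by
          refine mul_le_mul_of_nonneg_right ?_ (hS k)
          rw [mul_min_of_nonneg _ _ hK]
          exact le_min (hlevel k hk'.le) (hlevel (k + 1) hk')
      _ ≤ K * (N * q * (2 * N.factorial * D)) := by
          rw [mul_assoc]
          gcongr K * ?_
          exact min_classWeight_mul_sum_sq_sub_le hN hq (hstep k hk') f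
  refine le_of_mul_le_mul_left ?_ (show (0 : ℝ) < N.factorial by exact_mod_cast N.factorial_pos)
  calc N.factorial * setWeight β meanFieldHamiltonian (X ∩ colourClass (p 0))
      = (colourClass (p 0)).card * ∑ g : Equiv.Perm (Fin N),
          X.indicator (weight β meanFieldHamiltonian) (p 0 ∘ g) := by
        rw [setWeight_inter_coe, card_colourClass_mul_sum_comp_perm]
    _ ≤ (colourClass (p 0)).card * ∑ g : Equiv.Perm (Fin N),
          weight β meanFieldHamiltonian (p 0) *
            (L * ∑ k ∈ Finset.range L, (f (p k ∘ g) - f (p (k + 1) ∘ g)) ^ 2) := by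
        gcongr with g
        exact indicator_weight_comp_perm_le hN hX g (hend g)
    _ = L * ∑ k ∈ Finset.range L, classWeight β (p 0) * S k := by
        simp only [S, ← Finset.mul_sum, classWeight]
        rw [Finset.sum_comm]
        ring
    _ ≤ L * ∑ _k ∈ Finset.range L, K * (N * q * (2 * N.factorial * D)) := by
        gcongr L * ?_
        exact Finset.sum_le_sum hedge
    _ = N.factorial * (K * (2 * N * q * (L : ℝ) ^ 2 * D)) := by
        rw [Finset.sum_const, Finset.card_range, nsmul_eq_mul]
        ring

end Path

lemma sum_conductance_le_weight (β : ℝ≥0) (H : Config N q → ℝ) (σ : Config N q) :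
    ∑ η, conductance β H σ η ≤ weight β H σ := by
  have hdiag : flipProb β H σ σ = 0 := by simp [flipProb]
  simp only [← weight_mul_flipProb]
  rw [← Finset.mul_sum, ← Finset.sum_erase Finset.univ hdiag]
  exact mul_le_of_le_one_right (weight_pos β H σ).le (sum_flipProb_le_one β H σ)

lemma dirichletForm_indicator_le_setWeight {H : Config N q → ℝ} {A S : Set (Config N q)}
    (hS : ∀ σ ∈ A, ∀ η ∉ A, hammingDist σ η = 1 → σ ∈ S) :
    dirichletForm (conductance β H) (A.indicator 1) ≤ setWeight β H S := by
  rw [dirichletForm_eq_sum_mul_laplacian (conductance_comm β H)]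
  refine Finset.sum_le_sum fun σ _ => ?_
  have hweight : 0 ≤ S.indicator (weight β H) σ :=
    Set.indicator_nonneg (fun _ _ => (weight_pos β H _).le) σ
  by_cases hA : σ ∈ A
  · rw [Set.indicator_of_mem hA, Pi.one_apply, one_mul, laplacian, Set.indicator_of_mem hA]
    by_cases hσ : σ ∈ S
    · rw [Set.indicator_of_mem hσ]
      refine (Finset.sum_le_sum fun η _ => ?_).trans (sum_conductance_le_weight β H σ)
      refine mul_le_of_le_one_right (conductance_nonneg β H σ η) (sub_le_self _ ?_)
      exact Set.indicator_nonneg (fun _ _ => zero_le_one) η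
    · refine (Finset.sum_eq_zero fun η _ => ?_).trans_le hweight
      by_cases hη : η ∈ A
      · rw [Set.indicator_of_mem hη, Pi.one_apply, Pi.one_apply, sub_self, mul_zero]
      · rw [conductance, if_neg fun h => hσ (hS σ hA η hη h), zero_mul]
  · rwa [Set.indicator_of_notMem hA, zero_mul]

end DirichletForm

/-! ### Paths of configurations -/

section Path

variable {N q : ℕ}

lemma exists_colourCount_eq (n : Fin q → ℕ) (hn : ∑ k, n k = N) :
    ∃ σ : Config N q, ∀ k, (colourCount σ k : ℕ) = n k := by
  subst hn
  refine ⟨fun v => (finSigmaFinEquiv.symm v).1, fun k => ?_⟩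
  rw [val_colourCount, ← Fintype.card_subtype, ← Fintype.card_fin (n k)]
  exact Fintype.card_congr <| (finSigmaFinEquiv.symm.subtypeEquiv fun _ => Iff.rfl).trans
    (Equiv.sigmaSubtype k)

lemma exists_nat_sum_eq_floor_sum {n : ℕ} {a : Fin n → ℝ} (ha : ∀ k, 0 ≤ a k) :
    ∃ b : Fin n → ℕ, ∑ k, b k = ⌊∑ k, a k⌋₊ ∧ ∀ k, |(b k : ℝ) - a k| ≤ 1 := by
  induction n with
  | zero => exact ⟨Fin.elim0, by simp, fun k => k.elim0⟩
  | succ n ih =>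
    obtain ⟨b, hsum, hb⟩ := ih fun k => ha k.castSucc
    set s := ∑ k : Fin n, a k.castSucc
    have hs : 0 ≤ s := Finset.sum_nonneg fun k _ => ha k.castSucc
    have hs' : 0 ≤ s + a (Fin.last n) := add_nonneg hs (ha _)
    have hmono : ⌊s⌋₊ ≤ ⌊s + a (Fin.last n)⌋₊ :=
      Nat.floor_mono (le_add_of_nonneg_right (ha _))
    refine ⟨Fin.snoc b (⌊s + a (Fin.last n)⌋₊ - ⌊s⌋₊), ?_, Fin.lastCases ?_ fun k => ?_⟩
    · simp only [Fin.sum_univ_castSucc, Fin.snoc_castSucc, Fin.snoc_last, hsum]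
      exact Nat.add_sub_of_le hmono
    · rw [Fin.snoc_last, Nat.cast_sub hmono, abs_le]
      constructor <;> linarith [Nat.floor_le hs, Nat.lt_floor_add_one s, Nat.floor_le hs',
        Nat.lt_floor_add_one (s + a (Fin.last n))]
    · rw [Fin.snoc_castSucc]
      exact hb k

lemma exists_dist_empirical_le (hN : 0 < N) {z : Fin q → ℝ} (hz : z ∈ stdSimplex ℝ (Fin q)) :
    ∃ σ : Config N q, dist (empirical σ) z ≤ 1 / N := by
  have hN' : (0 : ℝ) < N := by exact_mod_cast hN
  obtain ⟨n, hsum, hn⟩ := exists_nat_sum_eq_floor_sum fun k => mul_nonneg hN'.le (hz.1 k)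
  rw [← Finset.mul_sum, hz.2, mul_one, Nat.floor_natCast] at hsum
  obtain ⟨σ, hσ⟩ := exists_colourCount_eq n hsum
  refine ⟨σ, (dist_pi_le_iff (by positivity)).2 fun k => ?_⟩
  calc dist (empirical σ k) (z k) = |(n k : ℝ) - N * z k| / N := by
        rw [← abs_of_pos hN', ← abs_div, abs_of_pos hN', sub_div, mul_div_cancel_left₀ _ hN'.ne',
          Real.dist_eq, empirical_apply, hσ]
    _ ≤ 1 / N := by
        gcongr
        exact hn k

lemma dist_empirical_apply (σ η : Config N q) (k : Fin q) :
    dist (empirical σ k) (empirical η k) =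
      ((colourCount σ k : ℤ) - (colourCount η k : ℤ)).natAbs / N := by
  rw [Real.dist_eq, empirical_apply, empirical_apply, ← sub_div, abs_div, Nat.abs_cast,
    Nat.cast_natAbs]
  push_cast
  rfl

lemma natAbs_colourCount_sub_le_one {σ η : Config N q} (h : hammingDist σ η = 1) (k : Fin q) :
    ((colourCount σ k : ℤ) - (colourCount η k : ℤ)).natAbs ≤ 1 := by
  obtain ⟨v, hv⟩ := Finset.card_eq_one.1 h
  have heq (i : Fin N) (hi : i ≠ v) : σ i = η i := by
    by_contra hne
    exact hi (Finset.mem_singleton.1 (hv ▸ Finset.mem_filter.2 ⟨Finset.mem_univ i, hne⟩))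
  rw [cast_colourCount, cast_colourCount, ← Finset.sum_sub_distrib, Fintype.sum_eq_single v
    fun i hi => by rw [heq i hi, sub_self]]
  split_ifs <;> simp

lemma dist_empirical_le_of_hammingDist_eq_one {σ η : Config N q} (h : hammingDist σ η = 1) :
    dist (empirical σ) (empirical η) ≤ 1 / N := by
  refine (dist_pi_le_iff (by positivity)).2 fun k => ?_
  rw [dist_empirical_apply]
  gcongr
  exact_mod_cast natAbs_colourCount_sub_le_one h k

lemma colourCount_update (σ : Config N q) (v : Fin N) (l k : Fin q) :
    (colourCount (Function.update σ v l) k : ℤ) =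
      (colourCount σ k : ℤ) - (if σ v = k then 1 else 0) + if l = k then 1 else 0 := by
  have hdiff : (colourCount (Function.update σ v l) k : ℤ) - (colourCount σ k : ℤ) =
      (if l = k then 1 else 0) - if σ v = k then 1 else 0 := by
    rw [cast_colourCount, cast_colourCount, ← Finset.sum_sub_distrib, Fintype.sum_eq_single v
      fun i hi => by rw [Function.update_of_ne hi, sub_self], Function.update_self]
  linarith

lemma hammingDist_update (σ : Config N q) {v : Fin N} {l : Fin q} (hl : l ≠ σ v) :
    hammingDist σ (Function.update σ v l) = 1 := by
  refine Finset.card_eq_one.2 ⟨v, Finset.ext fun i => ?_⟩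
  rcases eq_or_ne i v with rfl | hi
  · simp [hl.symm]
  · simp [hi]

lemma exists_colourCount_lt {σ τ : Config N q} (h : colourCount σ ≠ colourCount τ) :
    ∃ k, colourCount τ k < colourCount σ k := by
  by_contra! hle
  have heq := (Finset.sum_eq_sum_iff_of_le fun k _ => Fin.le_def.1 (hle k)).1
    ((sum_colourCount σ).trans (sum_colourCount τ).symm)
  exact h (funext fun k => Fin.ext (heq k (Finset.mem_univ k)))

lemma exists_flip_towards {σ τ : Config N q} (h : colourCount σ ≠ colourCount τ) :
    ∃ η, hammingDist σ η = 1 ∧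
      (∀ k, ((colourCount η k : ℤ) - (colourCount τ k : ℤ)).natAbs ≤
        ((colourCount σ k : ℤ) - (colourCount τ k : ℤ)).natAbs) ∧
      ∃ k, ((colourCount η k : ℤ) - (colourCount τ k : ℤ)).natAbs <
        ((colourCount σ k : ℤ) - (colourCount τ k : ℤ)).natAbs := by
  obtain ⟨k, hk⟩ := exists_colourCount_lt h
  obtain ⟨l, hl⟩ := exists_colourCount_lt h.symm
  rw [Fin.lt_def] at hk hl
  have hkl : l ≠ k := by
    rintro rfl
    exact hk.asymm hl
  obtain ⟨v, hv⟩ : ∃ v, σ v = k := by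
    have hpos : 0 < (colourCount σ k : ℕ) := by omega
    rw [val_colourCount, Finset.card_pos] at hpos
    obtain ⟨v, hv⟩ := hpos
    exact ⟨v, (Finset.mem_filter.1 hv).2⟩
  refine ⟨Function.update σ v l, hammingDist_update σ (hv ▸ hkl), fun j => ?_, k, ?_⟩
  · rw [colourCount_update, hv]
    rcases eq_or_ne k j with rfl | hkj
    · rw [if_pos rfl, if_neg hkl]
      omega
    · rcases eq_or_ne l j with rfl | hlj
      · rw [if_neg hkj, if_pos rfl]
        omega
      · rw [if_neg hkj, if_neg hlj]
        omega
  · rw [colourCount_update, hv, if_pos rfl, if_neg hkl]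
    omega

/-- The relation between configurations that holds if the second one lies in `P` and arises from
the first one by a single spin flip. -/
def FlipInto (P : Set (Config N q)) (σ η : Config N q) : Prop :=
  hammingDist σ η = 1 ∧ η ∈ P

lemma FlipInto.mono {P Q : Set (Config N q)} (h : P ⊆ Q) {σ η : Config N q}
    (hση : Relation.ReflTransGen (FlipInto P) σ η) : Relation.ReflTransGen (FlipInto Q) σ η :=
  Relation.ReflTransGen.mono (fun _ _ hab => ⟨hab.1, h hab.2⟩) _ _ hση

lemma exists_flips_towards (σ τ : Config N q) :
    ∃ η, colourCount η = colourCount τ ∧ Relation.ReflTransGen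
      (FlipInto {η | dist (empirical η) (empirical τ) ≤ dist (empirical σ) (empirical τ)}) σ η := by
  induction hd : ∑ k, ((colourCount σ k : ℤ) - (colourCount τ k : ℤ)).natAbs using
    Nat.strong_induction_on generalizing σ with
  | _ d ih =>
    by_cases heq : colourCount σ = colourCount τ
    · exact ⟨σ, heq, Relation.ReflTransGen.refl⟩
    obtain ⟨σ', hflip, hle, k, hlt⟩ := exists_flip_towards heq
    have hdist : dist (empirical σ') (empirical τ) ≤ dist (empirical σ) (empirical τ) := by
      refine (dist_pi_le_iff dist_nonneg).2 fun k => le_trans ?_ (dist_le_pi_dist _ _ k)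
      rw [dist_empirical_apply, dist_empirical_apply]
      gcongr
      exact hle k
    obtain ⟨η, hη, hpath⟩ := ih _
      (hd ▸ Finset.sum_lt_sum (fun k _ => hle k) ⟨k, Finset.mem_univ k, hlt⟩) σ' rfl
    exact ⟨η, hη, Relation.ReflTransGen.head ⟨hflip, hdist⟩
      (FlipInto.mono (fun _ h => le_trans h hdist) hpath)⟩

lemma exists_flips_near {P : Set (Config N q)} {δ : ℝ} {z : Fin q → ℝ}
    (hP : ∀ σ : Config N q, dist (empirical σ) z < δ → σ ∈ P) {σ τ : Config N q}
    (hσ : dist (empirical σ) z < δ / 2) (hτ : dist (empirical τ) z < δ / 4) :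
    ∃ η, colourCount η = colourCount τ ∧ Relation.ReflTransGen (FlipInto P) σ η := by
  obtain ⟨η, hη, hpath⟩ := exists_flips_towards σ τ
  refine ⟨η, hη, FlipInto.mono (fun ζ hζ => hP ζ ?_) hpath⟩
  have hζ' : dist (empirical ζ) (empirical τ) ≤ dist (empirical σ) (empirical τ) := hζ
  linarith [dist_triangle (empirical ζ) (empirical τ) z,
    dist_triangle_right (empirical σ) (empirical τ) z]

lemma exists_flips_of_chain (hN : 0 < N) {P : Set (Config N q)} {Z : Set (Fin q → ℝ)} {δ : ℝ}
    (hNδ : 1 / (N : ℝ) < δ / 4) (hZ : Z ⊆ stdSimplex ℝ (Fin q))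
    (hP : ∀ z ∈ Z, ∀ σ : Config N q, dist (empirical σ) z < δ → σ ∈ P)
    {σ : Config N q} {y : Fin q → ℝ}
    (hy : Relation.ReflTransGen (fun x z => z ∈ Z ∧ dist x z < δ / 4) (empirical σ) y) :
    ∃ η, dist (empirical η) y < δ / 4 ∧ Relation.ReflTransGen (FlipInto P) σ η := by
  induction hy with
  | refl => exact ⟨σ, by rw [dist_self]; exact hNδ.trans_le' (by positivity), .refl⟩
  | @tail x z _ hxz ih =>
    obtain ⟨η, hη, hpath⟩ := ih
    obtain ⟨τ, hτ⟩ := exists_dist_empirical_le hN (hZ hxz.1)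
    have hτ' := hτ.trans_lt hNδ
    obtain ⟨η', hη', hpath'⟩ := exists_flips_near (σ := η) (hP z hxz.1)
      (by linarith [dist_triangle (empirical η) x z, hxz.2]) hτ'
    exact ⟨η', by rwa [empirical_congr hη'], hpath.trans hpath'⟩

/-- The graph on the possible colour counts in which two vertices are adjacent if they are realised
by configurations in `P` that differ by a single spin flip. -/
def classGraph (P : Set (Config N q)) : SimpleGraph (Fin q → Fin (N + 1)) where
  Adj x y := x ≠ y ∧ ∃ σ ∈ P, ∃ η ∈ P, colourCount σ = x ∧ colourCount η = y ∧ hammingDist σ η = 1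
  symm := ⟨fun _ _ ⟨hne, σ, hσ, η, hη, hx, hy, h⟩ =>
    ⟨hne.symm, η, hη, σ, hσ, hy, hx, (hammingDist_comm η σ).trans h⟩⟩
  loopless := ⟨fun _ h => h.1 rfl⟩

variable {P : Set (Config N q)} {σ η : Config N q}

lemma classGraph_reachable (hσ : σ ∈ P) (h : Relation.ReflTransGen (FlipInto P) σ η) :
    η ∈ P ∧ (classGraph P).Reachable (colourCount σ) (colourCount η) := by
  induction h with
  | refl => exact ⟨hσ, .refl _⟩
  | @tail a b _ hab ih =>
    refine ⟨hab.2, ih.2.trans ?_⟩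
    by_cases heq : colourCount a = colourCount b
    · rw [heq]
    · exact SimpleGraph.Adj.reachable ⟨heq, a, ih.1, b, hab.2, rfl, rfl, hab.1⟩

lemma exists_path_of_walk (hP : ∀ σ ∈ P, ∀ g : Equiv.Perm (Fin N), σ ∘ g ∈ P)
    {x y : Fin q → Fin (N + 1)} (w : (classGraph P).Walk x y) (hσ : σ ∈ P)
    (hx : colourCount σ = x) :
    ∃ p : ℕ → Config N q, p 0 = σ ∧ colourCount (p w.length) = y ∧
      (∀ k < w.length, hammingDist (p k) (p (k + 1)) = 1) ∧ ∀ k ≤ w.length, p k ∈ P := by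
  induction w generalizing σ with
  | nil => exact ⟨fun _ => σ, rfl, hx, fun k hk => absurd hk k.not_lt_zero, fun _ _ => hσ⟩
  | cons hadj w ih =>
    obtain ⟨-, σ', -, η', hη', hσx, hηx, hflip⟩ := id hadj
    obtain ⟨g, rfl⟩ := exists_perm_of_colourCount_eq (hx.trans hσx.symm)
    obtain ⟨p, hp0, hpL, hstep, hpP⟩ := ih (hP η' hη' g) ((colourCount_comp_perm η' g).trans hηx)
    refine ⟨fun k => Nat.casesOn k (σ' ∘ g) p, rfl, by rwa [SimpleGraph.Walk.length_cons], ?_, ?_⟩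
    · rintro (_ | k) hk
      · change hammingDist (σ' ∘ g) (p 0) = 1
        rw [hp0, hammingDist_comp_perm, hflip]
      · exact hstep k (Nat.lt_of_succ_lt_succ hk)
    · rintro (_ | k) hk
      · exact hσ
      · exact hpP k (Nat.le_of_succ_le_succ hk)

-- A path in the class graph need not visit a class twice, and there are at most `(N + 1) ^ q`
-- classes.
lemma exists_short_path (hP : ∀ σ ∈ P, ∀ g : Equiv.Perm (Fin N), σ ∘ g ∈ P) (hσ : σ ∈ P)
    (h : Relation.ReflTransGen (FlipInto P) σ η) :
    ∃ (L : ℕ) (p : ℕ → Config N q), L ≤ (N + 1) ^ q ∧ p 0 = σ ∧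
      colourCount (p L) = colourCount η ∧
      (∀ k < L, hammingDist (p k) (p (k + 1)) = 1) ∧ ∀ k ≤ L, p k ∈ P := by
  obtain ⟨w⟩ := (classGraph_reachable hσ h).2
  obtain ⟨p, hp⟩ := exists_path_of_walk hP w.toPath.1 hσ rfl
  refine ⟨_, p, ?_, hp⟩
  have hlength := w.toPath.2.length_lt
  rw [Fintype.card_fun, Fintype.card_fin, Fintype.card_fin] at hlength
  exact hlength.le

end Path

/-! ### Metastability of the mean-field chain -/

lemma empirical_mem_latticeSimplex {N q : ℕ} (hN : 0 < N) (σ : Config N q) :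
    empirical σ ∈ latticeSimplex N q :=
  ⟨empirical_mem_stdSimplex hN σ, fun _ => ⟨_, rfl⟩⟩

lemma exists_empirical_eq {N q : ℕ} (hN : 0 < N) {x : Fin q → ℝ} (hx : x ∈ latticeSimplex N q) :
    ∃ σ : Config N q, empirical σ = x := by
  have hN' : (N : ℝ) ≠ 0 := by exact_mod_cast hN.ne'
  choose n hn using hx.2
  have hsum : ∑ k, n k = N := by
    have h := hx.1.2
    simp only [hn] at h
    rw [← Finset.sum_div, div_eq_one_iff_eq hN'] at h
    exact_mod_cast h
  obtain ⟨σ, hσ⟩ := exists_colourCount_eq n hsum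
  exact ⟨σ, funext fun k => by rw [empirical_apply, hσ, hn]⟩

namespace IsLatticeApprox

variable {q : ℕ} {β : ℝ} {m : ℕ → Fin (q + 1) → Fin q → ℝ} {i : Fin (q + 1)}

lemma dist_le (hm : IsLatticeApprox q β m) (hq : 2 ≤ q) (hβ : betaOne q < β)
    (hi : i ∈ indexSet q β) {N : ℕ} (hN : 0 < N) : dist (m N i) (minimum q β i) ≤ q / N := by
  have hq1 : (1 : ℝ) ≤ q := by exact_mod_cast one_le_two.trans hq
  obtain ⟨σ, hσ⟩ := exists_dist_empirical_le hN (minimum_mem_stdSimplex hq hβ i)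
  refine (dist_pi_le_iff (by positivity)).2 fun k => abs_le_of_sq_le_sq ?_ (by positivity)
  calc (m N i k - minimum q β i k) ^ 2
      ≤ ∑ l, (m N i l - minimum q β i l) ^ 2 :=
        Finset.single_le_sum (f := fun l => (m N i l - minimum q β i l) ^ 2)
          (fun _ _ => sq_nonneg _) (Finset.mem_univ k)
    _ ≤ ∑ l, (empirical σ l - minimum q β i l) ^ 2 :=
        (hm N hN i hi).2 _ (empirical_mem_latticeSimplex hN σ)
    _ ≤ ∑ _l : Fin q, (1 / (N : ℝ)) ^ 2 := Finset.sum_le_sum fun l _ =>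
        sq_le_sq' (neg_le_of_abs_le ((dist_le_pi_dist _ _ l).trans hσ))
          (le_of_abs_le ((dist_le_pi_dist _ _ l).trans hσ))
    _ = q / (N : ℝ) ^ 2 := by simp [div_eq_mul_inv]
    _ ≤ (q / N) ^ 2 := by
        rw [div_pow]
        gcongr
        exact le_self_pow₀ hq1 two_ne_zero

lemma tendsto (hm : IsLatticeApprox q β m) (hq : 2 ≤ q) (hβ : betaOne q < β)
    (hi : i ∈ indexSet q β) : Tendsto (fun N => m N i) atTop (nhds (minimum q β i)) :=
  tendsto_iff_dist_tendsto_zero.2 <| squeeze_zero' (.of_forall fun _ => dist_nonneg)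
    ((eventually_gt_atTop 0).mono fun _ hN => hm.dist_le hq hβ hi hN)
    (tendsto_const_div_atTop_nhds_zero_nat (q : ℝ))

lemma nonempty_metastableSet (hm : IsLatticeApprox q β m) (hi : i ∈ indexSet q β) {N : ℕ}
    (hN : 0 < N) : (metastableSet m N i).Nonempty :=
  exists_empirical_eq hN (hm N hN i hi).1

lemma eventually_pairwiseDisjoint_metastableSet (hm : IsLatticeApprox q β m) (hq : 2 ≤ q)
    (hβ : betaOne q < β) :
    ∀ᶠ N in atTop, (indexSet q β : Set (Fin (q + 1))).PairwiseDisjoint (metastableSet m N) := by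
  have hne : ∀ᶠ N in atTop, ∀ i ∈ indexSet q β, ∀ j ∈ indexSet q β, i ≠ j → m N i ≠ m N j := by
    simp only [eventually_all_finset, eventually_imp_distrib_left]
    exact fun i hi j hj hij => ((hm.tendsto hq hβ hi).prodMk_nhds (hm.tendsto hq hβ hj)).eventually
      (isClosed_diagonal.isOpen_compl.mem_nhds ((minimum_injective hq hβ).ne hij))
  filter_upwards [hne] with N hN i hi j hj hij
  exact Set.disjoint_left.2 fun σ hσi hσj => hN i hi j hj hij (Eq.trans (Eq.symm hσi) hσj)

lemma eventually_exists_descending_path (hm : IsLatticeApprox q β m) (hq : 2 ≤ q)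
    (hβ : betaOne q < β) {ε : ℝ} (hε : 0 < ε) :
    ∀ᶠ N in atTop, ∀ σ : Config N q, ∃ i ∈ indexSet q β, ∃ η ∈ metastableSet m N i,
      Relation.ReflTransGen (FlipInto
        {τ | freeEnergy β (empirical τ) ≤ freeEnergy β (empirical σ) + ε}) σ η := by
  have hcompact := isCompact_stdSimplex ℝ (Fin q)
  have hcont := (continuous_freeEnergy (q := q) β).continuousOn (s := stdSimplex ℝ (Fin q))
  obtain ⟨δ, hδ, huniform⟩ := Metric.uniformContinuousOn_iff.1
    (hcompact.uniformContinuousOn_of_continuous hcont) ε hε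
  have hδ4 : 0 < δ / 4 := by positivity
  have hm_near : ∀ᶠ N in atTop, ∀ i ∈ indexSet q β, dist (m N i) (minimum q β i) < δ / 4 :=
    (eventually_all_finset _).2 fun i hi => Metric.tendsto_nhds.1 (hm.tendsto hq hβ hi) _ hδ4
  filter_upwards [hm_near, tendsto_one_div_atTop_nhds_zero_nat.eventually_lt_const hδ4,
    eventually_gt_atTop 0] with N hmN hNδ hN σ
  set P : Set (Config N q) := {τ | freeEnergy β (empirical τ) ≤ freeEnergy β (empirical σ) + ε}
  let Z := {z ∈ stdSimplex ℝ (Fin q) | freeEnergy β z ≤ freeEnergy β (empirical σ)}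
  have hP (z) (hz : z ∈ Z) (τ : Config N q) (hτ : dist (empirical τ) z < δ) : τ ∈ P := by
    have hlt := huniform _ (empirical_mem_stdSimplex hN τ) z hz.1 hτ
    exact (sub_le_iff_le_add'.1 (le_of_abs_le hlt.le)).trans (by gcongr; exact hz.2)
  obtain ⟨y, hy, hmin, hchain⟩ :=
    exists_chain_to_localMin hcompact hcont (empirical_mem_stdSimplex hN σ) hδ4
  have hyZ : y ∈ Z := by
    refine ⟨hy, ?_⟩
    rcases hchain.cases_tail with rfl | ⟨_, -, -, hle, -⟩
    · exact le_rfl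
    · exact hle
  obtain ⟨η, hη, hpath⟩ := exists_flips_of_chain hN hNδ (fun _ hz => hz.1) hP
    (Relation.ReflTransGen.mono (fun _ _ h => ⟨⟨h.1, h.2.1⟩, h.2.2⟩) _ _ hchain)
  obtain ⟨i, hi, rfl⟩ := exists_eq_minimum hq hβ hy hmin
  obtain ⟨τ, hτ⟩ := hm.nonempty_metastableSet hi hN
  obtain ⟨η', hη', hpath'⟩ := exists_flips_near (σ := η) (τ := τ) (hP _ hyZ)
    (hη.trans (by linarith)) (by rw [show empirical τ = m N i from hτ]; exact hmN i hi)
  exact ⟨i, hi, η', (empirical_congr hη').trans hτ, hpath.trans hpath'⟩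

end IsLatticeApprox

section Bounds

variable {N q : ℕ} {β : ℝ≥0}

lemma exists_le_mul_classWeight_of_flips (hN : 0 < N) (hβ : 0 < β) {ε : ℝ} (hε : 0 ≤ ε)
    {σ η : Config N q} (h : Relation.ReflTransGen (FlipInto
      {τ | freeEnergy β (empirical τ) ≤ freeEnergy β (empirical σ) + ε}) σ η) :
    ∃ (L : ℕ) (p : ℕ → Config N q), L ≤ (N + 1) ^ q ∧ p 0 = σ ∧
      colourCount (p L) = colourCount η ∧ (∀ k < L, hammingDist (p k) (p (k + 1)) = 1) ∧
      ∀ k ≤ L, classWeight β σ ≤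
        Real.exp (β * N * ε + 2 * entropyError β q N) * classWeight β (p k) := by
  obtain ⟨L, p, hL, hp0, hpL, hstep, hp⟩ := exists_short_path (fun τ hτ g => by
    rwa [Set.mem_ofPred_eq, empirical_congr (colourCount_comp_perm τ g)])
    (Set.mem_ofPred_eq.symm ▸ le_add_of_nonneg_right hε) h
  refine ⟨L, p, hL, hp0, hpL, hstep, fun k hk => ?_⟩
  have hle : freeEnergy β (empirical (p k)) ≤ freeEnergy β (empirical σ) + ε := hp k hk
  calc classWeight β σ
      ≤ Real.exp (-(β * N * freeEnergy β (empirical σ)) + entropyError β q N) :=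
        classWeight_le_exp hN hβ σ
    _ = Real.exp (β * N * ε + 2 * entropyError β q N) *
          Real.exp (-(β * N * (freeEnergy β (empirical σ) + ε)) - entropyError β q N) := by
        rw [← Real.exp_add]
        ring_nf
    _ ≤ Real.exp (β * N * ε + 2 * entropyError β q N) *
          Real.exp (-(β * N * freeEnergy β (empirical (p k))) - entropyError β q N) := by gcongr
    _ ≤ _ := mul_le_mul_of_nonneg_left (exp_le_classWeight hN hβ (p k)) (Real.exp_pos _).le

variable {X U : Set (Config N q)} {ε : ℝ}

lemma setWeight_le_mul_dirichletForm (hN : 0 < N) (hq : 0 < q) (hβ : 0 < β) (hε : 0 ≤ ε)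
    (hU : ∀ η ∈ U, ∀ τ, colourCount τ = colourCount η → τ ∈ U)
    (hpath : ∀ σ ∈ X, ∃ η ∈ U, Relation.ReflTransGen (FlipInto
      {τ | freeEnergy β (empirical τ) ≤ freeEnergy β (empirical σ) + ε}) σ η)
    {f : Config N q → ℝ} (hfX : ∀ σ ∈ X, f σ = 1) (hfU : ∀ σ ∈ U, f σ = 0) :
    setWeight β meanFieldHamiltonian X ≤
      2 * N * q * ((N : ℝ) + 1) ^ (3 * q) * Real.exp (β * N * ε + 2 * entropyError β q N) *
        dirichletForm (conductance β meanFieldHamiltonian) f := by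
  set D := dirichletForm (conductance β meanFieldHamiltonian) f
  set K := Real.exp (β * N * ε + 2 * entropyError β q N)
  have hD : 0 ≤ D := dirichletForm_nonneg (conductance_nonneg β _) f
  have hclass (σ) (hσ : σ ∈ X) : setWeight β meanFieldHamiltonian (X ∩ colourClass σ) ≤
      K * (2 * N * q * (((N : ℝ) + 1) ^ q) ^ 2 * D) := by
    obtain ⟨η, hη, hflips⟩ := hpath σ hσ
    obtain ⟨L, p, hL, rfl, hpL, hstep, hlevel⟩ := exists_le_mul_classWeight_of_flips hN hβ hε hflips
    have hL' : (L : ℝ) ≤ ((N : ℝ) + 1) ^ q := by exact_mod_cast hL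
    refine (setWeight_inter_colourClass_le_of_path hN hq (Real.exp_pos _).le hfX hstep
      (fun g => hfU _ (hU η hη _ ((colourCount_comp_perm _ g).trans hpL))) hlevel).trans ?_
    gcongr
  refine (setWeight_le_of_inter_colourClass_le (by positivity) hclass).trans_eq ?_
  ring

lemma le_escapeProb_of_flips (hN : 0 < N) (hq : 0 < q) (hβ : 0 < β) (hε : 0 ≤ ε)
    (hX : X.Nonempty) (hXU : Disjoint X U)
    (hU : ∀ η ∈ U, ∀ τ, colourCount τ = colourCount η → τ ∈ U)
    (hpath : ∀ σ ∈ X, ∃ η ∈ U, Relation.ReflTransGen (FlipInto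
      {τ | freeEnergy β (empirical τ) ≤ freeEnergy β (empirical σ) + ε}) σ η) :
    ENNReal.ofReal (2 * N * q * ((N : ℝ) + 1) ^ (3 * q) *
      Real.exp (β * N * ε + 2 * entropyError β q N))⁻¹ ≤
        escapeProb β meanFieldHamiltonian X U := by
  have : (0 : ℝ) < N := by exact_mod_cast hN
  have : (0 : ℝ) < q := by exact_mod_cast hq
  rw [escapeProb_eq_capacity β _ hX hXU]
  refine ENNReal.ofReal_le_ofReal ((le_div_iff₀ (setWeight_pos β _ hX)).2 ?_)
  refine le_capacity hXU fun f hfX hfU => (inv_mul_le_iff₀ (by positivity)).2 ?_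
  exact setWeight_le_mul_dirichletForm hN hq hβ hε hU hpath hfX hfU

lemma capacity_le_setWeight_annulus {H : Config N q → ℝ} {x : Fin q → ℝ} {r s : ℝ}
    (hs : s + 1 / N ≤ r) {A B : Set (Config N q)} (hA : ∀ σ ∈ A, dist (empirical σ) x < r)
    (hB : ∀ σ ∈ B, r ≤ dist (empirical σ) x) :
    capacity (conductance β H) A B ≤
      setWeight β H {σ | dist (empirical σ) x ∈ Set.Icc s r} := by
  set V : Set (Config N q) := {σ | dist (empirical σ) x < r}
  have hVA (σ) (hσ : σ ∈ A) : V.indicator (1 : Config N q → ℝ) σ = 1 :=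
    Set.indicator_of_mem (s := V) (hA σ hσ) _
  have hVB (σ) (hσ : σ ∈ B) : V.indicator (1 : Config N q → ℝ) σ = 0 :=
    Set.indicator_of_notMem (s := V) (hB σ hσ).not_gt _
  refine (capacity_le_dirichletForm (conductance_nonneg β H) hVA hVB).trans
    (dirichletForm_indicator_le_setWeight fun σ hσ η hη hflip => ⟨?_, le_of_lt hσ⟩)
  have hη' : r ≤ dist (empirical η) x := not_lt.1 hη
  linarith [dist_triangle_left (empirical η) x (empirical σ),
    dist_empirical_le_of_hammingDist_eq_one hflip]

lemma setWeight_le_exp_of_le_freeEnergy (hN : 0 < N) (hβ : 0 < β) {a : ℝ}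
    (h : ∀ σ ∈ X, a ≤ freeEnergy β (empirical σ)) :
    setWeight β meanFieldHamiltonian X ≤
      ((N : ℝ) + 1) ^ q * Real.exp (-(β * N * a) + entropyError β q N) := by
  refine setWeight_le_of_inter_colourClass_le (Real.exp_pos _).le fun σ hσ => ?_
  calc setWeight β meanFieldHamiltonian (X ∩ colourClass σ) ≤ classWeight β σ :=
        setWeight_inter_colourClass_le hN X σ
    _ ≤ Real.exp (-(β * N * freeEnergy β (empirical σ)) + entropyError β q N) :=
        classWeight_le_exp hN hβ σ
    _ ≤ Real.exp (-(β * N * a) + entropyError β q N) := by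
        gcongr
        exact h σ hσ

lemma escapeProb_colourClass_le (hN : 0 < N) (hβ : 0 < β) {x : Fin q → ℝ} {r s a : ℝ}
    (hs : s + 1 / N ≤ r) (ha : ∀ y ∈ stdSimplex ℝ (Fin q), dist y x ∈ Set.Icc s r →
      a ≤ freeEnergy β y) {σ : Config N q} (hσ : dist (empirical σ) x < r)
    {B : Set (Config N q)} (hB : ∀ η ∈ B, r ≤ dist (empirical η) x) :
    escapeProb β meanFieldHamiltonian (colourClass σ) B ≤
      ENNReal.ofReal (((N : ℝ) + 1) ^ q * Real.exp (2 * entropyError β q N) *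
        Real.exp (-(β * N * (a - freeEnergy β (empirical σ))))) := by
  have hclass (η) (hη : η ∈ (colourClass σ : Set (Config N q))) : dist (empirical η) x < r := by
    rwa [empirical_congr (mem_colourClass.1 hη)]
  have hne : (colourClass σ : Set (Config N q)).Nonempty := ⟨σ, mem_colourClass.2 rfl⟩
  have hdisj : Disjoint (colourClass σ : Set (Config N q)) B :=
    Set.disjoint_left.2 fun η hη hηB => (hclass η hη).not_ge (hB η hηB)
  rw [escapeProb_eq_capacity β _ hne hdisj]
  refine ENNReal.ofReal_le_ofReal ((div_le_iff₀ (setWeight_pos β _ hne)).2 ?_)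
  rw [setWeight_colourClass hN]
  calc capacity (conductance β meanFieldHamiltonian) (colourClass σ) B
      ≤ setWeight β meanFieldHamiltonian {η | dist (empirical η) x ∈ Set.Icc s r} :=
        capacity_le_setWeight_annulus hs hclass hB
    _ ≤ ((N : ℝ) + 1) ^ q * Real.exp (-(β * N * a) + entropyError β q N) :=
        setWeight_le_exp_of_le_freeEnergy hN hβ fun η hη =>
          ha _ (empirical_mem_stdSimplex hN η) hη
    _ = ((N : ℝ) + 1) ^ q * Real.exp (2 * entropyError β q N) *
          Real.exp (-(β * N * (a - freeEnergy β (empirical σ)))) *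
          Real.exp (-(β * N * freeEnergy β (empirical σ)) - entropyError β q N) := by
        simp only [mul_assoc, ← Real.exp_add]
        ring_nf
    _ ≤ _ := mul_le_mul_of_nonneg_left (exp_le_classWeight hN hβ σ) (by positivity)

end Bounds

lemma exp_two_mul_entropyError (β : ℝ≥0) (q N : ℕ) :
    Real.exp (2 * entropyError β q N) =
      Real.exp (2 * (q + 1) + β) * ((N : ℝ) + 1) ^ (2 * (q + 1)) := by
  have hN : (0 : ℝ) < N + 1 := by positivity
  rw [← Real.exp_log (pow_pos hN _), ← Real.exp_add, Real.log_pow, entropyError]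
  push_cast
  ring_nf

lemma eventually_mul_pow_mul_exp_entropyError_le (β : ℝ≥0) (q : ℕ) (a : ℝ) (n : ℕ) {δ : ℝ}
    (hδ : 0 < δ) :
    ∀ᶠ N : ℕ in atTop,
      a * ((N : ℝ) + 1) ^ n * Real.exp (2 * entropyError β q N) ≤ Real.exp (δ * N) := by
  have hlittleO := ((isLittleO_pow_exp_pos_mul_atTop (n + 2 * (q + 1)) hδ).const_mul_left
    (a * Real.exp (2 * (q + 1) + β) * Real.exp δ)).comp_tendsto
      (tendsto_atTop_add_const_right _ (1 : ℝ) tendsto_natCast_atTop_atTop)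
  filter_upwards [hlittleO.def one_pos] with N hN
  refine le_of_mul_le_mul_right ?_ (Real.exp_pos δ)
  calc a * ((N : ℝ) + 1) ^ n * Real.exp (2 * entropyError β q N) * Real.exp δ
      = a * Real.exp (2 * (q + 1) + β) * Real.exp δ * ((N : ℝ) + 1) ^ (n + 2 * (q + 1)) := by
        rw [exp_two_mul_entropyError, pow_add]
        ring
    _ ≤ Real.exp (δ * (N + 1)) := by
        simpa only [Function.comp_apply, Real.norm_eq_abs, Real.abs_exp, one_mul] using
          (le_abs_self _).trans hN
    _ = Real.exp (δ * N) * Real.exp δ := by rw [← Real.exp_add, mul_add, mul_one]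

section MeanField

variable {q : ℕ} {β : ℝ≥0}

lemma eventually_le_escapeProb (hq : 2 ≤ q) (hβ : betaOne q < β)
    {m : ℕ → Fin (q + 1) → Fin q → ℝ} (hm : IsLatticeApprox q β m) {ε : ℝ} (hε : 0 < ε) :
    ∀ᶠ N in atTop, ∀ X : Set (Config N q), X.Nonempty →
      X ⊆ (⋃ i ∈ indexSet q β, metastableSet m N i)ᶜ →
      ENNReal.ofReal (Real.exp (-(ε * N))) ≤
        escapeProb β meanFieldHamiltonian X (⋃ i ∈ indexSet q β, metastableSet m N i) := by
  have hβ0 : (0 : ℝ) < β := (exists_orderEq_neg hq hβ).1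
  have hε' : 0 < ε / (2 * β) := by positivity
  filter_upwards [hm.eventually_exists_descending_path hq hβ hε', eventually_gt_atTop 0,
    eventually_mul_pow_mul_exp_entropyError_le β q (2 * q) (3 * q + 1) (half_pos hε)]
    with N hpath hN hgrowth X hX hXU
  have : (0 : ℝ) < N := by exact_mod_cast hN
  have : (0 : ℝ) < q := by exact_mod_cast zero_lt_two.trans_le hq
  refine le_trans (ENNReal.ofReal_le_ofReal ?_) (le_escapeProb_of_flips hN
    (zero_lt_two.trans_le hq) hβ0 hε'.le hX (Set.subset_compl_iff_disjoint_right.1 hXU) ?_ ?_)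
  · rw [Real.exp_neg]
    gcongr
    calc 2 * N * q * ((N : ℝ) + 1) ^ (3 * q) *
          Real.exp (β * N * (ε / (2 * β)) + 2 * entropyError β q N)
        = 2 * q * (((N : ℝ) + 1) ^ (3 * q) * N) * Real.exp (2 * entropyError β q N) *
            Real.exp (ε / 2 * N) := by
          rw [mul_assoc _ (Real.exp (2 * _)), ← Real.exp_add,
            show β * N * (ε / (2 * β)) = ε / 2 * N by field_simp, add_comm (ε / 2 * N)]
          ring
      _ ≤ 2 * q * ((N : ℝ) + 1) ^ (3 * q + 1) * Real.exp (2 * entropyError β q N) *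
            Real.exp (ε / 2 * N) := by
          rw [pow_succ]
          gcongr
          exact le_add_of_nonneg_right zero_le_one
      _ ≤ Real.exp (ε / 2 * N) * Real.exp (ε / 2 * N) := by gcongr
      _ = Real.exp (ε * N) := by
          rw [← Real.exp_add]
          ring_nf
  · intro η hη τ hτ
    obtain ⟨i, hi, hηi⟩ := Set.mem_iUnion₂.1 hη
    exact Set.mem_biUnion hi ((empirical_congr hτ).trans hηi)
  · intro σ _
    obtain ⟨i, hi, η, hη, hflips⟩ := hpath σ
    exact ⟨η, Set.mem_biUnion hi hη, hflips⟩

lemma exists_eventually_escapeProb_le (hq : 2 ≤ q) (hβ : betaOne q < β) {j : Fin (q + 1)}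
    (hj : j ∈ indexSet q β) :
    ∃ c > 0, ∀ m, IsLatticeApprox q β m → ∀ᶠ N : ℕ in atTop,
      escapeProb β meanFieldHamiltonian (metastableSet m N j)
        ((⋃ i ∈ indexSet q β, metastableSet m N i) \ metastableSet m N j) ≤
          ENNReal.ofReal (Real.exp (-(c * N))) := by
  have hβ0 : (0 : ℝ) < β := (exists_orderEq_neg hq hβ).1
  obtain ⟨r, hr, c, hc, hsep, hshell⟩ := exists_shell_minimum hq hβ hj
  set x := minimum q β j
  refine ⟨β * c / 4, by positivity, fun m hm => ?_⟩
  have hm_j := hm.tendsto hq hβ hj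
  have henergy : ∀ᶠ N in atTop, freeEnergy β (m N j) < freeEnergy β x + c / 2 :=
    ((continuous_freeEnergy β).continuousAt.tendsto.comp hm_j).eventually_lt_const (by linarith)
  have hfar : ∀ᶠ N in atTop, ∀ i ∈ indexSet q β, i ≠ j → r < dist (m N i) x := by
    simp only [eventually_all_finset, eventually_imp_distrib_left]
    exact fun i hi hij => ((hm.tendsto hq hβ hi).dist tendsto_const_nhds).eventually_const_lt
      (by linarith [hsep i hij])
  filter_upwards [henergy, hfar, Metric.tendsto_nhds.1 hm_j r hr, eventually_gt_atTop 0,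
    tendsto_one_div_atTop_nhds_zero_nat.eventually_lt_const (half_pos hr),
    eventually_mul_pow_mul_exp_entropyError_le β q 1 q (δ := β * c / 4) (by positivity)]
    with N henergyN hfarN hnear hN hNr hgrowth
  obtain ⟨σ, hσ : empirical σ = m N j⟩ := hm.nonempty_metastableSet hj hN
  have hset : metastableSet m N j = colourClass σ := by
    ext η
    rw [Finset.mem_coe, mem_colourClass, ← empirical_eq_iff hN, hσ]
    rfl
  refine (hset ▸ escapeProb_colourClass_le hN hβ0 (by linarith) hshell (hσ ▸ hnear) ?_).trans
    (ENNReal.ofReal_le_ofReal ?_)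
  · rintro η ⟨hη, hηj⟩
    obtain ⟨i, hi, hηi : empirical η = m N i⟩ := Set.mem_iUnion₂.1 hη
    rw [hηi]
    exact (hfarN i hi (by rintro rfl; exact hηj hηi)).le
  · rw [one_mul] at hgrowth
    calc _ ≤ Real.exp (β * c / 4 * N) * Real.exp (-(β * N * (c / 2))) := by
          gcongr
          rw [hσ]
          linarith
      _ = Real.exp (-(β * c / 4 * N)) := by
          rw [← Real.exp_add]
          ring_nf

lemma IsMetastable.of_escapeProb_le {N : ℕ} {ι : Type*} {H : Config N q → ℝ} {I : Finset ι}
    {M : ι → Set (Config N q)} {n d ρ : ℝ} (hM : ∀ i ∈ I, (M i).Nonempty)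
    (hdisj : (I : Set ι).PairwiseDisjoint M) (hd : 0 < d)
    (hnum : ∀ j ∈ I, escapeProb β H (M j) ((⋃ i ∈ I, M i) \ M j) ≤ ENNReal.ofReal n)
    (hden : ∀ X : Set (Config N q), X.Nonempty → X ⊆ (⋃ i ∈ I, M i)ᶜ →
      ENNReal.ofReal d ≤ escapeProb β H X (⋃ i ∈ I, M i))
    (hρ : I.card * n / d ≤ ρ) : IsMetastable β H I M ρ := by
  refine ⟨hM, hdisj, ?_⟩
  calc _ ≤ (I.card : ℝ≥0∞) * ENNReal.ofReal n / ENNReal.ofReal d := by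
        gcongr
        · exact iSup₂_le hnum
        · exact le_iInf₂ fun X hX => hden X hX.1 hX.2
    _ = ENNReal.ofReal (I.card * n / d) := by
        rw [← ENNReal.ofReal_natCast, ← ENNReal.ofReal_mul (Nat.cast_nonneg _),
          ENNReal.ofReal_div_of_pos hd]
    _ ≤ ENNReal.ofReal ρ := ENNReal.ofReal_le_ofReal hρ

lemma exists_uniform_escapeProb_le (hq : 2 ≤ q) (hβ : betaOne q < β) :
    ∃ c > 0, ∀ m, IsLatticeApprox q β m → ∀ᶠ N : ℕ in atTop, ∀ j ∈ indexSet q β,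
      escapeProb β meanFieldHamiltonian (metastableSet m N j)
        ((⋃ i ∈ indexSet q β, metastableSet m N i) \ metastableSet m N j) ≤
          ENNReal.ofReal (Real.exp (-(c * N))) := by
  choose! c hc hbound using fun j hj => exists_eventually_escapeProb_le hq hβ (j := j) hj
  obtain ⟨c₀, hc₀, hle⟩ : ∃ c₀ > 0, ∀ j ∈ indexSet q β, c₀ ≤ c j := by
    rcases (indexSet q β).eq_empty_or_nonempty with hempty | hne
    · exact ⟨1, one_pos, by simp [hempty]⟩
    · obtain ⟨j, hj, hmin⟩ := Finset.exists_min_image _ c hne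
      exact ⟨c j, hc j hj, hmin⟩
  refine ⟨c₀, hc₀, fun m hm => (eventually_all_finset _).2 fun j hj => ?_⟩
  filter_upwards [hbound j hj m hm] with N hN
  refine hN.trans (ENNReal.ofReal_le_ofReal ?_)
  gcongr
  exact hle j hj

lemma exists_eventually_isMetastable_meanField (hq : 2 ≤ q) (hβ : betaOne q < β) :
    ∃ k > 0, ∀ m, IsLatticeApprox q β m → ∀ᶠ N : ℕ in atTop,
      IsMetastable β (meanFieldHamiltonian (N := N) (q := q)) (indexSet q β) (metastableSet m N)
        (Real.exp (-k * N)) := by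
  obtain ⟨c, hc, hnum⟩ := exists_uniform_escapeProb_le hq hβ
  have hc3 : 0 < c / 3 := by positivity
  refine ⟨c / 3, hc3, fun m hm => ?_⟩
  have hcard : ∀ᶠ N : ℕ in atTop, ((indexSet q β).card : ℝ) ≤ Real.exp (c / 3 * N) :=
    (Real.tendsto_exp_atTop.comp
      (tendsto_natCast_atTop_atTop.const_mul_atTop hc3)).eventually_ge_atTop _
  filter_upwards [hnum m hm, eventually_le_escapeProb hq hβ hm hc3, hcard,
    hm.eventually_pairwiseDisjoint_metastableSet hq hβ, eventually_gt_atTop 0]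
    with N hnumN hdenN hcardN hdisj hN
  refine .of_escapeProb_le (fun i hi => hm.nonempty_metastableSet hi hN) hdisj (Real.exp_pos _)
    hnumN hdenN ((div_le_iff₀ (Real.exp_pos _)).2 ?_)
  calc (indexSet q β).card * Real.exp (-(c * N))
      ≤ Real.exp (c / 3 * N) * Real.exp (-(c * N)) := by gcongr
    _ = Real.exp (-(c / 3) * N) * Real.exp (-(c / 3 * N)) := by
        rw [← Real.exp_add, ← Real.exp_add]
        ring_nf

end MeanField

lemma meanFieldMetastable_iff_eventually {q : ℕ} {β : ℝ≥0} {m : ℕ → Fin (q + 1) → Fin q → ℝ}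
    {k : ℝ} : MeanFieldMetastable q β m k ↔ ∀ᶠ N : ℕ in atTop,
      IsMetastable β (meanFieldHamiltonian (N := N) (q := q)) (indexSet q β) (metastableSet m N)
        (Real.exp (-k * N)) :=
  (atTop_basis_Ioi.eventually_iff.trans <| by simp [MeanFieldMetastable]).symm

end Potts

end

theorem theorem2_general {Ω : Type*} [MeasurableSpace Ω] (P : Measure Ω) [IsProbabilityMeasure P]
    (J : ℕ → ℕ → Ω → ℝ)
    (hJ_indep : iIndepFun (fun p : {p : ℕ × ℕ // p.1 < p.2} => J p.1.1 p.1.2) P)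
    (hJ_ident : ∀ i j, i < j → IdentDistrib (J i j) (J 0 1) P P)
    (hJ_mean : ∫ ω, J 0 1 ω ∂P = 1)
    (hJ_exp : (0 : ℝ) ∈ interior (integrableExpSet (J 0 1) P)) (q : ℕ) (β : ℝ≥0) :
    (2 ≤ q → Potts.betaOne q < β → ∃ k₁ : ℝ, 0 < k₁ ∧ ∀ m : ℕ → Fin (q + 1) → Fin q → ℝ,
      Potts.IsLatticeApprox q β m → Potts.MeanFieldMetastable q β m k₁) ∧
    ∀ {ι : Type*} (I : Finset ι) (M : ∀ N, ι → Set (Potts.Config N q)) (k₁ k₂ : ℝ), k₂ < k₁ →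
      (∀ᶠ N : ℕ in atTop,
        Potts.IsMetastable β Potts.meanFieldHamiltonian I (M N) (Real.exp (-k₁ * N))) →
      ∀ᵐ ω ∂P, ∀ᶠ N : ℕ in atTop,
        Potts.IsMetastable β (Potts.hamiltonian fun i j => J i j ω) I (M N)
          (Real.exp (-k₂ * N)) := by
  refine ⟨fun hq hβ => ?_, fun I M k₁ k₂ hk hM =>
    Potts.ae_eventually_isMetastable hJ_indep hJ_ident hJ_mean hJ_exp hk hM⟩
  obtain ⟨k₁, hk₁, h⟩ := Potts.exists_eventually_isMetastable_meanField hq hβ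
  exact ⟨k₁, hk₁, fun m hm => Potts.meanFieldMetastable_iff_eventually.2 (h m hm)⟩

theorem theorem2 {Ω : Type*} [MeasurableSpace Ω] (P : Measure Ω) [IsProbabilityMeasure P]
    (J : ℕ → ℕ → Ω → ℝ)
    (hJ_meas : ∀ i j, i < j → Measurable (J i j))
    (hJ_indep : iIndepFun (fun p : {p : ℕ × ℕ // p.1 < p.2} => J p.1.1 p.1.2) P)
    (hJ_ident : ∀ i j, i < j → IdentDistrib (J i j) (J 0 1) P P)
    (hJ_mean : ∫ ω, J 0 1 ω ∂P = 1)
    (hJ_exp : (0 : ℝ) ∈ interior (integrableExpSet (J 0 1) P))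
    (q : ℕ) (hq : 2 ≤ q) (β : ℝ≥0) (hβ : Potts.betaOne q < β) :
    (∃ k₁ : ℝ, 0 < k₁ ∧ ∀ m : ℕ → Fin (q + 1) → Fin q → ℝ, Potts.IsLatticeApprox q β m →
      Potts.MeanFieldMetastable q β m k₁) ∧
    ∀ m : ℕ → Fin (q + 1) → Fin q → ℝ, Potts.IsLatticeApprox q β m →
      ∀ k₁ : ℝ, 0 < k₁ → Potts.MeanFieldMetastable q β m k₁ →
        ∀ k₂ : ℝ, 0 < k₂ → k₂ < k₁ →
          ∀ᵐ ω ∂P, ∀ᶠ N : ℕ in atTop, ω ∈ Potts.metastableEvent J q β m k₂ N := by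
  have h := theorem2_general P J hJ_indep hJ_ident hJ_mean hJ_exp q β
  exact ⟨h.1 hq hβ, fun m _ k₁ _ hk₁ k₂ _ hk => h.2 (Potts.indexSet q β) (Potts.metastableSet m)
    k₁ k₂ hk (Potts.meanFieldMetastable_iff_eventually.1 hk₁)⟩
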